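/- Setting. Let $(\Omega,\mathfrak F,\mathbb P)$ be a probability space (complete or not) with a jointly measurable, measure preserving, ergodic flow $(\theta_t)_{t\in\mathbb R}$. Let $1<p<\infty$, $1/p+1/q=1$, and let $X=\mathbb R\times L_p([-1,0],\mathbb R)$ with norm $\|u\|=|u_1|+\|u_2\|_p$ and positive cone $X^+=\{u: u_1\ge 0,\ u_2\ge 0 \text{ a.e.}\}$; write $u\le v$ for $v-u\in X^+$. Let $a,b\colon\Omega\to\mathbb R$ be measurable with (S1) $a\in L_1(\mathbb P)$ and $\omega\mapsto \ln^+\int_0^1|b(\theta_r\omega)|^q\,dr$ in $L_1(\mathbb P)$; (S2) $b(\omega)\ge 0$ for all $\omega\in\Omega$. Redefine $a$ to be $0$ on the set of those $\omega$ for which $t\mapsto a(\theta_t\omega)$ is not in $L_{1,\mathrm{loc}}(\mathbb R)$, and $b$ to be $0$ on the set of those $\omega$ for which $t\mapsto b(\theta_t\omega)$ is not in $L_{q,\mathrm{loc}}(\mathbb R)$. Proposition. These redefinitions change $a$ and $b$ only on sets of $\mathbb P$-measure zero. For the redefined coefficients, for every $\omega\in\Omega$ and $u=(u_1,u_2)\in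 X$ the problem $$z'(t)=a(\theta_t\omega)z(t)+b(\theta_t\omega)z(t-1)\ \ (t>0),\qquad z=u_2 \text{ on } [-1,0),\qquad z(0)=u_1$$ has a unique Carathéodory solution $z(\cdot,\omega,u)$ (locally absolutely continuous on $[0,\infty)$, equation a.e.), and $U_\omega(t)u=(z(t,\omega,u),z_t(\omega,u))$, with $z_t(\omega,u)(s)=z(t+s,\omega,u)$ for $s\in[-1,0]$, defines a measurable linear skew-product semiflow $\Phi$ on $X$: the map $(t,\omega,u)\mapsto U_\omega(t)u$ from $[0,\infty)\times\Omega\times X$ to $X$ is jointly measurable, every $U_\omega(t)$ is a bounded linear operator, $U_\omega(0)=\mathrm{Id}$, and $U_{\theta_s\omega}(t)\circ U_\omega(s)=U_\omega(t+s)$ for $s,t\ge0$. Moreover, for time $T=2$: (A1) the functions $\omega\mapsto\sup_{0\le s\le 2}\ln^+\|U_\omega(s)\|$ and $\omega\mapsto\sup_{0\le s\le 2}\ln^+\|U_{\theta_s\omega}(2-s)\|$ are finite everywhere and belong to $L_1(\mathbb P)$. (A2) If $u_1\le u_2$ in $X$, then $U_\omega(t)u_1\le U_\omega(t)u_2$ for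 all $\omega\in\Omega$ and $t\ge0$. (A3) Let $\mathbf e\in X$ have both components constantly equal to $1/2$, and let $$\varkappa(\omega)=\exp\Bigl(\int_1^2|a(\theta_r\omega)|\,dr\Bigr)\Bigl[1+\int_1^2\exp\Bigl(-\int_{s-1}^s a(\theta_r\omega)\,dr\Bigr)b(\theta_s\omega)\,ds\Bigr].$$ Then $\mathbf e\in X^+$, $\|\mathbf e\|=1$, $U_\omega(2)\mathbf e\ne0$ for all $\omega$, $\varkappa\colon\Omega\to[1,\infty)$ is measurable, $\ln\varkappa\in L_1(\mathbb P)$, $\ln^+\ln\varkappa\in L_1(\mathbb P)$, and for all $\omega$ and all nonzero $u\in X^+$ either $U_\omega(2)u=0$, or $U_\omega(2)u\ne0$ and there is $\beta(\omega,u)>0$ with $\beta(\omega,u)\,\mathbf e\le U_\omega(2)u\le\varkappa(\omega)\beta(\omega,u)\,\mathbf e$. Finally, $\Phi$ has a generalized principal Lyapunov exponent, and every such exponent $\bar\lambda_1$ satisfies $\bar\lambda_1\ge\int_\Omega a\,d\mathbb P$. Here $\bar\lambda_1\in[-\infty,\infty)$ is a generalized principal Lyapunov exponent of $\Phi$ if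 there are a measurable set $\widetilde\Omega\subset\Omega$, invariant under all $\theta_t$, with $\mathbb P(\widetilde\Omega)=1$, and a measurable $w\colon\widetilde\Omega\to X^+\setminus\{0\}$ such that for every $\omega\in\widetilde\Omega$: $U_\omega(t)\,\mathrm{span}\{w(\omega)\}=\mathrm{span}\{w(\theta_t\omega)\}$ for all $t>0$; $\lim_{t\to\infty}\frac1t\ln\|U_\omega(t)w(\omega)\|=\bar\lambda_1$; and $\limsup_{t\to\infty}\frac1t\ln\|U_\omega(t)u\|\le\bar\lambda_1$ for every $u\in X$ with $U_\omega(1)u\ne0$ (with $\ln 0=-\infty$). -/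

import Mathlib

open MeasureTheory Filter Topology Set
open scoped NNReal ENNReal

noncomputable section

namespace RandomDelay

/-! ### Measurable linear skew-product semiflows

A metric dynamical system `θ` on `Ω` is an additive action of `ℝ` on `Ω`, `θ_t ω = t +ᵥ ω`, that is
jointly measurable and measure preserving. -/

/-- A measurable linear skew-product semiflow on `X` covering the action `(t, ω) ↦ t +ᵥ ω`. -/
structure SkewProductSemiflow (Ω X : Type*) [MeasurableSpace Ω] [AddAction ℝ Ω]
    [NormedAddCommGroup X] [NormedSpace ℝ X] [MeasurableSpace X] where
  /-- the operators `U_ω(t)`, `t ≥ 0` -/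
  U : Ω → ℝ≥0 → X →L[ℝ] X
  measurable_U : Measurable (fun x : ℝ≥0 × Ω × X => U x.2.1 x.1 x.2.2)
  U_zero : ∀ ω, U ω 0 = ContinuousLinearMap.id ℝ X
  cocycle : ∀ (ω : Ω) (t s : ℝ≥0),
    (U ((s : ℝ) +ᵥ ω) t).comp (U ω s) = U ω (t + s)

/-- `ln⁺ x = max (ln x) 0` on `[0, ∞]`. -/
def lnPlus (x : ℝ≥0∞) : ℝ≥0∞ := (ENNReal.log x).toENNReal

/-- `f : Ω → [0, ∞]` takes only finite values and belongs to `L₁(P)`. -/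
def FiniteL1 {Ω : Type*} [MeasurableSpace Ω] (P : Measure Ω) (f : Ω → ℝ≥0∞) : Prop :=
  (∀ ω, f ω < ∞) ∧ AEMeasurable f P ∧ ∫⁻ ω, f ω ∂P < ∞

section Assumptions

variable {Ω X : Type*} [MeasurableSpace Ω] [AddAction ℝ Ω]
  [NormedAddCommGroup X] [NormedSpace ℝ X] [MeasurableSpace X]

/-- Integrability (A1) for time `T`: both `sup_{0 ≤ s ≤ T} ln⁺ ‖U_ω(s)‖` and
`sup_{0 ≤ s ≤ T} ln⁺ ‖U_{θ_s ω}(T - s)‖` are in `L₁(P)`. -/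
def IntegrabilityA1 (P : Measure Ω) (Φ : SkewProductSemiflow Ω X) (T : ℝ≥0) : Prop :=
  FiniteL1 P (fun ω => ⨆ s ∈ Iic T, lnPlus ‖Φ.U ω s‖ₑ) ∧
  FiniteL1 P (fun ω => ⨆ s ∈ Iic T, lnPlus ‖Φ.U ((s : ℝ) +ᵥ ω) (T - s)‖ₑ)

/-- The order defined by the cone `K`. -/
def ConeLE (K : Set X) (u v : X) : Prop := v - u ∈ K

/-- Positivity (A2). -/
def PositivityA2 (K : Set X) (Φ : SkewProductSemiflow Ω X) : Prop :=
  ∀ (ω : Ω) (t : ℝ≥0) (u₁ u₂ : X), ConeLE K u₁ u₂ → ConeLE K (Φ.U ω t u₁) (Φ.U ω t u₂)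

/-- Focusing (A3) for time `T`, with the vector `e` and the function `κ`. -/
def FocusingA3 (P : Measure Ω) (K : Set X) (Φ : SkewProductSemiflow Ω X) (T : ℝ≥0)
    (e : X) (κ : Ω → ℝ) : Prop :=
  PositivityA2 K Φ ∧
  e ∈ K ∧ ‖e‖ = 1 ∧ (∀ ω, Φ.U ω T e ≠ 0) ∧
  Measurable κ ∧ (∀ ω, 1 ≤ κ ω) ∧
  Integrable (fun ω => Real.posLog (Real.log (κ ω))) P ∧
  ∀ (ω : Ω) (u : X), u ∈ K → u ≠ 0 →
    Φ.U ω T u = 0 ∨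
    (Φ.U ω T u ≠ 0 ∧ ∃ β : ℝ, 0 < β ∧
      ConeLE K (β • e) (Φ.U ω T u) ∧ ConeLE K (Φ.U ω T u) ((κ ω * β) • e))

/-- `lam ∈ [-∞, ∞)` is the generalized principal Lyapunov exponent associated to some family
`E(ω) = span {w(ω)}`, `ω ∈ S`, of generalized principal Floquet subspaces of `Φ`.
Logarithms of norms are taken in `[-∞, ∞]`, with `ln 0 = -∞`. -/
def IsPrincipalLyapunovExponent (P : Measure Ω) (K : Set X) (Φ : SkewProductSemiflow Ω X)
    (lam : EReal) : Prop :=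
  lam < ⊤ ∧ ∃ (S : Set Ω) (w : Ω → X),
    MeasurableSet S ∧ (∀ t : ℝ, (fun ω => t +ᵥ ω) ⁻¹' S = S) ∧ P S = 1 ∧
    Measurable (fun ω : S => w ω) ∧
    ∀ ω ∈ S,
      w ω ∈ K ∧ w ω ≠ 0 ∧
      (∀ t : ℝ≥0, 0 < t →
        (Submodule.span ℝ {w ω}).map (Φ.U ω t).toLinearMap
          = Submodule.span ℝ {w ((t : ℝ) +ᵥ ω)}) ∧
      Tendsto (fun t : ℝ≥0 => ENNReal.log ‖Φ.U ω t (w ω)‖ₑ / (((t : ℝ) : EReal))) atTop (𝓝 lam) ∧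
      ∀ u : X, Φ.U ω 1 u ≠ 0 →
        limsup (fun t : ℝ≥0 => ENNReal.log ‖Φ.U ω t u‖ₑ / (((t : ℝ) : EReal))) atTop ≤ lam

end Assumptions

/-! ### The delay equation `z'(t) = a(θ_t ω) z(t) + b(θ_t ω) z(t - 1)` -/

/-- Lebesgue measure on `[-1, 0]`. -/
abbrev histMeasure : Measure ℝ := volume.restrict (Icc (-1 : ℝ) 0)

/-- `X = ℝ × L_p([-1, 0], ℝ)` with the norm `‖u‖ = |u₁| + ‖u₂‖_p`. -/
abbrev DelaySpace (p : ℝ≥0∞) : Type := WithLp 1 (ℝ × Lp ℝ p histMeasure)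

instance (p : ℝ≥0∞) [Fact (1 ≤ p)] : MeasurableSpace (DelaySpace p) := borel _

instance (p : ℝ≥0∞) [Fact (1 ≤ p)] : BorelSpace (DelaySpace p) := ⟨rfl⟩

/-- The positive cone of `X`. -/
def posCone (p : ℝ≥0∞) : Set (DelaySpace p) :=
  {u | 0 ≤ u.fst ∧ ∀ᵐ s ∂histMeasure, 0 ≤ u.snd s}

/-- The element `(1/2, 1/2)` of `X`. -/
def halfVec (p : ℝ≥0∞) : DelaySpace p :=
  WithLp.toLp 1 ((1 / 2 : ℝ), Lp.const p histMeasure (1 / 2 : ℝ))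

/-- `z : [-1, ∞) → ℝ` is a solution in the sense of Carathéodory of
`z'(t) = α(t) z(t) + β(t) z(t - 1)`, `z = u₂` on `[-1, 0)`, `z(0) = u₁`. -/
def IsDelaySolution {p : ℝ≥0∞} (α β : ℝ → ℝ) (u : DelaySpace p) (z : ℝ → ℝ) : Prop :=
  (∀ᵐ t ∂(volume.restrict (Ico (-1 : ℝ) 0)), z t = u.snd t) ∧
  z 0 = u.fst ∧
  (∀ T : ℝ, 0 < T → AbsolutelyContinuousOnInterval z 0 T) ∧
  ∀ᵐ t ∂(volume.restrict (Ioi (0 : ℝ))), HasDerivAt z (α t * z t + β t * z (t - 1)) t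

section Coefficients

variable {Ω : Type*} [AddAction ℝ Ω]

open Classical in
/-- The coefficient `a`, set to `0` on the invariant set of those `ω` for which `t ↦ a(θ_t ω)` is
not locally integrable. -/
def normA (a : Ω → ℝ) (ω : Ω) : ℝ :=
  if LocallyIntegrable (fun t : ℝ => a (t +ᵥ ω)) volume then a ω else 0

open Classical in
/-- The coefficient `b`, set to `0` on the invariant set of those `ω` for which `t ↦ b(θ_t ω)` is
not in `L_{q,loc}(ℝ)`. -/
def normB (q : ℝ≥0∞) (b : Ω → ℝ) (ω : Ω) : ℝ :=
  if ∀ x y : ℝ, MemLp (fun t : ℝ => b (t +ᵥ ω)) q (volume.restrict (Icc x y)) then b ω else 0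

/-- Assumption (S1). -/
def AssumptionS1 [MeasurableSpace Ω] (P : Measure Ω) (q : ℝ≥0∞) (a b : Ω → ℝ) : Prop :=
  Measurable a ∧ Measurable b ∧ Integrable a P ∧
  ∫⁻ ω, lnPlus (∫⁻ r in Icc (0 : ℝ) 1, ‖b (r +ᵥ ω)‖ₑ ^ q.toReal) ∂P < ∞

/-- Assumption (S2). -/
def AssumptionS2 (b : Ω → ℝ) : Prop := ∀ ω, 0 ≤ b ω

/-- `Φ` is generated by the delay equation with coefficients `a`, `b`: every initial value problem
has a solution, and every solution `z` satisfies `U_ω(t) u = (z(t), z_t)`, where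
`z_t(s) = z(t + s)` on `[-1, 0]`; in particular solutions are unique. -/
def IsGeneratedBy {p : ℝ≥0∞} [Fact (1 ≤ p)] [MeasurableSpace Ω]
    (Φ : SkewProductSemiflow Ω (DelaySpace p)) (a b : Ω → ℝ) : Prop :=
  ∀ (ω : Ω) (u : DelaySpace p),
    (∃ z : ℝ → ℝ, IsDelaySolution (fun t => a (t +ᵥ ω)) (fun t => b (t +ᵥ ω)) u z) ∧
    ∀ z : ℝ → ℝ, IsDelaySolution (fun t => a (t +ᵥ ω)) (fun t => b (t +ᵥ ω)) u z →
      ∀ t : ℝ≥0, (Φ.U ω t u).fst = z t ∧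
        ∀ᵐ s ∂histMeasure, (Φ.U ω t u).snd s = z (t + s)

/-- `c(ω) = exp ∫₀¹ |a(θ_r ω)| dr`. -/
def cFun (a : Ω → ℝ) (ω : Ω) : ℝ := Real.exp (∫ r in (0 : ℝ)..1, |a (r +ᵥ ω)|)

/-- `κ(ω) = c(θ₁ ω) [1 + ∫₁² exp(- ∫_{s-1}^s a(θ_r ω) dr) b(θ_s ω) ds]`. -/
def kappa (a b : Ω → ℝ) (ω : Ω) : ℝ :=
  cFun a ((1 : ℝ) +ᵥ ω) *
    (1 + ∫ s in (1 : ℝ)..2, Real.exp (-∫ r in (s - 1)..s, a (r +ᵥ ω)) * b (s +ᵥ ω))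

end Coefficients

end RandomDelay

end

/-!
Carathéodory solutions of the delay equation are the solutions of the variation of constants formula
`z(t) = exp (A(t)) (u₁ + ∫₀ᵗ exp (-A(s)) β(s) z(s - 1) ds)`, `A(t) = ∫₀ᵗ α` (`IsMild`). As the right
hand side at time `t` involves `z` up to time `t - 1` only, this formula is solved by steps of unit
length (`picard`, `delaySol`), uniquely (`IsMild.unique`), and the solution depends measurably on
time and `ω`, linearly and boundedly on the initial value. Hölder's inequality on the first unit of
time bounds the solution operator by an explicit function of `∫ |α|` and `‖β‖_q`
(`norm_delayOp_le`). Over the flow, its logarithm is integrable by (S1), which gives (A1); the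
suprema over uncountably many times are measurable because the semiflow is strongly continuous
(`integrabilityA1_of_norm_le`).

If `b ≥ 0`, the formula preserves positivity, and a nonnegative solution satisfies
`exp (A(t) - A(r)) z(r) ≤ z(t)`. This bounds the values on `[1, 2]` below by a multiple of `z(1)`,
and the values on `[0, 1]` above by a multiple of `z(1)`; through the formula on `[1, 2]` the latter
yields a comparable upper bound on `[1, 2]`. So the state at time `2` lies between two multiples of
`(1/2, 1/2)` with quotient `κ`, or vanishes (`delayOp_two_focusing`).

The principal exponent is obtained for any focusing semiflow on a space with a monotone norm.
A focusing operator contracts the projective oscillation between vectors of the cone by the factor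
`1 - 1 / κ` (`shrinksOsc_of_focusing`). By Poincaré recurrence, the past of almost every `ω` visits
a set on which `κ` is bounded infinitely often, so that the normalized images at `ω` of the vector
`e` started in the remote past form a Cauchy family (`IsFocusing.cauchy_normPullback`). Its limit
`w(ω)` spans an invariant direction, and every orbit is eventually dominated by that of `w(ω)`. The
function `ln ‖U_ω(t) w(ω)‖` is an additive cocycle with integrable increments, so its growth rate is
almost surely constant by the pointwise ergodic theorem, which is proved here from the maximal
ergodic inequality and the zero-one law (`IsAdditiveCocycle.tendsto_div`).

The lower bound by `∫ a` is the same ergodic theorem applied to `A`, combined with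
`exp (A(t) - A(1)) z(1) ≤ z(t)` (`integral_le_of_isPrincipalLyapunovExponent`).
-/


open MeasureTheory Filter Topology Set
open scoped NNReal ENNReal

noncomputable section

namespace RandomDelay

/-! ### The pointwise ergodic theorem for additive cocycles over a flow -/

section Maximal

variable {Ω : Type*}

/-- The maximal function `max_{0 ≤ n ≤ N} ∑_{k < n} g ∘ T^k`, defined by recursion. -/
def maxBirkhoff (T : Ω → Ω) (g : Ω → ℝ) : ℕ → Ω → ℝ
  | 0 => fun _ => 0
  | N + 1 => fun ω => max 0 (g ω + maxBirkhoff T g N (T ω))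

lemma maxBirkhoff_nonneg (T : Ω → Ω) (g : Ω → ℝ) (N : ℕ) (ω : Ω) : 0 ≤ maxBirkhoff T g N ω := by
  cases N with
  | zero => exact le_rfl
  | succ N => exact le_max_left _ _

lemma maxBirkhoff_le_succ (T : Ω → Ω) (g : Ω → ℝ) (N : ℕ) (ω : Ω) :
    maxBirkhoff T g N ω ≤ maxBirkhoff T g (N + 1) ω := by
  induction N generalizing ω with
  | zero => exact maxBirkhoff_nonneg T g 1 ω
  | succ N ih => exact max_le_max le_rfl (by gcongr; exact ih (T ω))

lemma birkhoffSum_le_maxBirkhoff (T : Ω → Ω) (g : Ω → ℝ) (N : ℕ) (ω : Ω) :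
    birkhoffSum T g N ω ≤ maxBirkhoff T g N ω := by
  induction N generalizing ω with
  | zero => simp [maxBirkhoff]
  | succ N ih =>
    rw [birkhoffSum_succ']
    exact le_max_of_le_right (by gcongr; exact ih (T ω))

variable [MeasurableSpace Ω] {μ : Measure Ω}

lemma integrable_maxBirkhoff {T : Ω → Ω} (hT : MeasurePreserving T μ μ) {g : Ω → ℝ}
    (hg : Integrable g μ) (N : ℕ) : Integrable (maxBirkhoff T g N) μ := by
  induction N with
  | zero => exact integrable_zero _ _ _
  | succ N ih => exact (integrable_zero _ _ _).sup (hg.add (hT.integrable_comp_of_integrable ih))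

/-- A consequence of the maximal ergodic theorem: if almost every point has a positive ergodic sum,
then the mean is nonnegative. -/
theorem integral_nonneg_of_exists_birkhoffSum_pos {T : Ω → Ω} (hT : MeasurePreserving T μ μ)
    {g : Ω → ℝ} (hg : Integrable g μ) (hgm : Measurable g)
    (h : ∀ᵐ ω ∂μ, ∃ n, 0 < birkhoffSum T g n ω) : 0 ≤ ∫ ω, g ω ∂μ := by
  have hM : ∀ N, Measurable (maxBirkhoff T g N) := by
    intro N
    induction N with
    | zero => exact measurable_const
    | succ N ih => exact measurable_const.max (hgm.add (ih.comp hT.measurable))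
  set E : ℕ → Set Ω := fun N => {ω | 0 < maxBirkhoff T g N ω}
  have hE : ∀ N, MeasurableSet (E N) := fun N => measurableSet_lt measurable_const (hM N)
  have hN : ∀ N, 0 ≤ ∫ ω, (E N).indicator g ω ∂μ := by
    intro N
    have hi := integrable_maxBirkhoff hT hg N
    have hi' : Integrable (fun ω => maxBirkhoff T g N (T ω)) μ :=
      hT.integrable_comp_of_integrable hi
    have h0 : ∫ ω, (maxBirkhoff T g N ω - maxBirkhoff T g N (T ω)) ∂μ = 0 := by
      have h1 : ∫ ω, maxBirkhoff T g N (T ω) ∂μ = ∫ ω, maxBirkhoff T g N ω ∂μ := by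
        conv_rhs => rw [← hT.map_eq]
        rw [integral_map hT.measurable.aemeasurable (hM N).aestronglyMeasurable]
      rw [integral_sub hi hi', h1, sub_self]
    rw [← h0]
    -- `max_N - max_N ∘ T` has mean zero and is at most `g` on `{max_N > 0}`, at most `0` elsewhere
    refine integral_mono (hi.sub hi') (hg.indicator (hE N)) fun ω => ?_
    by_cases hω : ω ∈ E N
    · rw [indicator_of_mem hω]
      have h1 : 0 < maxBirkhoff T g N ω := hω
      have h2 := maxBirkhoff_le_succ T g N ω
      have h3 : maxBirkhoff T g (N + 1) ω ≤ g ω + maxBirkhoff T g N (T ω) := by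
        have : maxBirkhoff T g (N + 1) ω = max 0 (g ω + maxBirkhoff T g N (T ω)) := rfl
        rcases max_choice 0 (g ω + maxBirkhoff T g N (T ω)) with h | h <;> rw [h] at this <;>
          linarith
      simp only
      linarith
    · rw [indicator_of_notMem hω]
      have h1 : maxBirkhoff T g N ω ≤ 0 := not_lt.1 hω
      have := maxBirkhoff_nonneg T g N (T ω)
      simp only
      linarith
  have hlim : Tendsto (fun N => ∫ ω, (E N).indicator g ω ∂μ) atTop (𝓝 (∫ ω, g ω ∂μ)) := by
    refine tendsto_integral_of_dominated_convergence (fun ω => |g ω|)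
      (fun N => (hg.indicator (hE N)).aestronglyMeasurable) hg.abs
      (fun N => Eventually.of_forall fun ω => ?_) ?_
    · exact norm_indicator_le_norm_self _ _
    · filter_upwards [h] with ω ⟨n, hn⟩
      refine tendsto_const_nhds.congr' ?_
      filter_upwards [eventually_ge_atTop n] with N hN
      rw [indicator_of_mem]
      exact (hn.trans_le (birkhoffSum_le_maxBirkhoff T g n ω)).trans_le
        (monotone_nat_of_le_succ (fun k => maxBirkhoff_le_succ T g k ω) hN)
  exact ge_of_tendsto' hlim hN

/-- Along the orbit of a measure preserving map, an integrable function grows sublinearly, by the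
Borel-Cantelli lemma. -/
theorem tendsto_iterate_div_atTop {T : Ω → Ω} (hT : MeasurePreserving T μ μ) {g : Ω → ℝ}
    [IsProbabilityMeasure μ] (hg : Integrable g μ) (hg0 : 0 ≤ g) (hgm : Measurable g) :
    ∀ᵐ ω ∂μ, Tendsto (fun n : ℕ => g (T^[n] ω) / n) atTop (𝓝 0) := by
  have key : ∀ m : ℕ, ∀ᵐ ω ∂μ, ∀ᶠ n : ℕ in atTop, g (T^[n] ω) ≤ n / (m + 1) := by
    intro m
    let _ : MeasureSpace Ω := ⟨μ⟩
    have h1 : (∑' j : ℕ, μ {ω | ((m : ℝ) + 1) * g ω ∈ Ioi (j : ℝ)}) < ∞ :=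
      ProbabilityTheory.tsum_prob_mem_Ioi_lt_top (hg.const_mul ((m : ℝ) + 1))
        (fun ω => mul_nonneg (by positivity) (hg0 ω))
    have h2 : ∀ j : ℕ, μ ((T^[j]) ⁻¹' {ω | ((m : ℝ) + 1) * g ω ∈ Ioi (j : ℝ)})
        = μ {ω | ((m : ℝ) + 1) * g ω ∈ Ioi (j : ℝ)} := fun j =>
      (hT.iterate j).measure_preimage
        ((measurable_const.mul hgm) measurableSet_Ioi).nullMeasurableSet
    have h3 := ae_eventually_notMem (μ := μ)
      (s := fun j : ℕ => (T^[j]) ⁻¹' {ω | ((m : ℝ) + 1) * g ω ∈ Ioi (j : ℝ)})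
      (by simp_rw [h2]; exact h1.ne)
    filter_upwards [h3] with ω hω
    filter_upwards [hω] with n hn
    simp only [mem_preimage, mem_ofPred_eq, mem_Ioi, not_lt] at hn
    rw [le_div_iff₀ (by positivity)]
    linarith
  filter_upwards [ae_all_iff.2 key] with ω hω
  rw [Metric.tendsto_atTop]
  intro ε hε
  obtain ⟨m, hm⟩ := exists_nat_one_div_lt hε
  obtain ⟨N, hN⟩ := eventually_atTop.1 (hω m)
  refine ⟨N + 1, fun n hn => ?_⟩
  have hn0 : (0 : ℝ) < n := by exact_mod_cast (by omega : 0 < n)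
  have h0 := hg0 (T^[n] ω)
  simp only [Pi.zero_apply] at h0
  rw [Real.dist_eq, sub_zero, abs_of_nonneg (by positivity), div_lt_iff₀ hn0]
  calc g (T^[n] ω) ≤ n / (m + 1) := hN n (by omega)
    _ = (1 / ((m : ℝ) + 1)) * n := by ring
    _ < ε * n := by gcongr

end Maximal

section Flow

variable {Ω : Type*} [AddAction ℝ Ω]

lemma iterate_one_vadd (n : ℕ) (ω : Ω) : (fun ω : Ω => (1 : ℝ) +ᵥ ω)^[n] ω = (n : ℝ) +ᵥ ω := by
  induction n with
  | zero => simp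
  | succ n ih =>
    rw [Function.iterate_succ_apply', ih, vadd_vadd]
    push_cast; rw [add_comm]

/-- `F` is an additive cocycle over the flow. -/
def IsAdditiveCocycle (F : ℝ≥0 → Ω → ℝ) : Prop :=
  ∀ (s t : ℝ≥0) (ω : Ω), F (s + t) ω = F s ω + F t ((s : ℝ) +ᵥ ω)

lemma IsAdditiveCocycle.natCast_eq_birkhoffSum {F : ℝ≥0 → Ω → ℝ} (hF : IsAdditiveCocycle F)
    (n : ℕ) (ω : Ω) : F n ω = birkhoffSum (fun ω : Ω => (1 : ℝ) +ᵥ ω) (F 1) n ω := by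
  induction n generalizing ω with
  | zero =>
    have := hF 0 0 ω
    simp at this ⊢
    linarith
  | succ n ih =>
    rw [birkhoffSum_succ', ← ih, Nat.cast_succ, add_comm, hF 1 n ω]
    simp

variable [MeasurableSpace Ω] [MeasurableVAdd₂ ℝ Ω]
  {P : Measure Ω} [IsProbabilityMeasure P] [ErgodicVAdd ℝ Ω P]

/-- Half of the pointwise ergodic theorem: an upper bound for an additive cocycle along integer
times. By the zero-one law for the (a.e. invariant) set of points at which it fails and by the
maximal ergodic theorem, failure would make the mean of `F 1 - c` nonnegative. -/
theorem IsAdditiveCocycle.eventually_le {F : ℝ≥0 → Ω → ℝ} (hF : IsAdditiveCocycle F)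
    (hm : Measurable (F 1)) {G : Ω → ℝ} (hG : Integrable G P) (hGm : Measurable G)
    (hFG : ∀ t ≤ (1 : ℝ≥0), ∀ ω, |F t ω| ≤ G ω) {c : ℝ} (hc : ∫ ω, F 1 ω ∂P < c) :
    ∀ᵐ ω ∂P, ∀ᶠ n : ℕ in atTop, F n ω ≤ c * n := by
  have hT : MeasurePreserving (fun ω : Ω => (1 : ℝ) +ᵥ ω) P P := measurePreserving_vadd 1 P
  obtain ⟨α, hα, hαc⟩ := exists_between hc
  have hF1 : Integrable (F 1) P := hG.mono' hm.aestronglyMeasurable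
    (Eventually.of_forall fun ω => hFG 1 le_rfl ω)
  have hFm : ∀ n : ℕ, Measurable (F n) := by
    intro n
    rw [show F n = fun ω => ∑ k ∈ Finset.range n, F 1 ((fun ω : Ω => (1 : ℝ) +ᵥ ω)^[k] ω) from
      funext (hF.natCast_eq_birkhoffSum n)]
    exact Finset.measurable_sum _ fun k _ => hm.comp (hT.measurable.iterate k)
  -- the union over `k` makes `E` insensitive to `o(n)` perturbations of `F n`
  set E : Set Ω := {ω | ∃ k : ℕ, ∃ᶠ n : ℕ in atTop, (α + 1 / ((k : ℝ) + 1)) * n < F n ω} with hE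
  have hEm : MeasurableSet E := by
    have : E = ⋃ k : ℕ, limsup (fun n : ℕ => {ω | (α + 1 / ((k : ℝ) + 1)) * n < F n ω}) atTop := by
      ext ω
      simp only [hE, mem_ofPred_eq, mem_iUnion, mem_limsup_iff_frequently_mem]
    rw [this]
    exact MeasurableSet.iUnion fun k => MeasurableSet.measurableSet_limsup fun n =>
      measurableSet_lt measurable_const (hFm n)
  have hsub := tendsto_iterate_div_atTop hT hG (fun ω => (abs_nonneg _).trans (hFG 1 le_rfl ω)) hGm
  -- the cocycle at `ω` and at a point of its orbit differ by `o(n)`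
  have hdiff : ∀ t ≤ (1 : ℝ≥0), ∀ᵐ ω ∂P,
      Tendsto (fun n : ℕ => (F n ω - F n ((t : ℝ) +ᵥ ω)) / n) atTop (𝓝 0) := by
    intro t ht
    filter_upwards [hsub] with ω hω
    have h1 : Tendsto (fun n : ℕ => G ω / n + G ((fun ω : Ω => (1 : ℝ) +ᵥ ω)^[n] ω) / n)
        atTop (𝓝 0) := by
      simpa using (tendsto_const_div_atTop_nhds_zero_nat (G ω)).add hω
    refine squeeze_zero_norm (fun n => ?_) h1
    have h2 : F n ω - F n ((t : ℝ) +ᵥ ω) = F t ω - F t (((n : ℝ≥0) : ℝ) +ᵥ ω) := by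
      have e1 := hF n t ω
      have e2 := hF t n ω
      rw [add_comm] at e2
      linarith
    rw [Real.norm_eq_abs, h2, abs_div, Nat.abs_cast, ← add_div, iterate_one_vadd]
    gcongr
    exact (abs_sub _ _).trans (add_le_add (hFG t ht ω) (hFG t ht _))
  have hmono : ∀ ω ω' : Ω, Tendsto (fun n : ℕ => (F n ω - F n ω') / n) atTop (𝓝 0) →
      ω ∈ E → ω' ∈ E := by
    rintro ω ω' h ⟨k, hk⟩
    refine ⟨k + 1, ?_⟩
    have hpos : (0 : ℝ) < 1 / ((k : ℝ) + 1) - 1 / (((k + 1 : ℕ) : ℝ) + 1) := by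
      rw [sub_pos]
      apply one_div_lt_one_div_of_lt (by positivity)
      push_cast; linarith
    have h3 := (h.eventually (gt_mem_nhds hpos)).and (eventually_gt_atTop 0)
    refine (hk.and_eventually h3).mono fun n hn => ?_
    obtain ⟨h4, h5, h6⟩ := hn
    have hn0 : (0 : ℝ) < n := by exact_mod_cast h6
    rw [div_lt_iff₀ hn0] at h5
    nlinarith
  have hinv : ∀ t : ℝ≥0, t ≤ 1 → (((t : ℝ) +ᵥ ·) ⁻¹' E : Set Ω) =ᵐ[P] E := by
    intro t ht
    filter_upwards [hdiff t ht] with ω hω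
    refine propext ⟨fun h => hmono _ _ ?_ h, fun h => hmono _ _ hω h⟩
    have := hω.neg
    simpa [← neg_div] using this
  -- the stabilizer of `E` is a subgroup containing `[0, 1]`
  have hst : AddAction.aestabilizer ℝ P E = ⊤ := by
    rw [eq_top_iff]
    intro t _
    have hpos : ∀ t : ℝ, 0 ≤ t → t ∈ AddAction.aestabilizer ℝ P E := by
      intro t ht
      obtain ⟨n, hn⟩ := exists_nat_gt t
      have hn0 : (0 : ℝ) < n := ht.trans_lt hn
      have h1 : -(t / n) ∈ AddAction.aestabilizer ℝ P E := by
        rw [AddAction.mem_aestabilizer, ← preimage_vadd_neg, neg_neg]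
        exact hinv ⟨t / n, by positivity⟩ ((div_le_one hn0).2 hn.le)
      have h2 := AddSubgroup.nsmul_mem _ (neg_mem h1) n
      rwa [neg_neg, nsmul_eq_mul, mul_div_cancel₀ _ hn0.ne'] at h2
    rcases le_total 0 t with h | h
    · exact hpos t h
    · simpa using neg_mem (hpos (-t) (by linarith))
  have hconst := AddAction.aeconst_of_aestabilizer_eq_top ℝ hEm.nullMeasurableSet hst
  rw [eventuallyConst_set'] at hconst
  rcases hconst with h | h
  · have h' : ∀ᵐ ω ∂P, ω ∉ E := by
      filter_upwards [h] with ω hω hω'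
      exact (hω ▸ hω' : (∅ : Set Ω) ω)
    filter_upwards [h'] with ω hω
    obtain ⟨k, hk⟩ := exists_nat_one_div_lt (sub_pos.2 hαc)
    simp only [hE, mem_ofPred_eq, not_exists, not_frequently, not_lt] at hω
    filter_upwards [hω k] with n hn
    refine hn.trans ?_
    gcongr
    linarith
  · exfalso
    have h' : ∀ᵐ ω ∂P, ω ∈ E := by
      filter_upwards [h] with ω hω
      exact (hω.symm ▸ mem_univ ω : E ω)
    have h1 : 0 ≤ ∫ ω, (F 1 ω - α) ∂P := by
      refine integral_nonneg_of_exists_birkhoffSum_pos hT (hF1.sub (integrable_const α))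
        (hm.sub_const α) ?_
      filter_upwards [h'] with ω ⟨k, hk⟩
      obtain ⟨n, hn⟩ := hk.exists
      refine ⟨n, ?_⟩
      have h2 : birkhoffSum (fun ω : Ω => (1 : ℝ) +ᵥ ω) (fun ω => F 1 ω - α) n ω
          = F n ω - α * n := by
        rw [hF.natCast_eq_birkhoffSum]
        simp [birkhoffSum, Finset.sum_sub_distrib, mul_comm]
      rw [h2]
      have : 0 ≤ 1 / ((k : ℝ) + 1) * n := by positivity
      linarith
    rw [integral_sub hF1 (integrable_const α)] at h1
    simp at h1
    linarith

/-- The pointwise ergodic theorem for additive cocycles over an ergodic flow. Real times are reduced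
to integer times by the bound `G` for the cocycle over times in `[0, 1]`. -/
theorem IsAdditiveCocycle.tendsto_div {F : ℝ≥0 → Ω → ℝ} (hF : IsAdditiveCocycle F)
    (hm : Measurable (F 1)) {G : Ω → ℝ} (hG : Integrable G P) (hGm : Measurable G)
    (hFG : ∀ t ≤ (1 : ℝ≥0), ∀ ω, |F t ω| ≤ G ω) :
    ∀ᵐ ω ∂P, Tendsto (fun t : ℝ≥0 => F t ω / t) atTop (𝓝 (∫ ω, F 1 ω ∂P)) := by
  have hT : MeasurePreserving (fun ω : Ω => (1 : ℝ) +ᵥ ω) P P := measurePreserving_vadd 1 P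
  have hG0 : 0 ≤ G := fun ω => (abs_nonneg _).trans (hFG 1 le_rfl ω)
  set I := ∫ ω, F 1 ω ∂P with hI
  have hup : ∀ᵐ ω ∂P, ∀ k : ℕ, ∀ᶠ n : ℕ in atTop, F n ω ≤ (I + 1 / ((k : ℝ) + 1)) * n :=
    ae_all_iff.2 fun k => hF.eventually_le hm hG hGm hFG (by
      have : (0 : ℝ) < 1 / ((k : ℝ) + 1) := by positivity
      linarith)
  have hlo : ∀ᵐ ω ∂P, ∀ k : ℕ, ∀ᶠ n : ℕ in atTop, -F n ω ≤ (-I + 1 / ((k : ℝ) + 1)) * n := by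
    refine ae_all_iff.2 fun k => IsAdditiveCocycle.eventually_le (F := fun t ω => -F t ω) ?_ hm.neg
      hG hGm (fun t ht ω => by simpa using hFG t ht ω) ?_
    · intro s t ω
      simp only [hF s t ω]; ring
    · have : (0 : ℝ) < 1 / ((k : ℝ) + 1) := by positivity
      rw [integral_neg]
      linarith
  filter_upwards [hup, hlo, tendsto_iterate_div_atTop hT hG hG0 hGm] with ω h1 h2 h3
  have hnat : Tendsto (fun n : ℕ => F n ω / n) atTop (𝓝 I) := by
    rw [Metric.tendsto_atTop']
    intro ε hε
    obtain ⟨k, hk⟩ := exists_nat_one_div_lt hε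
    obtain ⟨N, hN⟩ := eventually_atTop.1 ((h1 k).and (h2 k))
    refine ⟨N, fun n hn => ?_⟩
    obtain ⟨h4, h5⟩ := hN n hn.le
    have hn0 : (0 : ℝ) < n := by exact_mod_cast (by omega : 0 < n)
    rw [Real.dist_eq, abs_lt]
    constructor
    · rw [lt_sub_iff_add_lt, lt_div_iff₀ hn0]; nlinarith
    · rw [sub_lt_iff_lt_add, div_lt_iff₀ hn0]; nlinarith
  -- `F t ω = F ⌊t⌋ ω + F (t - ⌊t⌋) (⌊t⌋ +ᵥ ω)`, where the last term is at most
  -- `G (⌊t⌋ +ᵥ ω) = o(t)`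
  have hfl : Tendsto (fun t : ℝ≥0 => ⌊t⌋₊) atTop atTop := tendsto_nat_floor_atTop
  have hratio : Tendsto (fun t : ℝ≥0 => (⌊t⌋₊ : ℝ) / t) atTop (𝓝 1) := by
    refine ((tendsto_nat_floor_div_atTop (R := ℝ)).comp
      (NNReal.tendsto_coe_atTop.2 tendsto_id)).congr fun t => ?_
    rfl
  have hmain : Tendsto (fun t : ℝ≥0 => (F ⌊t⌋₊ ω / ⌊t⌋₊) * ((⌊t⌋₊ : ℝ) / t)) atTop (𝓝 (I * 1)) :=
    (hnat.comp hfl).mul hratio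
  have hrem : Tendsto (fun t : ℝ≥0 => F (t - ⌊t⌋₊) (((⌊t⌋₊ : ℝ≥0) : ℝ) +ᵥ ω) / t) atTop (𝓝 0) := by
    refine squeeze_zero_norm' ?_ (h3.comp hfl)
    filter_upwards [eventually_ge_atTop 1] with t ht
    have hf : (0 : ℝ) < ⌊t⌋₊ := by exact_mod_cast Nat.floor_pos.2 ht
    have hle : ((⌊t⌋₊ : ℝ≥0)) ≤ t := Nat.floor_le zero_le
    have hle' : (⌊t⌋₊ : ℝ) ≤ t := by exact_mod_cast hle
    rw [Real.norm_eq_abs, abs_div, NNReal.abs_eq]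
    simp only [Function.comp, iterate_one_vadd]
    refine div_le_div₀ (hG0 _) (hFG _ ?_ _) hf hle'
    rw [tsub_le_iff_right, add_comm]
    exact (Nat.lt_floor_add_one t).le
  have hsum := hmain.add hrem
  rw [mul_one, add_zero] at hsum
  refine hsum.congr' ?_
  filter_upwards [eventually_ge_atTop 1] with t ht
  have hf : (0 : ℝ) < ⌊t⌋₊ := by exact_mod_cast Nat.floor_pos.2 ht
  have hle : ((⌊t⌋₊ : ℝ≥0)) ≤ t := Nat.floor_le zero_le
  have := hF ⌊t⌋₊ (t - ⌊t⌋₊) ω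
  rw [add_tsub_cancel_of_le hle] at this
  rw [this, div_mul_div_cancel₀ hf.ne', ← add_div]

/-- A flow invariant set of full measure contains a measurable flow invariant set of full measure,
namely the set of points whose orbit lies in a given measurable set of full measure for almost all
times. -/
theorem exists_measurableSet_invariant_subset {A : Set Ω}
    (hA : ∀ (t : ℝ) (ω : Ω), ω ∈ A → t +ᵥ ω ∈ A) (hAP : ∀ᵐ ω ∂P, ω ∈ A) :
    ∃ S ⊆ A, MeasurableSet S ∧ (∀ t : ℝ, (fun ω => t +ᵥ ω) ⁻¹' S = S) ∧ ∀ᵐ ω ∂P, ω ∈ S := by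
  set B : Set Ω := (toMeasurable P Aᶜ)ᶜ with hBdef
  have hBm : MeasurableSet B := (measurableSet_toMeasurable _ _).compl
  have hBA : B ⊆ A := compl_subset_comm.1 (subset_toMeasurable P Aᶜ)
  have hB : ∀ᵐ ω ∂P, ω ∈ B := by
    rw [ae_iff, hBdef]
    simp only [mem_compl_iff, not_not, ofPred_mem_eq, measure_toMeasurable]
    exact hAP
  have hpm : MeasurableSet {x : Ω × ℝ | x.2 +ᵥ x.1 ∈ B} :=
    (measurable_snd.vadd measurable_fst) hBm
  refine ⟨{ω | ∀ᵐ t : ℝ, t +ᵥ ω ∈ B}, fun ω hω => ?_, ?_, fun t => ?_, ?_⟩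
  · obtain ⟨t, ht⟩ := Eventually.exists (f := ae (volume : Measure ℝ)) hω
    simpa using hA (-t) _ (hBA ht)
  · exact measurable_measure_prodMk_left hpm.compl (measurableSet_singleton 0)
  · ext ω
    simp only [mem_preimage, mem_ofPred_eq, vadd_vadd]
    have hq : ∀ s : ℝ, Measure.QuasiMeasurePreserving (fun r : ℝ => r + s) volume volume := fun s =>
      (measurePreserving_add_right volume s).quasiMeasurePreserving
    refine ⟨fun h => ?_, fun h => (hq t).ae h⟩
    simpa using (hq (-t)).ae h
  · have := (Measure.ae_ae_comm (μ := P) (ν := (volume : Measure ℝ))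
      (p := fun ω t => t +ᵥ ω ∈ B) hpm).2
      (Eventually.of_forall fun t => (measurePreserving_vadd t P).quasiMeasurePreserving.ae hB)
    exact this

end Flow

/-! ### Absolutely continuous functions -/

lemma abs_exp_sub_exp_le {x y C : ℝ} (hx : x ≤ C) (hy : y ≤ C) :
    |Real.exp x - Real.exp y| ≤ Real.exp C * |x - y| := by
  have := (convex_Iic C).norm_image_sub_le_of_norm_deriv_le (f := Real.exp) (C := Real.exp C)
    (x := y) (y := x) (fun z _ => Real.differentiableAt_exp)
    (fun z hz => by rw [Real.deriv_exp, Real.norm_eq_abs, Real.abs_exp]; exact Real.exp_le_exp.2 hz)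
    hy hx
  simpa [Real.norm_eq_abs] using this

lemma _root_.AbsolutelyContinuousOnInterval.exp {f : ℝ → ℝ} {a b : ℝ}
    (hf : AbsolutelyContinuousOnInterval f a b) :
    AbsolutelyContinuousOnInterval (fun x => Real.exp (f x)) a b := by
  obtain ⟨C, hC⟩ := hf.exists_bound
  rw [absolutelyContinuousOnInterval_iff] at hf ⊢
  intro ε hε
  obtain ⟨δ, hδ, h⟩ := hf (ε / Real.exp C) (by positivity)
  refine ⟨δ, hδ, fun E hE hEδ => ?_⟩
  have h1 := h E hE hEδ
  rw [lt_div_iff₀ (by positivity), Finset.sum_mul] at h1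
  refine lt_of_le_of_lt (Finset.sum_le_sum fun i hi => ?_) h1
  have h2 := hE.1 i hi
  rw [Real.dist_eq, Real.dist_eq, mul_comm]
  exact abs_exp_sub_exp_le ((le_abs_self _).trans (hC _ h2.1)) ((le_abs_self _).trans (hC _ h2.2))

lemma _root_.AbsolutelyContinuousOnInterval.congr {f g : ℝ → ℝ} {a b : ℝ}
    (hf : AbsolutelyContinuousOnInterval f a b) (h : EqOn f g (uIcc a b)) :
    AbsolutelyContinuousOnInterval g a b := by
  rw [absolutelyContinuousOnInterval_iff] at hf ⊢
  intro ε hε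
  obtain ⟨δ, hδ, h'⟩ := hf ε hε
  refine ⟨δ, hδ, fun E hE hEδ => ?_⟩
  refine lt_of_eq_of_lt (Finset.sum_congr rfl fun i hi => ?_) (h' E hE hEδ)
  rw [h (hE.1 i hi).1, h (hE.1 i hi).2]

/-! ### The delay equation with deterministic coefficients -/

/-- The conditions on deterministic coefficients `α`, `β` of the delay equation: `α` is locally
integrable, `β` is locally in `L_q`. -/
structure IsDelayCoeff (q : ℝ≥0∞) (α β : ℝ → ℝ) : Prop where
  locallyIntegrable : LocallyIntegrable α volume
  memLp : ∀ x y : ℝ, MemLp β q (volume.restrict (Icc x y))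

/-- The primitive of `α` vanishing at `0`. -/
def prim (α : ℝ → ℝ) (t : ℝ) : ℝ := ∫ r in (0 : ℝ)..t, α r

/-- The integrand of the variation of constants formula. -/
def vocIntegrand (α β z : ℝ → ℝ) (s : ℝ) : ℝ := Real.exp (-prim α s) * (β s * z (s - 1))

/-- Mild solutions of the delay equation: solutions of the variation of constants formula. -/
def IsMild {p : ℝ≥0∞} (α β : ℝ → ℝ) (u : DelaySpace p) (z : ℝ → ℝ) : Prop :=
  (∀ᵐ t ∂(volume.restrict (Ico (-1 : ℝ) 0)), z t = u.snd t) ∧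
  ∀ t : ℝ, 0 ≤ t →
    z t = Real.exp (prim α t) * (u.fst + ∫ s in (0 : ℝ)..t, vocIntegrand α β z s)

lemma restrict_Ico_eq_histMeasure : volume.restrict (Ico (-1 : ℝ) 0) = histMeasure :=
  Measure.restrict_congr_set Ico_ae_eq_Icc

namespace IsDelayCoeff

variable {q : ℝ≥0∞} {α β : ℝ → ℝ}

lemma intervalIntegrable (h : IsDelayCoeff q α β) (x y : ℝ) : IntervalIntegrable α volume x y :=
  intervalIntegrable_iff.2
    ((h.locallyIntegrable.integrableOn_isCompact isCompact_uIcc).mono_set uIoc_subset_uIcc)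

lemma continuous_prim (h : IsDelayCoeff q α β) : Continuous (prim α) :=
  intervalIntegral.continuous_primitive h.intervalIntegrable 0

lemma prim_add (h : IsDelayCoeff q α β) (s t : ℝ) :
    prim α (t + s) = prim α s + prim (fun r => α (r + s)) t := by
  simp only [prim]
  rw [intervalIntegral.integral_comp_add_right, zero_add,
    intervalIntegral.integral_add_adjacent_intervals (h.intervalIntegrable _ _)
      (h.intervalIntegrable _ _)]

lemma shift (h : IsDelayCoeff q α β) (s : ℝ) :
    IsDelayCoeff q (fun r => α (r + s)) (fun r => β (r + s)) where
  locallyIntegrable := by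
    rw [locallyIntegrable_iff]
    intro K hK
    have h1 := (measurePreserving_add_right volume s).integrableOn_comp_preimage
      (MeasurableEquiv.addRight s).measurableEmbedding (f := α) (s := (· + s) '' K)
    rw [preimage_image_eq _ (add_left_injective s)] at h1
    exact h1.2 (h.locallyIntegrable.integrableOn_isCompact (hK.image (continuous_add_const s)))
  memLp x y := by
    have h1 := (h.memLp (x + s) (y + s)).comp_measurePreserving
      ((measurePreserving_add_right volume s).restrict_preimage measurableSet_Icc)
    simpa [Function.comp_def] using h1

end IsDelayCoeff

section Mild

variable {p q : ℝ≥0∞} [p.HolderConjugate q] {α β : ℝ → ℝ} {u : DelaySpace p}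
  {z z' : ℝ → ℝ}

lemma IsDelayCoeff.intervalIntegrable_vocIntegrand (h : IsDelayCoeff q α β) {T : ℝ} (hT : 0 ≤ T)
    (hz : MemLp z p (volume.restrict (Icc (-1) T))) :
    IntervalIntegrable (vocIntegrand α β z) volume 0 (T + 1) := by
  have h1 : MemLp (fun s => z (s - 1)) p (volume.restrict (Icc 0 (T + 1))) := by
    have h1 := hz.comp_measurePreserving
      ((measurePreserving_sub_right volume (1 : ℝ)).restrict_preimage measurableSet_Icc)
    simpa [Function.comp_def] using h1
  have h2 : Integrable (fun s => β s * z (s - 1)) (volume.restrict (Icc 0 (T + 1))) :=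
    memLp_one_iff_integrable.1 (h1.mul (h.memLp 0 (T + 1)))
  have h3 : IntervalIntegrable (fun s => β s * z (s - 1)) volume 0 (T + 1) :=
    (intervalIntegrable_iff_integrableOn_Icc_of_le (by linarith)).2 h2
  exact h3.continuousOn_mul (Real.continuous_exp.comp h.continuous_prim.neg).continuousOn

/-- Integrability and continuity propagate from `[-1, n]` to `[-1, n + 1]` by the variation of
constants formula. -/
lemma IsMild.memLp_nat (h : IsDelayCoeff q α β) (hz : IsMild α β u z) (n : ℕ) :
    MemLp z p (volume.restrict (Icc (-1) n)) ∧ ContinuousOn z (Icc 0 n) := by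
  induction n with
  | zero =>
    refine ⟨?_, by simp⟩
    have h1 := hz.1
    rw [restrict_Ico_eq_histMeasure] at h1
    have := (Lp.memLp u.snd).ae_eq (EventuallyEq.symm h1)
    simpa using this
  | succ n ih =>
    have hint := h.intervalIntegrable_vocIntegrand (Nat.cast_nonneg n) ih.1
    have hc : ContinuousOn z (Icc 0 (n + 1 : ℝ)) := by
      have h1 := intervalIntegral.continuousOn_primitive_interval'
        hint left_mem_uIcc
      rw [uIcc_of_le (by positivity)] at h1
      have h2 : ContinuousOn (fun t => Real.exp (prim α t) *
          (u.fst + ∫ s in (0 : ℝ)..t, vocIntegrand α β z s)) (Icc 0 (n + 1 : ℝ)) :=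
        (Real.continuous_exp.comp h.continuous_prim).continuousOn.mul (continuousOn_const.add h1)
      exact h2.congr fun t ht => hz.2 t ht.1
    push_cast
    refine ⟨?_, hc⟩
    have h3 : MemLp z p (volume.restrict (Icc 0 (n + 1 : ℝ))) := by
      obtain ⟨C, hC⟩ := isCompact_Icc.exists_bound_of_continuousOn hc
      exact MemLp.of_bound (hc.aestronglyMeasurable measurableSet_Icc) C
        ((ae_restrict_iff' measurableSet_Icc).2 (Eventually.of_forall hC))
    have h4 : MemLp ((Icc (0 : ℝ) (n + 1)).piecewise z z) p
        (volume.restrict (Icc (-1) (n + 1 : ℝ))) := by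
      refine MemLp.piecewise measurableSet_Icc (h3.mono_measure ?_) (ih.1.mono_measure ?_)
      · rw [Measure.restrict_restrict measurableSet_Icc]
        exact Measure.restrict_mono inter_subset_left le_rfl
      · rw [Measure.restrict_restrict measurableSet_Icc.compl]
        have hsub : (Icc (0 : ℝ) (n + 1))ᶜ ∩ Icc (-1) (n + 1) ⊆ Icc (-1) n := fun s hs =>
          ⟨hs.2.1, not_lt.1 fun hlt => hs.1 ⟨n.cast_nonneg.trans hlt.le, hs.2.2⟩⟩
        exact Measure.restrict_mono hsub le_rfl
    rwa [piecewise_same] at h4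

lemma IsMild.memLp (h : IsDelayCoeff q α β) (hz : IsMild α β u z) (T : ℝ) :
    MemLp z p (volume.restrict (Icc (-1) T)) := by
  obtain ⟨n, hn⟩ := exists_nat_ge T
  exact (hz.memLp_nat h n).1.mono_measure
    (Measure.restrict_mono (Icc_subset_Icc_right hn) le_rfl)

lemma IsMild.continuousOn (h : IsDelayCoeff q α β) (hz : IsMild α β u z) (T : ℝ) :
    ContinuousOn z (Icc 0 T) := by
  obtain ⟨n, hn⟩ := exists_nat_ge T
  exact (hz.memLp_nat h n).2.mono (Icc_subset_Icc_right hn)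

lemma IsMild.intervalIntegrable (h : IsDelayCoeff q α β) (hz : IsMild α β u z) {x y : ℝ}
    (hx : 0 ≤ x) (hy : 0 ≤ y) : IntervalIntegrable (vocIntegrand α β z) volume x y := by
  refine (h.intervalIntegrable_vocIntegrand (le_max_of_le_left hx)
    (hz.memLp h (max x y))).mono_set ?_
  rw [uIcc_of_le (by have := le_max_left x y; linarith : (0 : ℝ) ≤ max x y + 1)]
  refine uIcc_subset_Icc ⟨hx, ?_⟩ ⟨hy, ?_⟩
  · have := le_max_left x y; linarith
  · have := le_max_right x y; linarith

/-- If two functions agree a.e. on `[-1, T]`, then so do the right hand sides of the variation of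
constants formula on `[0, T + 1]`. -/
lemma integral_vocIntegrand_congr {T t : ℝ} (ht : 0 ≤ t) (htT : t ≤ T + 1)
    (h : ∀ᵐ s ∂(volume.restrict (Icc (-1) T)), z s = z' s) :
    ∫ s in (0 : ℝ)..t, vocIntegrand α β z s = ∫ s in (0 : ℝ)..t, vocIntegrand α β z' s := by
  refine intervalIntegral.integral_congr_ae ?_
  rw [ae_restrict_iff' measurableSet_Icc] at h
  have h1 := (measurePreserving_sub_right volume (1 : ℝ)).quasiMeasurePreserving.ae h
  filter_upwards [h1] with s hs hs'
  rw [uIoc_of_le ht] at hs'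
  rw [vocIntegrand, vocIntegrand, hs ⟨by linarith [hs'.1], by linarith [hs'.2]⟩]

/-- Uniqueness of mild solutions. -/
theorem IsMild.unique (hz : IsMild α β u z) (hz' : IsMild α β u z') :
    ∀ t : ℝ, 0 ≤ t → z t = z' t := by
  have hhist : ∀ᵐ s ∂(volume.restrict (Ico (-1 : ℝ) 0)), z s = z' s := by
    filter_upwards [hz.1, hz'.1] with s h1 h2 using h1.trans h2.symm
  rw [ae_restrict_iff' measurableSet_Ico] at hhist
  have key : ∀ n : ℕ, ∀ t : ℝ, 0 ≤ t → t ≤ n → z t = z' t := by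
    intro n
    induction n with
    | zero =>
      intro t h0 h1
      have : t = 0 := le_antisymm (by simpa using h1) h0
      rw [hz.2 t h0, hz'.2 t h0, this]
      simp
    | succ n ih =>
      intro t h0 h1
      rw [hz.2 t h0, hz'.2 t h0]
      congr 2
      refine integral_vocIntegrand_congr (T := n) h0 (by exact_mod_cast h1) ?_
      rw [ae_restrict_iff' measurableSet_Icc]
      filter_upwards [hhist] with s hs hs'
      rcases lt_or_ge s 0 with h | h
      · exact hs ⟨hs'.1, h⟩
      · exact ih s h hs'.2
  intro t ht
  obtain ⟨n, hn⟩ := exists_nat_ge t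
  exact key n t ht hn

theorem IsMild.ae_eq (hz : IsMild α β u z) (hz' : IsMild α β u z') {t : ℝ} (ht : 0 ≤ t) :
    ∀ᵐ s ∂histMeasure, z (t + s) = z' (t + s) := by
  have hhist : ∀ᵐ s ∂(volume.restrict (Ico (-1 : ℝ) 0)), z s = z' s := by
    filter_upwards [hz.1, hz'.1] with s h1 h2 using h1.trans h2.symm
  rw [ae_restrict_iff' measurableSet_Ico] at hhist
  rw [ae_restrict_iff' measurableSet_Icc]
  filter_upwards [(measurePreserving_add_left volume t).quasiMeasurePreserving.ae hhist] with s hs h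
  rcases lt_or_ge (t + s) 0 with h' | h'
  · exact hs ⟨by linarith [h.1], h'⟩
  · exact hz.unique hz' _ h'

omit [p.HolderConjugate q] in
/-- A Carathéodory solution is a mild solution: `exp (-prim α) * z` is absolutely continuous with
derivative `vocIntegrand α β z`. -/
theorem IsDelayCoeff.isMild_of_isDelaySolution (h : IsDelayCoeff q α β)
    (hz : IsDelaySolution α β u z) : IsMild α β u z := by
  obtain ⟨h1, h2, h3, h4⟩ := hz
  refine ⟨h1, fun t ht => ?_⟩
  rcases ht.eq_or_lt with rfl | ht
  · simp [prim, h2]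
  have hA : AbsolutelyContinuousOnInterval (fun s => Real.exp (-prim α s)) 0 t :=
    ((h.intervalIntegrable 0 t).absolutelyContinuousOnInterval_intervalIntegral
      left_mem_uIcc).neg.exp
  have hy := (hA.fun_mul (h3 t ht)).integral_deriv_eq_sub
  have hae : ∀ᵐ s, s ∈ uIoc 0 t →
      deriv (fun s => Real.exp (-prim α s) * z s) s = vocIntegrand α β z s := by
    rw [ae_restrict_iff' measurableSet_Ioi] at h4
    filter_upwards [h4, LocallyIntegrable.ae_hasDerivAt_integral h.locallyIntegrable]
      with s hs hs' hmem
    rw [uIoc_of_le ht.le] at hmem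
    have e1 : HasDerivAt (prim α) (α s) s := hs' 0
    refine (e1.neg.exp.mul (hs hmem.1)).deriv.trans ?_
    simp only [vocIntegrand, Pi.neg_apply]
    ring
  rw [intervalIntegral.integral_congr_ae hae] at hy
  rw [hy, h2]
  simp only [prim, intervalIntegral.integral_same, neg_zero, Real.exp_zero, one_mul,
    add_sub_cancel]
  rw [← mul_assoc, ← Real.exp_add]
  simp

theorem IsMild.isDelaySolution (h : IsDelayCoeff q α β) (hz : IsMild α β u z) :
    IsDelaySolution α β u z := by
  refine ⟨hz.1, ?_, fun T hT => ?_, ?_⟩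
  · simp [hz.2 0 le_rfl, prim]
  · have hA : AbsolutelyContinuousOnInterval (fun s => Real.exp (prim α s)) 0 T :=
      ((h.intervalIntegrable 0 T).absolutelyContinuousOnInterval_intervalIntegral
        left_mem_uIcc).exp
    have hI := (hz.intervalIntegrable h le_rfl
      hT.le).absolutelyContinuousOnInterval_intervalIntegral left_mem_uIcc
    have hc : AbsolutelyContinuousOnInterval (fun _ : ℝ => u.fst) 0 T :=
      (LipschitzWith.const u.fst).lipschitzOnWith.absolutelyContinuousOnInterval
    refine (hA.fun_mul (hc.fun_add hI)).congr fun t ht => ?_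
    rw [uIcc_of_le hT.le] at ht
    exact (hz.2 t ht.1).symm
  · rw [ae_restrict_iff' measurableSet_Ioi]
    have hI : ∀ n : ℕ, ∀ᵐ x, x ∈ uIcc (0 : ℝ) n → ∀ c ∈ uIcc (0 : ℝ) n,
        HasDerivAt (fun x => ∫ s in c..x, vocIntegrand α β z s) (vocIntegrand α β z x) x :=
      fun n => (hz.intervalIntegrable h le_rfl n.cast_nonneg).ae_hasDerivAt_integral
    filter_upwards [ae_all_iff.2 hI, LocallyIntegrable.ae_hasDerivAt_integral h.locallyIntegrable]
      with t h1 h2 ht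
    have ht : 0 < t := ht
    obtain ⟨n, hn⟩ := exists_nat_ge t
    have e1 : HasDerivAt (prim α) (α t) t := h2 0
    have e2 := h1 n (by rw [uIcc_of_le n.cast_nonneg]; exact ⟨ht.le, hn⟩) 0 left_mem_uIcc
    have e3 := e1.exp.mul (e2.const_add u.fst)
    have e4 : z =ᶠ[𝓝 t] fun t => Real.exp (prim α t) *
        (u.fst + ∫ s in (0 : ℝ)..t, vocIntegrand α β z s) := by
      filter_upwards [lt_mem_nhds ht] with s hs using hz.2 s hs.le
    refine (e3.congr_of_eventuallyEq e4).congr_deriv ?_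
    rw [hz.2 t ht.le, vocIntegrand]
    have : Real.exp (prim α t) * (Real.exp (-prim α t) * (β t * z (t - 1))) = β t * z (t - 1) := by
      rw [← mul_assoc, ← Real.exp_add]; simp
    rw [this]
    ring

/-! ### Existence by the method of steps -/

/-- The Picard iterates for the variation of constants formula. On `(-∞, n)` all iterates from the
`n`-th on agree, as the right hand side at time `t` involves only times up to `t - 1`. -/
def picard {p : ℝ≥0∞} (α β : ℝ → ℝ) (u : DelaySpace p) : ℕ → ℝ → ℝ
  | 0 => fun t => u.snd t
  | n + 1 => fun t => if t < 0 then u.snd t else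
      Real.exp (prim α t) * (u.fst + ∫ s in (0 : ℝ)..t, vocIntegrand α β (picard α β u n) s)

/-- The solution of the delay equation, patched together from the Picard iterates. -/
def delaySol {p : ℝ≥0∞} (α β : ℝ → ℝ) (u : DelaySpace p) (t : ℝ) : ℝ :=
  picard α β u (⌊t⌋₊ + 1) t

lemma picard_of_neg (n : ℕ) {t : ℝ} (ht : t < 0) : picard α β u n t = u.snd t := by
  cases n with
  | zero => rfl
  | succ n => exact if_pos ht

lemma picard_succ_of_nonneg (n : ℕ) {t : ℝ} (ht : 0 ≤ t) : picard α β u (n + 1) t =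
    Real.exp (prim α t) * (u.fst + ∫ s in (0 : ℝ)..t, vocIntegrand α β (picard α β u n) s) :=
  if_neg ht.not_gt

lemma picard_succ_eq (n : ℕ) {t : ℝ} (ht : t < n) : picard α β u (n + 1) t = picard α β u n t := by
  induction n generalizing t with
  | zero => exact if_pos (by simpa using ht)
  | succ n ih =>
    rcases lt_or_ge t 0 with h0 | h0
    · rw [picard_of_neg _ h0, picard_of_neg _ h0]
    rw [picard_succ_of_nonneg _ h0, picard_succ_of_nonneg _ h0]
    congr 2
    refine intervalIntegral.integral_congr fun s hs => ?_
    rw [uIcc_of_le h0] at hs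
    push_cast at ht
    simp only [vocIntegrand]
    rw [ih (by linarith [hs.2])]

lemma picard_eq_delaySol (n : ℕ) {t : ℝ} (ht : t < n) : picard α β u n t = delaySol α β u t := by
  rcases lt_or_ge t 0 with h0 | h0
  · rw [delaySol, picard_of_neg _ h0, picard_of_neg _ h0]
  have hn : ⌊t⌋₊ + 1 ≤ n := (Nat.floor_lt h0).2 ht
  obtain ⟨k, rfl⟩ := Nat.exists_eq_add_of_le hn
  have hlt : t < (⌊t⌋₊ + 1 : ℕ) := by exact_mod_cast Nat.lt_floor_add_one t
  clear hn ht
  induction k with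
  | zero => rfl
  | succ k ih =>
    rw [← ih, ← picard_succ_eq (⌊t⌋₊ + 1 + k)
      (by push_cast at hlt ⊢; linarith [k.cast_nonneg (α := ℝ)])]
    rfl

theorem isMild_delaySol : IsMild α β u (delaySol α β u) := by
  refine ⟨?_, fun t ht => ?_⟩
  · rw [ae_restrict_iff' measurableSet_Ico]
    exact Eventually.of_forall fun t ht => picard_of_neg _ ht.2
  · rw [delaySol, picard_succ_of_nonneg _ ht]
    congr 2
    refine intervalIntegral.integral_congr fun s hs => ?_
    rw [uIcc_of_le ht] at hs
    simp only [vocIntegrand]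
    rw [picard_eq_delaySol _ (by linarith [hs.2, Nat.lt_floor_add_one t])]

/-! ### Linearity, positivity and the cocycle property -/

lemma IsMild.add {u' : DelaySpace p} (h : IsDelayCoeff q α β) (hz : IsMild α β u z)
    (hz' : IsMild α β u' z') : IsMild α β (u + u') (fun t => z t + z' t) := by
  refine ⟨?_, fun t ht => ?_⟩
  · have h1 := Lp.coeFn_add u.snd u'.snd
    have h2 := hz.1
    have h3 := hz'.1
    rw [restrict_Ico_eq_histMeasure] at h2 h3 ⊢
    filter_upwards [h1, h2, h3] with s h1 h2 h3
    rw [h2, h3]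
    exact h1.symm
  · have : ∀ s, vocIntegrand α β (fun t => z t + z' t) s
        = vocIntegrand α β z s + vocIntegrand α β z' s := fun s => by
      simp only [vocIntegrand]; ring
    simp only [this]
    rw [intervalIntegral.integral_add (hz.intervalIntegrable h le_rfl ht)
      (hz'.intervalIntegrable h le_rfl ht), hz.2 t ht, hz'.2 t ht, WithLp.add_fst]
    ring

lemma IsMild.smul (c : ℝ) (hz : IsMild α β u z) : IsMild α β (c • u) (fun t => c * z t) := by
  refine ⟨?_, fun t ht => ?_⟩
  · have h1 := Lp.coeFn_smul c u.snd
    have h2 := hz.1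
    rw [restrict_Ico_eq_histMeasure] at h2 ⊢
    filter_upwards [h1, h2] with s h1 h2
    rw [h2]
    exact h1.symm
  · have : ∀ s, vocIntegrand α β (fun t => c * z t) s = c * vocIntegrand α β z s := fun s => by
      simp only [vocIntegrand]; ring
    simp only [this]
    rw [intervalIntegral.integral_const_mul, hz.2 t ht, WithLp.smul_fst, smul_eq_mul]
    ring

/-- Solutions with a nonnegative initial value are nonnegative if `β` is. -/
lemma IsMild.nonneg (hβ : ∀ t, 0 ≤ β t) (hu : u ∈ posCone p) (hz : IsMild α β u z) :
    ∀ t : ℝ, 0 ≤ t → 0 ≤ z t := by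
  have hhist : ∀ᵐ s ∂(volume.restrict (Ico (-1 : ℝ) 0)), 0 ≤ z s := by
    have h1 := hz.1
    rw [restrict_Ico_eq_histMeasure] at h1 ⊢
    filter_upwards [h1, hu.2] with s h1 h2 using h1 ▸ h2
  rw [ae_restrict_iff' measurableSet_Ico] at hhist
  have key : ∀ n : ℕ, ∀ t : ℝ, 0 ≤ t → t < n → 0 ≤ z t := by
    intro n
    induction n with
    | zero => intro t h0 h1; simp at h1; linarith
    | succ n ih =>
      intro t h0 h1
      rw [hz.2 t h0]
      refine mul_nonneg (Real.exp_pos _).le (add_nonneg hu.1 ?_)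
      rw [intervalIntegral.integral_of_le h0]
      refine setIntegral_nonneg_of_ae_restrict ?_
      rw [EventuallyLE, ae_restrict_iff' measurableSet_Ioc]
      filter_upwards [(measurePreserving_sub_right volume (1 : ℝ)).quasiMeasurePreserving.ae hhist]
        with s hs hs'
      refine mul_nonneg (Real.exp_pos _).le (mul_nonneg (hβ s) ?_)
      push_cast at h1
      rcases lt_or_ge (s - 1) 0 with h | h
      · exact hs ⟨by linarith [hs'.1], h⟩
      · exact ih _ h (by linarith [hs'.2])
  intro t ht
  obtain ⟨n, hn⟩ := exists_nat_gt t
  exact key n t ht hn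

/-- The time shift of a mild solution is a mild solution of the shifted equation. -/
lemma IsMild.shift (h : IsDelayCoeff q α β) (hz : IsMild α β u z) {s : ℝ} (hs : 0 ≤ s)
    {v : DelaySpace p} (hv1 : v.fst = z s) (hv2 : ∀ᵐ r ∂histMeasure, v.snd r = z (s + r)) :
    IsMild (fun r => α (r + s)) (fun r => β (r + s)) v (fun r => z (r + s)) := by
  refine ⟨?_, fun t ht => ?_⟩
  · rw [restrict_Ico_eq_histMeasure]
    filter_upwards [hv2] with r hr
    rw [hr, add_comm]
  · have e1 : ∀ r, vocIntegrand (fun r => α (r + s)) (fun r => β (r + s)) (fun r => z (r + s)) r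
        = Real.exp (prim α s) * vocIntegrand α β z (r + s) := by
      intro r
      simp only [vocIntegrand]
      rw [h.prim_add s r, neg_add, Real.exp_add, show r - 1 + s = r + s - 1 by ring]
      have e : Real.exp (prim α s) * Real.exp (-prim α s) = 1 := by rw [← Real.exp_add]; simp
      linear_combination
        (-(Real.exp (-prim (fun r => α (r + s)) r) * (β (r + s) * z (r + s - 1)))) * e
    simp only [e1]
    rw [intervalIntegral.integral_const_mul, intervalIntegral.integral_comp_add_right, zero_add,
      hv1, hz.2 s hs, hz.2 (t + s) (by linarith), h.prim_add s t, Real.exp_add, ← mul_add,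
      ← intervalIntegral.integral_add_adjacent_intervals (hz.intervalIntegrable h le_rfl hs)
        (hz.intervalIntegrable h hs (by linarith))]
    ring

end Mild

/-! ### The solution operators of the deterministic equation -/

lemma DelaySpace.ext' {p : ℝ≥0∞} {u v : DelaySpace p} (h1 : u.fst = v.fst)
    (h2 : ∀ᵐ s ∂histMeasure, u.snd s = v.snd s) : u = v := by
  apply (WithLp.ofLp_injective 1)
  exact Prod.ext h1 (Lp.ext h2)

lemma DelaySpace.norm_eq {p : ℝ≥0∞} [Fact (1 ≤ p)] (u : DelaySpace p) :
    ‖u‖ = |u.fst| + ‖u.snd‖ := by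
  rw [WithLp.prod_norm_eq_of_L1, Real.norm_eq_abs]

/-- The history component, extended by `0` to the real line. -/
def histExt {p : ℝ≥0∞} (u : DelaySpace p) : ℝ → ℝ := (Icc (-1 : ℝ) 0).indicator u.snd

lemma memLp_histExt {p : ℝ≥0∞} (u : DelaySpace p) : MemLp (histExt u) p volume :=
  (memLp_indicator_iff_restrict measurableSet_Icc).2 (Lp.memLp u.snd)

lemma eLpNorm_histExt {p : ℝ≥0∞} (u : DelaySpace p) : eLpNorm (histExt u) p volume = ‖u.snd‖ₑ := by
  rw [histExt, eLpNorm_indicator_eq_eLpNorm_restrict measurableSet_Icc, Lp.enorm_def]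

lemma eLpNorm_histExt_comp_add {p : ℝ≥0∞} (u : DelaySpace p) (c : ℝ) :
    eLpNorm (fun s => histExt u (s + c)) p volume = ‖u.snd‖ₑ := by
  rw [← eLpNorm_histExt]
  exact eLpNorm_comp_measurePreserving (memLp_histExt u).aestronglyMeasurable
    (measurePreserving_add_right volume c)

section Operators

variable {p q : ℝ≥0∞} [p.HolderConjugate q] {α β : ℝ → ℝ} {u : DelaySpace p}
  {z z' : ℝ → ℝ}

omit [p.HolderConjugate q] in
/-- Before time `0`, a mild solution is given by its history. -/
lemma IsMild.ae_eq_histExt (hz : IsMild α β u z) :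
    ∀ᵐ s, s ∈ Ico (-1 : ℝ) 0 → z s = histExt u s := by
  have h1 := hz.1
  rw [ae_restrict_iff' measurableSet_Ico] at h1
  filter_upwards [h1] with s hs hs'
  rw [hs hs', histExt, indicator_of_mem (Ico_subset_Icc_self hs')]

/-- Hölder's inequality for the delayed term on the first unit of time, where that term involves
only the history. -/
lemma IsMild.integral_abs_delay_le [Fact (1 ≤ p)] (h : IsDelayCoeff q α β) (hz : IsMild α β u z)
    {t B : ℝ} (ht0 : 0 ≤ t) (ht : t ≤ 1) (hB0 : 0 ≤ B)
    (hB : eLpNorm β q (volume.restrict (Icc 0 t)) ≤ ENNReal.ofReal B) :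
    ∫ s in (0 : ℝ)..t, |β s * z (s - 1)| ≤ B * ‖u.snd‖ := by
  have hβm : AEStronglyMeasurable β (volume.restrict (Icc 0 t)) := (h.memLp 0 t).1
  have hzm : AEStronglyMeasurable (fun s => z (s - 1)) (volume.restrict (Icc 0 t)) := by
    have h1 := (hz.memLp h (t - 1)).comp_measurePreserving
      ((measurePreserving_sub_right volume (1 : ℝ)).restrict_preimage measurableSet_Icc)
    have h2 : MemLp (fun s => z (s - 1)) p (volume.restrict (Icc 0 t)) := by
      simpa [Function.comp_def] using h1
    exact h2.1
  have h1 : eLpNorm (fun s => z (s - 1)) p (volume.restrict (Icc 0 t)) ≤ ‖u.snd‖ₑ := by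
    rw [← eLpNorm_histExt_comp_add u (-1)]
    refine (eLpNorm_congr_ae (g := fun s => histExt u (s + -1)) ?_).trans_le
      (eLpNorm_mono_measure _ Measure.restrict_le_self)
    rw [EventuallyEq, ae_restrict_iff' measurableSet_Icc]
    have hne : ∀ᵐ s : ℝ, s ≠ 1 := by simp [ae_iff, measure_singleton]
    filter_upwards [(measurePreserving_sub_right volume (1 : ℝ)).quasiMeasurePreserving.ae
      hz.ae_eq_histExt, hne] with s hs hs1 hmem
    rw [hs ⟨by linarith [hmem.1], by
      have := lt_of_le_of_ne (hmem.2.trans ht) hs1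
      linarith⟩, sub_eq_add_neg]
  have h2 : eLpNorm (β • fun s => z (s - 1)) 1 (volume.restrict (Icc 0 t))
      ≤ ENNReal.ofReal B * ‖u.snd‖ₑ :=
    have : q.HolderTriple p 1 := ENNReal.HolderTriple.symm
    (eLpNorm_smul_le_mul_eLpNorm (p := q) (q := p) hzm hβm).trans (mul_le_mul' hB h1)
  rw [intervalIntegral.integral_of_le ht0, ← integral_Icc_eq_integral_Ioc]
  have h3 := integral_norm_eq_lintegral_enorm (hβm.smul hzm)
  simp only [Pi.smul_apply', smul_eq_mul, Real.norm_eq_abs] at h3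
  rw [h3]
  rw [eLpNorm_one_eq_lintegral_enorm] at h2
  refine ENNReal.toReal_le_of_le_ofReal (by positivity) (h2.trans_eq ?_)
  rw [ENNReal.ofReal_mul hB0, ofReal_norm]

omit [p.HolderConjugate q] in
lemma abs_prim_le (h : IsDelayCoeff q α β) {t r K : ℝ} (hr : 0 ≤ r) (hrt : r ≤ t)
    (hK : ∫ s in (0 : ℝ)..t, |α s| ≤ K) : |prim α r| ≤ K :=
  (intervalIntegral.abs_integral_le_integral_abs hr).trans <|
    (intervalIntegral.integral_mono_interval le_rfl hr hrt
      (Eventually.of_forall fun _ => abs_nonneg _) (h.intervalIntegrable 0 t).abs).trans hK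

/-- The a priori bound for the solutions on the first unit of time. -/
lemma IsMild.abs_le [Fact (1 ≤ p)] (h : IsDelayCoeff q α β) (hz : IsMild α β u z)
    {t K B : ℝ} (ht0 : 0 ≤ t) (ht : t ≤ 1) (hK : ∫ s in (0 : ℝ)..t, |α s| ≤ K) (hB0 : 0 ≤ B)
    (hB : eLpNorm β q (volume.restrict (Icc 0 t)) ≤ ENNReal.ofReal B) {r : ℝ} (hr : 0 ≤ r)
    (hrt : r ≤ t) : |z r| ≤ Real.exp (2 * K) * (1 + B) * ‖u‖ := by
  have hK0 : 0 ≤ K := (abs_nonneg _).trans (abs_prim_le h le_rfl ht0 hK)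
  have hI := (hz.intervalIntegrable h le_rfl ht0)
  have hI' : IntervalIntegrable (fun s => β s * z (s - 1)) volume 0 t := by
    have := hI.continuousOn_mul (Real.continuous_exp.comp h.continuous_prim).continuousOn
    refine this.congr fun s _ => ?_
    simp only [vocIntegrand, Function.comp]
    rw [← mul_assoc, ← Real.exp_add]
    simp
  have h1 : |∫ s in (0 : ℝ)..r, vocIntegrand α β z s| ≤ Real.exp K * (B * ‖u.snd‖) := by
    calc |∫ s in (0 : ℝ)..r, vocIntegrand α β z s|
        ≤ ∫ s in (0 : ℝ)..r, |vocIntegrand α β z s| :=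
          intervalIntegral.abs_integral_le_integral_abs hr
      _ ≤ ∫ s in (0 : ℝ)..t, |vocIntegrand α β z s| :=
          intervalIntegral.integral_mono_interval le_rfl hr hrt
            (Eventually.of_forall fun _ => abs_nonneg _) hI.abs
      _ ≤ ∫ s in (0 : ℝ)..t, Real.exp K * |β s * z (s - 1)| := by
          refine intervalIntegral.integral_mono_on ht0 hI.abs (hI'.abs.const_mul _) fun s hs => ?_
          rw [vocIntegrand, abs_mul, Real.abs_exp]
          gcongr
          exact (neg_le_abs _).trans (abs_prim_le h hs.1 hs.2 hK)
      _ = Real.exp K * ∫ s in (0 : ℝ)..t, |β s * z (s - 1)| :=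
          intervalIntegral.integral_const_mul _ _
      _ ≤ _ := by
          gcongr
          exact hz.integral_abs_delay_le h ht0 ht hB0 hB
  rw [hz.2 r hr, abs_mul, Real.abs_exp]
  have hu := DelaySpace.norm_eq u
  have hu1 := abs_nonneg u.fst
  have hu2 := norm_nonneg u.snd
  have h1K : 1 ≤ Real.exp K := Real.one_le_exp hK0
  calc Real.exp (prim α r) * |u.fst + ∫ s in (0 : ℝ)..r, vocIntegrand α β z s|
      ≤ Real.exp K * (|u.fst| + Real.exp K * (B * ‖u.snd‖)) := by
        gcongr
        · exact (le_abs_self _).trans (abs_prim_le h hr hrt hK)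
        · exact (abs_add_le _ _).trans (by gcongr)
    _ ≤ Real.exp K * (Real.exp K * ‖u‖ + Real.exp K * (B * ‖u‖)) := by
        gcongr
        · nlinarith
        · linarith
    _ = _ := by rw [two_mul, Real.exp_add]; ring

/-- The segment `s ↦ z (t + s)` of `z` at time `t`, as an element of `L_p([-1, 0])`; it is `0` if
the segment is not `p`-integrable. -/
def segment (p : ℝ≥0∞) (z : ℝ → ℝ) (t : ℝ) : Lp ℝ p histMeasure :=
  open Classical in
  if h : MemLp (fun s => z (t + s)) p histMeasure then h.toLp _ else 0

/-- The solution operator `u ↦ (z(t), z_t)` of the delay equation at time `t`. -/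
def delayOp (α β : ℝ → ℝ) (t : ℝ) (u : DelaySpace p) : DelaySpace p :=
  WithLp.toLp 1 (delaySol α β u t, segment p (delaySol α β u) t)

lemma IsMild.memLp_segment (h : IsDelayCoeff q α β) (hz : IsMild α β u z) {t : ℝ} (ht : 0 ≤ t) :
    MemLp (fun s => z (t + s)) p histMeasure := by
  have h1 := ((hz.memLp h t).mono_measure (Measure.restrict_mono
    (Icc_subset_Icc_left (by linarith : (-1 : ℝ) ≤ t + -1)) le_rfl)).comp_measurePreserving
      ((measurePreserving_add_left volume t).restrict_preimage measurableSet_Icc)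
  simpa [Function.comp_def] using h1

lemma delayOp_snd (h : IsDelayCoeff q α β) {t : ℝ} (ht : 0 ≤ t) :
    ∀ᵐ s ∂histMeasure, (delayOp α β t u).snd s = delaySol α β u (t + s) := by
  have hm := isMild_delaySol.memLp_segment (u := u) h ht
  have : (delayOp α β t u).snd = hm.toLp _ := dif_pos hm
  rw [this]
  exact hm.coeFn_toLp

lemma IsMild.delayOp_fst (hz : IsMild α β u z) {t : ℝ} (ht : 0 ≤ t) :
    (delayOp α β t u).fst = z t :=
  isMild_delaySol.unique hz t ht

lemma IsMild.delayOp_snd (h : IsDelayCoeff q α β) (hz : IsMild α β u z) {t : ℝ} (ht : 0 ≤ t) :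
    ∀ᵐ s ∂histMeasure, (delayOp α β t u).snd s = z (t + s) := by
  filter_upwards [RandomDelay.delayOp_snd (u := u) h ht, isMild_delaySol.ae_eq hz ht] with s h1 h2
  exact h1.trans h2

lemma delayOp_zero (h : IsDelayCoeff q α β) (u : DelaySpace p) : delayOp α β 0 u = u := by
  refine DelaySpace.ext' ?_ ?_
  · rw [isMild_delaySol.delayOp_fst le_rfl, isMild_delaySol.2 0 le_rfl]
    simp [prim]
  · have h1 := (isMild_delaySol (α := α) (β := β) (u := u)).1
    rw [restrict_Ico_eq_histMeasure] at h1
    filter_upwards [delayOp_snd (u := u) h le_rfl, h1] with s h1 h2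
    rw [h1, zero_add, h2]

lemma delayOp_add (h : IsDelayCoeff q α β) {t : ℝ} (ht : 0 ≤ t) (u v : DelaySpace p) :
    delayOp α β t (u + v) = delayOp α β t u + delayOp α β t v := by
  have hm := IsMild.add h (isMild_delaySol (α := α) (β := β) (u := u))
    (isMild_delaySol (α := α) (β := β) (u := v))
  refine DelaySpace.ext' ?_ ?_
  · rw [hm.delayOp_fst ht]; rfl
  · filter_upwards [hm.delayOp_snd h ht, delayOp_snd (u := u) h ht, delayOp_snd (u := v) h ht,
      Lp.coeFn_add (delayOp α β t u).snd (delayOp α β t v).snd] with s h1 h2 h3 h4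
    rw [h1, WithLp.add_snd, h4, Pi.add_apply, h2, h3]

lemma delayOp_smul (h : IsDelayCoeff q α β) {t : ℝ} (ht : 0 ≤ t) (c : ℝ) (u : DelaySpace p) :
    delayOp α β t (c • u) = c • delayOp α β t u := by
  have hm := IsMild.smul c (isMild_delaySol (α := α) (β := β) (u := u))
  refine DelaySpace.ext' ?_ ?_
  · rw [hm.delayOp_fst ht]; rfl
  · filter_upwards [hm.delayOp_snd h ht, delayOp_snd (u := u) h ht,
      Lp.coeFn_smul c (delayOp α β t u).snd] with s h1 h2 h3
    rw [h1, WithLp.smul_snd, h3, Pi.smul_apply, h2, smul_eq_mul]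

/-- The cocycle property of the solution operators. -/
lemma delayOp_comp (h : IsDelayCoeff q α β) {s t : ℝ} (hs : 0 ≤ s) (ht : 0 ≤ t)
    (u : DelaySpace p) :
    delayOp (fun r => α (r + s)) (fun r => β (r + s)) t (delayOp α β s u)
      = delayOp α β (t + s) u := by
  have hm := (isMild_delaySol (α := α) (β := β) (u := u)).shift h hs (v := delayOp α β s u) rfl
    (delayOp_snd h hs)
  refine DelaySpace.ext' ?_ ?_
  · rw [hm.delayOp_fst ht]; rfl
  · filter_upwards [hm.delayOp_snd (h.shift s) ht, delayOp_snd (u := u) h (add_nonneg ht hs)]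
      with r h1 h2
    rw [h1, h2, add_right_comm]

variable [Fact (1 ≤ p)]

/-- The segment at time `t` splits into the remaining history and the values taken since time `0`,
so that it is controlled by the norm of the history and a bound on `[0, t]`. -/
lemma norm_delayOp_snd_le (h : IsDelayCoeff q α β) {t C : ℝ} (ht : 0 ≤ t)
    (hC : ∀ r, 0 ≤ r → r ≤ t → |delaySol α β u r| ≤ C) :
    ‖(delayOp α β t u).snd‖ ≤ ‖u.snd‖ + C := by
  have hC0 : 0 ≤ C := (abs_nonneg _).trans (hC 0 le_rfl ht)
  have h1 : ‖(delayOp α β t u).snd‖ₑ ≤ ‖u.snd‖ₑ + ENNReal.ofReal C := by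
    rw [Lp.enorm_def]
    have hm1 : AEStronglyMeasurable (fun s => ‖histExt u (s + t)‖) histMeasure :=
      ((memLp_histExt u).comp_measurePreserving
        (measurePreserving_add_right volume t)).aestronglyMeasurable.norm.restrict
    calc eLpNorm (delayOp α β t u).snd p histMeasure
        ≤ eLpNorm ((fun s => ‖histExt u (s + t)‖) + fun _ => C) p histMeasure := by
          refine eLpNorm_mono_ae ?_
          have h2 := isMild_delaySol.ae_eq_histExt (α := α) (β := β) (u := u)
          have h3 := (measurePreserving_add_left volume t).quasiMeasurePreserving.ae h2
          rw [← Measure.restrict_univ (μ := volume)] at h3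
          filter_upwards [delayOp_snd (u := u) h ht, ae_mono (Measure.restrict_mono
            (subset_univ (Icc (-1 : ℝ) 0)) le_rfl) h3, ae_restrict_mem measurableSet_Icc]
            with s e1 e2 hs
          rw [e1]
          simp only [Pi.add_apply, Real.norm_eq_abs]
          rw [abs_of_nonneg (a := |histExt u (s + t)| + C) (by positivity)]
          rcases lt_or_ge (t + s) 0 with hlt | hge
          · rw [e2 ⟨by linarith [hs.1], hlt⟩, add_comm t s]
            linarith
          · have := hC (t + s) hge (by linarith [hs.2])
            have := abs_nonneg (histExt u (s + t))
            linarith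
      _ ≤ eLpNorm (fun s => ‖histExt u (s + t)‖) p histMeasure
          + eLpNorm (fun _ : ℝ => C) p histMeasure :=
          eLpNorm_add_le hm1 aestronglyMeasurable_const Fact.out
      _ ≤ ‖u.snd‖ₑ + ENNReal.ofReal C := by
          gcongr
          · rw [eLpNorm_norm, ← eLpNorm_histExt_comp_add u t]
            exact eLpNorm_mono_measure _ Measure.restrict_le_self
          · refine (eLpNorm_le_of_ae_bound (C := C) (Eventually.of_forall fun _ => ?_)).trans ?_
            · rw [Real.norm_eq_abs, abs_of_nonneg hC0]
            · simp
  rw [← ofReal_norm, ← ofReal_norm, ← ENNReal.ofReal_add (norm_nonneg _) hC0] at h1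
  exact (ENNReal.ofReal_le_ofReal_iff (by positivity)).1 h1

/-- The bound for the solution operators at times `t ≤ 1`. -/
lemma norm_delayOp_le (h : IsDelayCoeff q α β) {t K B : ℝ} (ht0 : 0 ≤ t) (ht : t ≤ 1)
    (hK : ∫ s in (0 : ℝ)..t, |α s| ≤ K) (hB0 : 0 ≤ B)
    (hB : eLpNorm β q (volume.restrict (Icc 0 t)) ≤ ENNReal.ofReal B) (u : DelaySpace p) :
    ‖delayOp α β t u‖ ≤ (1 + 2 * (Real.exp (2 * K) * (1 + B))) * ‖u‖ := by
  have hb := fun r hr hrt =>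
    isMild_delaySol.abs_le (u := u) h ht0 ht hK hB0 hB (r := r) hr hrt
  have h1 := norm_delayOp_snd_le h ht0 hb
  have h2 : |(delayOp α β t u).fst| ≤ _ := hb t ht0 le_rfl
  have hu := DelaySpace.norm_eq u
  have hu1 := abs_nonneg u.fst
  rw [DelaySpace.norm_eq]
  linarith

/-- The solution operators are bounded at all times: by the cocycle property, unit steps suffice. -/
lemma exists_norm_delayOp_le (h : IsDelayCoeff q α β) {t : ℝ} (ht : 0 ≤ t) :
    ∃ C, ∀ u : DelaySpace p, ‖delayOp α β t u‖ ≤ C * ‖u‖ := by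
  have key : ∀ n : ℕ, ∀ α β : ℝ → ℝ, IsDelayCoeff q α β → ∀ t : ℝ, 0 ≤ t → t ≤ n + 1 →
      ∃ C, ∀ u : DelaySpace p, ‖delayOp α β t u‖ ≤ C * ‖u‖ := by
    intro n
    induction n with
    | zero =>
      intro α β h t ht ht1
      refine ⟨_, norm_delayOp_le h ht (by simpa using ht1) le_rfl ENNReal.toReal_nonneg
        (ENNReal.ofReal_toReal (h.memLp 0 t).2.ne).ge⟩
    | succ n ih =>
      intro α β h t ht ht1
      rcases le_total t 1 with h1 | h1
      · exact ih α β h t ht (by have := n.cast_nonneg (α := ℝ); linarith)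
      obtain ⟨C, hC⟩ := ih _ _ (h.shift 1) (t - 1) (by linarith) (by push_cast at ht1; linarith)
      obtain ⟨C', hC'⟩ := ih α β h 1 zero_le_one (by have := n.cast_nonneg (α := ℝ); linarith)
      refine ⟨|C| * C', fun u => ?_⟩
      have h2 := delayOp_comp h zero_le_one (sub_nonneg.2 h1) u
      rw [sub_add_cancel] at h2
      rw [← h2, mul_assoc]
      refine (hC _).trans ?_
      gcongr
      · exact le_abs_self C
      · exact hC' u
  obtain ⟨n, hn⟩ := exists_nat_ge t
  exact key n α β h t ht (by linarith)

/-- Translations act continuously in `L_p`. -/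
lemma tendsto_eLpNorm_translation {f : ℝ → ℝ} (hp' : p ≠ ∞) (hf : MemLp f p volume) :
    Tendsto (fun t : ℝ => eLpNorm (fun s => f (t + s) - f s) p volume) (𝓝 0) (𝓝 0) := by
  let g : ℝ → C(ℝ, ℝ) := fun t => ⟨fun s => t + s, continuous_const_add t⟩
  have hg : Continuous g := ContinuousMap.continuous_of_continuous_uncurry _ continuous_add
  have hgm : ∀ t, MeasurePreserving (g t) volume volume := fun t =>
    measurePreserving_add_left volume t
  have h1 := (continuous_const (y := hf.toLp f)).compMeasurePreservingLp hg hgm hp'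
  have h2 := tendsto_iff_edist_tendsto_0.1 (h1.tendsto 0)
  refine h2.congr fun t => ?_
  rw [Lp.edist_def]
  refine eLpNorm_congr_ae ?_
  have e := hf.coeFn_toLp
  have e1 := Lp.coeFn_compMeasurePreserving (hf.toLp f) (hgm t)
  have e2 := Lp.coeFn_compMeasurePreserving (hf.toLp f) (hgm 0)
  filter_upwards [e1, e2, (hgm t).quasiMeasurePreserving.ae e,
    (hgm 0).quasiMeasurePreserving.ae e] with s a1 a2 a3 a4
  simp only [Pi.sub_apply, a1, a2, Function.comp]
  rw [a3, a4]
  simp [g]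

/-- Strong right continuity of the solution operators at time `0`. -/
theorem tendsto_delayOp_zero (hp' : p ≠ ∞) (h : IsDelayCoeff q α β) (u : DelaySpace p) :
    Tendsto (fun t => delayOp α β t u) (𝓝[≥] 0) (𝓝 u) := by
  have hp0 : p ≠ 0 := (zero_lt_one.trans_le (Fact.out : 1 ≤ p)).ne'
  have hm := isMild_delaySol (α := α) (β := β) (u := u)
  have h01 : ∀ᶠ t : ℝ in 𝓝[≥] 0, t ∈ Icc (0 : ℝ) 1 := Icc_mem_nhdsGE zero_lt_one
  have hfst : Tendsto (fun t => delaySol α β u t) (𝓝[≥] 0) (𝓝 u.fst) := by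
    have h1 := (hm.continuousOn h 1) 0 ⟨le_rfl, zero_le_one⟩
    have h2 : delaySol α β u 0 = u.fst := by simp [hm.2 0 le_rfl, prim]
    rw [ContinuousWithinAt, h2] at h1
    exact h1.mono_left (le_inf inf_le_left (le_principal_iff.2 h01))
  obtain ⟨C, hC⟩ := isCompact_Icc.exists_bound_of_continuousOn (hm.continuousOn h 1)
  -- the segment differs from the history by a translation, and by a bounded term on `[-t, 0]`
  have hbd : ∀ t ∈ Icc (0 : ℝ) 1, ‖(delayOp α β t u).snd - u.snd‖ₑ ≤
      eLpNorm (fun s => histExt u (t + s) - histExt u s) p volume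
        + ‖C‖ₑ * ENNReal.ofReal t ^ (1 / p.toReal) := by
    intro t ht
    have hvol : ENNReal.ofReal t = volume (Icc (-t) 0) := by simp
    have hmt := (memLp_histExt u).comp_measurePreserving (measurePreserving_add_left volume t)
    have hdm := (hmt.sub (memLp_histExt u)).aestronglyMeasurable.norm
    rw [Lp.enorm_def, hvol]
    calc eLpNorm ((delayOp α β t u).snd - u.snd : Lp ℝ p histMeasure) p histMeasure
        ≤ eLpNorm ((fun s => ‖histExt u (t + s) - histExt u s‖) +
            (Icc (-t) 0).indicator fun _ => C) p histMeasure := by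
          refine eLpNorm_mono_ae ?_
          have h2 := (measurePreserving_add_left volume t).quasiMeasurePreserving.ae
            hm.ae_eq_histExt
          have hne : ∀ᵐ s : ℝ, t + s ≠ 0 := by
            have : ∀ s : ℝ, t + s = 0 ↔ s = -t := fun s => by
              constructor <;> intro h <;> linarith
            simp [ae_iff, this, measure_singleton]
          filter_upwards [delayOp_snd (u := u) h ht.1, ae_restrict_of_ae h2,
            Lp.coeFn_sub (delayOp α β t u).snd u.snd, ae_restrict_of_ae hne,
            ae_restrict_mem measurableSet_Icc] with s e1 e2 e3 e4 hs
          have hus : u.snd s = histExt u s := (indicator_of_mem hs _).symm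
          rw [e3, Pi.sub_apply, e1, hus, Pi.add_apply]
          refine le_trans ?_ (le_abs_self _)
          rcases lt_or_ge (t + s) 0 with hlt | hge
          · rw [e2 ⟨by linarith [hs.1, ht.1], hlt⟩, indicator_of_notMem, add_zero]
            intro h'
            linarith [h'.1]
          · have hgt : 0 < t + s := lt_of_le_of_ne hge (Ne.symm e4)
            rw [indicator_of_mem (show s ∈ Icc (-t) 0 from ⟨by linarith, hs.2⟩)]
            have h0 : histExt u (t + s) = 0 := indicator_of_notMem (fun h' => by linarith [h'.2]) _
            rw [h0, zero_sub, norm_neg]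
            refine (norm_sub_le _ _).trans ?_
            rw [add_comm]
            gcongr
            exact hC _ ⟨hge, by linarith [hs.2, ht.2]⟩
      _ ≤ eLpNorm (fun s => ‖histExt u (t + s) - histExt u s‖) p histMeasure
          + eLpNorm ((Icc (-t) 0).indicator fun _ => C) p histMeasure :=
          eLpNorm_add_le hdm.restrict
            (aestronglyMeasurable_const.indicator measurableSet_Icc) Fact.out
      _ ≤ _ := by
          gcongr
          · rw [eLpNorm_norm]
            exact eLpNorm_mono_measure _ Measure.restrict_le_self
          · exact (eLpNorm_mono_measure _ Measure.restrict_le_self).trans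
              (eLpNorm_indicator_const_le _ _)
  have hsnd : Tendsto (fun t => (delayOp α β t u).snd) (𝓝[≥] 0) (𝓝 u.snd) := by
    rw [tendsto_iff_edist_tendsto_0]
    have hlim : Tendsto (fun t : ℝ => eLpNorm (fun s => histExt u (t + s) - histExt u s) p volume
        + ‖C‖ₑ * ENNReal.ofReal t ^ (1 / p.toReal)) (𝓝[≥] 0) (𝓝 0) := by
      have hpos : 0 < 1 / p.toReal := by
        have := ENNReal.toReal_pos hp0 hp'
        positivity
      have h1 : Tendsto (fun t : ℝ => ‖C‖ₑ * ENNReal.ofReal t ^ (1 / p.toReal)) (𝓝 0) (𝓝 0) := by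
        have : Continuous fun t : ℝ => ‖C‖ₑ * ENNReal.ofReal t ^ (1 / p.toReal) :=
          (ENNReal.continuous_const_mul (by simp)).comp
            ((ENNReal.continuous_rpow_const).comp ENNReal.continuous_ofReal)
        have h2 := this.tendsto 0
        simp only [ENNReal.ofReal_zero, ENNReal.zero_rpow_of_pos hpos, mul_zero] at h2
        exact h2
      have := (tendsto_eLpNorm_translation hp' (memLp_histExt u)).add h1
      rw [add_zero] at this
      exact this.mono_left nhdsWithin_le_nhds
    refine tendsto_of_tendsto_of_tendsto_of_le_of_le' tendsto_const_nhds hlim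
      (Eventually.of_forall fun _ => zero_le) ?_
    filter_upwards [h01] with t ht
    rw [edist_eq_enorm_sub]
    exact hbd t ht
  exact ((WithLp.prod_continuous_toLp 1 ℝ (Lp ℝ p histMeasure)).tendsto _).comp
    (hfst.prodMk_nhds hsnd)

end Operators

/-! ### Measurability lemmas -/

/-- In a separable metric space, every open set is a countable union of balls centred in a dense
sequence. -/
lemma measurable_of_measurable_dist {Y Z : Type*} [MeasurableSpace Y] [PseudoMetricSpace Z]
    [SecondCountableTopology Z] [MeasurableSpace Z] [BorelSpace Z] {F : Y → Z}
    (h : ∀ z, Measurable fun y => dist (F y) z) : Measurable F := by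
  rcases isEmpty_or_nonempty Z with hZ | hZ
  · exact measurable_of_subsingleton_codomain F
  refine measurable_of_isOpen fun O hO => ?_
  have hd := TopologicalSpace.denseRange_denseSeq Z
  set d := TopologicalSpace.denseSeq Z
  have hcover : F ⁻¹' O = ⋃ (n : ℕ) (m : ℕ) (_ : Metric.ball (d n) (1 / ((m : ℝ) + 1)) ⊆ O),
      {y | dist (F y) (d n) < 1 / ((m : ℝ) + 1)} := by
    ext y
    simp only [mem_preimage, mem_iUnion, mem_ofPred_eq, exists_prop]
    refine ⟨fun hy => ?_, fun ⟨n, m, hsub, hy⟩ => hsub hy⟩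
    obtain ⟨ε, hε, hball⟩ := Metric.isOpen_iff.1 hO _ hy
    obtain ⟨m, hm⟩ := exists_nat_one_div_lt (half_pos hε)
    have hm0 : (0 : ℝ) < 1 / ((m : ℝ) + 1) := by positivity
    obtain ⟨n, hn⟩ := hd.exists_dist_lt (F y) hm0
    refine ⟨n, m, fun z hz => hball ?_, hn⟩
    rw [Metric.mem_ball] at hz ⊢
    rw [dist_comm] at hn
    linarith [dist_triangle z (d n) (F y)]
  rw [hcover]
  exact MeasurableSet.iUnion fun n => MeasurableSet.iUnion fun m => MeasurableSet.iUnion fun _ =>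
    measurableSet_lt (h (d n)) measurable_const

lemma measurable_intervalIntegral {Y : Type*} [MeasurableSpace Y] {f : Y → ℝ → ℝ}
    (hf : Measurable (Function.uncurry f)) {l r : Y → ℝ} (hl : Measurable l) (hr : Measurable r) :
    Measurable fun y => ∫ s in l y..r y, f y s := by
  have key : ∀ {l r : Y → ℝ}, Measurable l → Measurable r →
      Measurable fun y => ∫ s in Ioc (l y) (r y), f y s := by
    intro l r hl hr
    have hS : MeasurableSet {x : Y × ℝ | x.2 ∈ Ioc (l x.1) (r x.1)} :=
      (measurableSet_lt (hl.comp measurable_fst) measurable_snd).inter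
        (measurableSet_le measurable_snd (hr.comp measurable_fst))
    have h1 : ∀ y, ∫ s in Ioc (l y) (r y), f y s
        = ∫ s, ({x : Y × ℝ | x.2 ∈ Ioc (l x.1) (r x.1)}.indicator (Function.uncurry f)) (y, s) := by
      intro y
      rw [← integral_indicator measurableSet_Ioc]
      rfl
    simp only [h1]
    exact (StronglyMeasurable.integral_prod_right
      (f := fun y s => {x : Y × ℝ | x.2 ∈ Ioc (l x.1) (r x.1)}.indicator
        (Function.uncurry f) (y, s))
      (hf.indicator hS).stronglyMeasurable).measurable
  simp only [intervalIntegral]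
  exact (key hl hr).sub (key hr hl)

section Random

variable {Ω : Type*} [MeasurableSpace Ω] [AddAction ℝ Ω] [MeasurableVAdd₂ ℝ Ω]

lemma measurable_orbit {a : Ω → ℝ} (ha : Measurable a) :
    Measurable fun x : ℝ × Ω => a (x.1 +ᵥ x.2) :=
  ha.comp (measurable_fst.vadd measurable_snd)

lemma measurable_orbit_intervalIntegral {a : Ω → ℝ} (ha : Measurable a) (x y : ℝ) :
    Measurable fun ω => ∫ r in x..y, a (r +ᵥ ω) :=
  measurable_intervalIntegral (f := fun ω r => a (r +ᵥ ω))
    ((measurable_orbit ha).comp measurable_swap) measurable_const measurable_const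

lemma measurable_prim_orbit {a : Ω → ℝ} (ha : Measurable a) :
    Measurable fun x : ℝ × Ω => prim (fun t => a (t +ᵥ x.2)) x.1 :=
  measurable_intervalIntegral (f := fun (x : ℝ × Ω) r => a (r +ᵥ x.2))
    ((measurable_orbit ha).comp (measurable_snd.prodMk (measurable_snd.comp measurable_fst)))
    measurable_const measurable_fst

lemma measurable_picard_orbit {p : ℝ≥0∞} {a b : Ω → ℝ} (ha : Measurable a) (hb : Measurable b)
    (u : DelaySpace p) (n : ℕ) : Measurable fun x : ℝ × Ω =>
      picard (fun t => a (t +ᵥ x.2)) (fun t => b (t +ᵥ x.2)) u n x.1 := by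
  induction n with
  | zero => exact (Lp.stronglyMeasurable u.snd).measurable.comp measurable_fst
  | succ n ih =>
    refine Measurable.ite (measurableSet_lt measurable_fst measurable_const)
      ((Lp.stronglyMeasurable u.snd).measurable.comp measurable_fst) ?_
    refine (Real.measurable_exp.comp (measurable_prim_orbit ha)).mul (measurable_const.add ?_)
    refine measurable_intervalIntegral (f := fun (x : ℝ × Ω) s => vocIntegrand
      (fun t => a (t +ᵥ x.2)) (fun t => b (t +ᵥ x.2)) (picard (fun t => a (t +ᵥ x.2))
        (fun t => b (t +ᵥ x.2)) u n) s) ?_ measurable_const measurable_fst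
    have h1 : Measurable fun y : (ℝ × Ω) × ℝ => (y.2, y.1.2) :=
      measurable_snd.prodMk (measurable_snd.comp measurable_fst)
    have h2 : Measurable fun y : (ℝ × Ω) × ℝ => (y.2 - 1, y.1.2) :=
      (measurable_snd.sub_const 1).prodMk (measurable_snd.comp measurable_fst)
    exact (Real.measurable_exp.comp ((measurable_prim_orbit ha).comp h1).neg).mul
      (((measurable_orbit hb).comp h1).mul (ih.comp h2))

lemma measurable_delaySol_orbit {p : ℝ≥0∞} {a b : Ω → ℝ} (ha : Measurable a) (hb : Measurable b)
    (u : DelaySpace p) : Measurable fun x : ℝ × Ω =>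
      delaySol (fun t => a (t +ᵥ x.2)) (fun t => b (t +ᵥ x.2)) u x.1 := by
  have h1 : Measurable fun y : ℕ × (ℝ × Ω) =>
      picard (fun t => a (t +ᵥ y.2.2)) (fun t => b (t +ᵥ y.2.2)) u y.1 y.2.1 :=
    measurable_from_prod_countable_right fun n => measurable_picard_orbit ha hb u n
  exact h1.comp (((Nat.measurable_floor.comp measurable_fst).add_const 1).prodMk measurable_id)

lemma measurable_delayOp_orbit {p q : ℝ≥0∞} [Fact (1 ≤ p)] [p.HolderConjugate q] (hp' : p ≠ ∞)
    {a b : Ω → ℝ} (ha : Measurable a) (hb : Measurable b)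
    (h : ∀ ω, IsDelayCoeff q (fun t : ℝ => a (t +ᵥ ω)) (fun t : ℝ => b (t +ᵥ ω)))
    (u : DelaySpace p) : Measurable fun x : ℝ≥0 × Ω =>
      delayOp (fun t : ℝ => a (t +ᵥ x.2)) (fun t : ℝ => b (t +ᵥ x.2)) x.1 u := by
  have : Fact (p ≠ ∞) := ⟨hp'⟩
  have hp0 : p ≠ 0 := (zero_lt_one.trans_le (Fact.out : 1 ≤ p)).ne'
  have hsol := measurable_delaySol_orbit ha hb u
  refine measurable_of_measurable_dist fun v => ?_
  simp only [dist_eq_norm, DelaySpace.norm_eq, WithLp.sub_fst, WithLp.sub_snd]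
  refine Measurable.add ?_ ?_
  · have h1 : Measurable fun x : ℝ≥0 × Ω => delaySol (fun t => a (t +ᵥ x.2))
        (fun t => b (t +ᵥ x.2)) u x.1 :=
      hsol.comp ((measurable_coe_nnreal_real.comp measurable_fst).prodMk measurable_snd)
    simp only [← Real.norm_eq_abs]
    exact (h1.sub_const v.fst).norm
  · have h1 : ∀ x : ℝ≥0 × Ω,
        ‖(delayOp (fun t => a (t +ᵥ x.2)) (fun t => b (t +ᵥ x.2)) x.1 u).snd - v.snd‖
        = ((∫⁻ s, ‖delaySol (fun t => a (t +ᵥ x.2)) (fun t => b (t +ᵥ x.2)) u (x.1 + s)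
          - v.snd s‖ₑ ^ p.toReal ∂histMeasure) ^ (1 / p.toReal)).toReal := by
      intro x
      rw [Lp.norm_def, eLpNorm_eq_lintegral_rpow_enorm_toReal hp0 hp']
      congr 2
      refine lintegral_congr_ae ?_
      filter_upwards [delayOp_snd (u := u) (h x.2) x.1.coe_nonneg, Lp.coeFn_sub
        (delayOp (fun t : ℝ => a (t +ᵥ x.2)) (fun t : ℝ => b (t +ᵥ x.2)) x.1 u).snd v.snd]
        with s h1 h2
      rw [h2, Pi.sub_apply, h1]
    simp only [h1]
    have h2 : Measurable fun y : (ℝ≥0 × Ω) × ℝ => (((y.1.1 : ℝ) + y.2, y.1.2) : ℝ × Ω) :=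
      ((measurable_coe_nnreal_real.comp (measurable_fst.comp measurable_fst)).add
        measurable_snd).prodMk (measurable_snd.comp measurable_fst)
    have h3 : Measurable fun y : (ℝ≥0 × Ω) × ℝ => ‖delaySol (fun t => a (t +ᵥ y.1.2))
        (fun t => b (t +ᵥ y.1.2)) u (y.1.1 + y.2) - v.snd y.2‖ₑ ^ p.toReal :=
      (((hsol.comp h2).sub ((Lp.stronglyMeasurable v.snd).measurable.comp
        measurable_snd)).enorm).pow_const _
    exact ((h3.lintegral_prod_right').pow_const _).ennreal_toReal

/-! ### The semiflow generated by the delay equation -/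

/-- The solution operator as a bounded linear operator. -/
def delayCLM {p q : ℝ≥0∞} [Fact (1 ≤ p)] [p.HolderConjugate q] {α β : ℝ → ℝ}
    (h : IsDelayCoeff q α β) (t : ℝ≥0) : DelaySpace p →L[ℝ] DelaySpace p :=
  LinearMap.mkContinuousOfExistsBound
    { toFun := delayOp α β t
      map_add' := delayOp_add h t.2
      map_smul' := fun c u => delayOp_smul h t.2 c u } (exists_norm_delayOp_le h t.2)

/-- The measurable linear skew-product semiflow generated by the delay equation. -/
def delaySemiflow {p q : ℝ≥0∞} [Fact (1 ≤ p)] [p.HolderConjugate q] (hp' : p ≠ ∞)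
    {a b : Ω → ℝ} (ha : Measurable a) (hb : Measurable b)
    (h : ∀ ω, IsDelayCoeff q (fun t : ℝ => a (t +ᵥ ω)) (fun t : ℝ => b (t +ᵥ ω))) :
    SkewProductSemiflow Ω (DelaySpace p) where
  U ω t := delayCLM (h ω) t
  measurable_U := by
    have : Fact (p ≠ ∞) := ⟨hp'⟩
    have h1 := measurable_uncurry_of_continuous_of_measurable
      (u := fun (u : DelaySpace p) (x : ℝ≥0 × Ω) => delayCLM (p := p) (h x.2) x.1 u)
      (fun x => (delayCLM (h x.2) x.1).continuous)
      (fun u => measurable_delayOp_orbit hp' ha hb h u)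
    exact h1.comp ((measurable_snd.comp measurable_snd).prodMk
      (measurable_fst.prodMk (measurable_fst.comp measurable_snd)))
  U_zero ω := by
    ext1 u
    exact delayOp_zero (h ω) u
  cocycle ω t s := by
    ext1 u
    have h1 := delayOp_comp (h ω) s.2 t.2 u
    simp only [add_vadd] at h1
    exact h1

lemma isGeneratedBy_delaySemiflow {p q : ℝ≥0∞} [Fact (1 ≤ p)] [p.HolderConjugate q]
    (hp' : p ≠ ∞) {a b : Ω → ℝ} (ha : Measurable a) (hb : Measurable b)
    (h : ∀ ω, IsDelayCoeff q (fun t : ℝ => a (t +ᵥ ω)) (fun t : ℝ => b (t +ᵥ ω))) :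
    IsGeneratedBy (delaySemiflow (p := p) hp' ha hb h) a b := by
  intro ω u
  refine ⟨⟨_, isMild_delaySol.isDelaySolution (h ω)⟩, fun z hz t => ?_⟩
  have hm := (h ω).isMild_of_isDelaySolution hz
  exact ⟨hm.delayOp_fst t.2, hm.delayOp_snd (h ω) t.2⟩

end Random

/-! ### The normalized coefficients -/

section Normalized

variable {Ω : Type*} [AddAction ℝ Ω]

lemma orbit_vadd (a : Ω → ℝ) (s : ℝ) (ω : Ω) :
    (fun t : ℝ => a (t +ᵥ (s +ᵥ ω))) = fun t => (fun t : ℝ => a (t +ᵥ ω)) (t + s) := by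
  funext t
  rw [vadd_vadd]

/-- The orbits of the normalized coefficient are locally integrable, the exceptional set being
invariant under the flow. -/
lemma normA_orbit (a : Ω → ℝ) (ω : Ω) :
    LocallyIntegrable (fun t : ℝ => normA a (t +ᵥ ω)) volume := by
  have hshift : ∀ (s : ℝ) (ω : Ω), LocallyIntegrable (fun t : ℝ => a (t +ᵥ ω)) volume →
      LocallyIntegrable (fun t : ℝ => a (t +ᵥ (s +ᵥ ω))) volume := by
    intro s ω h
    rw [orbit_vadd]
    exact (IsDelayCoeff.shift (q := 0) (β := 0) ⟨h, fun _ _ => MemLp.zero⟩ s).1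
  have hiff : ∀ s : ℝ, LocallyIntegrable (fun t : ℝ => a (t +ᵥ (s +ᵥ ω))) volume ↔
      LocallyIntegrable (fun t : ℝ => a (t +ᵥ ω)) volume := fun s =>
    ⟨fun h => by simpa using hshift (-s) _ h, hshift s ω⟩
  by_cases h : LocallyIntegrable (fun t : ℝ => a (t +ᵥ ω)) volume
  · have e : ∀ t : ℝ, normA a (t +ᵥ ω) = a (t +ᵥ ω) := fun t => if_pos ((hiff t).2 h)
    simpa only [e] using h
  · have e : ∀ t : ℝ, normA a (t +ᵥ ω) = 0 := fun t => if_neg fun h' => h ((hiff t).1 h')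
    simp only [e]
    exact locallyIntegrable_zero

lemma normB_orbit (q : ℝ≥0∞) (b : Ω → ℝ) (ω : Ω) (x y : ℝ) :
    MemLp (fun t : ℝ => normB q b (t +ᵥ ω)) q (volume.restrict (Icc x y)) := by
  have hshift : ∀ (s : ℝ) (ω : Ω),
      (∀ x y : ℝ, MemLp (fun t : ℝ => b (t +ᵥ ω)) q (volume.restrict (Icc x y))) →
      ∀ x y : ℝ, MemLp (fun t : ℝ => b (t +ᵥ (s +ᵥ ω))) q (volume.restrict (Icc x y)) := by
    intro s ω h
    rw [orbit_vadd]
    exact (IsDelayCoeff.shift (α := 0) ⟨locallyIntegrable_zero, h⟩ s).2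
  have hiff : ∀ s : ℝ,
      (∀ x y : ℝ, MemLp (fun t : ℝ => b (t +ᵥ (s +ᵥ ω))) q (volume.restrict (Icc x y))) ↔
      ∀ x y : ℝ, MemLp (fun t : ℝ => b (t +ᵥ ω)) q (volume.restrict (Icc x y)) := fun s =>
    ⟨fun h => by simpa using hshift (-s) _ h, hshift s ω⟩
  by_cases h : ∀ x y : ℝ, MemLp (fun t : ℝ => b (t +ᵥ ω)) q (volume.restrict (Icc x y))
  · have e : ∀ t : ℝ, normB q b (t +ᵥ ω) = b (t +ᵥ ω) := fun t => if_pos ((hiff t).2 h)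
    simpa only [e] using h x y
  · have e : ∀ t : ℝ, normB q b (t +ᵥ ω) = 0 := fun t => if_neg fun h' => h ((hiff t).1 h')
    simp only [e]
    exact MemLp.zero

lemma isDelayCoeff_norm (q : ℝ≥0∞) (a b : Ω → ℝ) (ω : Ω) :
    IsDelayCoeff q (fun t : ℝ => normA a (t +ᵥ ω)) (fun t : ℝ => normB q b (t +ᵥ ω)) :=
  ⟨normA_orbit a ω, normB_orbit q b ω⟩

lemma normB_nonneg (q : ℝ≥0∞) {b : Ω → ℝ} (hb : ∀ ω, 0 ≤ b ω) (ω : Ω) : 0 ≤ normB q b ω := by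
  rw [normB]
  split_ifs
  · exact hb ω
  · exact le_rfl

lemma exists_nat_Icc_subset (x y : ℝ) : ∃ n : ℕ, Icc x y ⊆ Icc (-(n : ℝ)) n := by
  obtain ⟨n, hn⟩ := exists_nat_ge (max |x| |y|)
  refine ⟨n, Icc_subset_Icc ?_ ?_⟩
  · linarith [neg_abs_le x, (le_max_left |x| |y|).trans hn]
  · linarith [le_abs_self y, (le_max_right |x| |y|).trans hn]

variable [MeasurableSpace Ω] [MeasurableVAdd₂ ℝ Ω]

lemma measurable_orbit_left {a : Ω → ℝ} (ha : Measurable a) (ω : Ω) :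
    Measurable fun t : ℝ => a (t +ᵥ ω) :=
  (measurable_orbit ha).comp (measurable_id.prodMk measurable_const)

lemma measurable_orbit_setLIntegral {a : Ω → ℝ} (ha : Measurable a) (r : ℝ) (s : Set ℝ) :
    Measurable fun ω => ∫⁻ t in s, ‖a (t +ᵥ ω)‖ₑ ^ r :=
  (((measurable_orbit ha).comp measurable_swap).enorm.pow_const r).lintegral_prod_right'

lemma setLIntegral_orbit_vadd {a : Ω → ℝ} (ha : Measurable a) (r x y k : ℝ) (ω : Ω) :
    ∫⁻ t in Icc x y, ‖a (t +ᵥ (k +ᵥ ω))‖ₑ ^ r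
      = ∫⁻ t in Icc (x + k) (y + k), ‖a (t +ᵥ ω)‖ₑ ^ r := by
  have h := ((measurePreserving_add_right volume k).restrict_preimage
    (measurableSet_Icc (a := x + k) (b := y + k))).lintegral_comp
      (((measurable_orbit_left ha ω).enorm).pow_const r)
  simp only [preimage_add_const_Icc, add_sub_cancel_right] at h
  simpa only [vadd_vadd] using h

lemma locallyIntegrable_orbit_iff {a : Ω → ℝ} (ha : Measurable a) (ω : Ω) :
    LocallyIntegrable (fun t : ℝ => a (t +ᵥ ω)) volume ↔
      ∀ n : ℕ, ∫⁻ t in Icc (-(n : ℝ)) n, ‖a (t +ᵥ ω)‖ₑ ^ (1 : ℝ) < ∞ := by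
  simp only [ENNReal.rpow_one]
  rw [locallyIntegrable_iff]
  constructor
  · intro h n
    exact (h _ isCompact_Icc).2
  · intro h K hK
    obtain ⟨x, y, hxy⟩ : ∃ x y : ℝ, K ⊆ Icc x y := by
      obtain ⟨x, hx⟩ := hK.bddBelow
      obtain ⟨y, hy⟩ := hK.bddAbove
      exact ⟨x, y, fun z hz => ⟨hx hz, hy hz⟩⟩
    obtain ⟨n, hn⟩ := exists_nat_Icc_subset x y
    have h1 : IntegrableOn (fun t : ℝ => a (t +ᵥ ω)) (Icc (-(n : ℝ)) n) :=
      ⟨(measurable_orbit_left ha ω).aestronglyMeasurable, h n⟩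
    exact h1.mono_set (hxy.trans hn)

lemma memLp_orbit_iff {q : ℝ≥0∞} (hq0 : q ≠ 0) (hq' : q ≠ ∞) {b : Ω → ℝ} (hb : Measurable b)
    (ω : Ω) :
    (∀ x y : ℝ, MemLp (fun t : ℝ => b (t +ᵥ ω)) q (volume.restrict (Icc x y))) ↔
      ∀ n : ℕ, ∫⁻ t in Icc (-(n : ℝ)) n, ‖b (t +ᵥ ω)‖ₑ ^ q.toReal < ∞ := by
  constructor
  · intro h n
    exact (eLpNorm_lt_top_iff_lintegral_rpow_enorm_lt_top hq0 hq').1 (h (-n) n).2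
  · intro h x y
    obtain ⟨n, hn⟩ := exists_nat_Icc_subset x y
    have h1 : MemLp (fun t : ℝ => b (t +ᵥ ω)) q (volume.restrict (Icc (-(n : ℝ)) n)) :=
      ⟨(measurable_orbit_left hb ω).aestronglyMeasurable,
        (eLpNorm_lt_top_iff_lintegral_rpow_enorm_lt_top hq0 hq').2 (h n)⟩
    exact h1.mono_measure (Measure.restrict_mono hn le_rfl)

lemma measurable_normA {a : Ω → ℝ} (ha : Measurable a) : Measurable (normA a) := by
  classical
  refine Measurable.ite ?_ ha measurable_const
  simp only [locallyIntegrable_orbit_iff ha, ofPred_forall]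
  exact MeasurableSet.iInter fun n =>
    measurableSet_lt (measurable_orbit_setLIntegral ha 1 _) measurable_const

lemma measurable_normB {q : ℝ≥0∞} (hq0 : q ≠ 0) (hq' : q ≠ ∞) {b : Ω → ℝ} (hb : Measurable b) :
    Measurable (normB q b) := by
  classical
  refine Measurable.ite ?_ hb measurable_const
  simp only [memLp_orbit_iff hq0 hq' hb, ofPred_forall]
  exact MeasurableSet.iInter fun n =>
    measurableSet_lt (measurable_orbit_setLIntegral hb q.toReal _) measurable_const

variable (P : Measure Ω) [VAddInvariantMeasure ℝ Ω P]

lemma normA_ae_eq [SFinite P] {a : Ω → ℝ} (ha : Measurable a) (hi : Integrable a P) :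
    normA a =ᵐ[P] a := by
  have h1 : ∀ n : ℕ, ∀ᵐ ω ∂P, ∫⁻ t in Icc (-(n : ℝ)) n, ‖a (t +ᵥ ω)‖ₑ ^ (1 : ℝ) < ∞ := by
    intro n
    refine ae_lt_top (measurable_orbit_setLIntegral ha 1 _) ?_
    simp only [ENNReal.rpow_one]
    rw [lintegral_lintegral_swap
      ((measurable_orbit ha).comp measurable_swap).enorm.aemeasurable]
    have h2 : ∀ t : ℝ, ∫⁻ ω, ‖a (t +ᵥ ω)‖ₑ ∂P = ∫⁻ ω, ‖a ω‖ₑ ∂P := fun t =>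
      (measurePreserving_vadd t P).lintegral_comp ha.enorm
    simp only [h2, lintegral_const]
    exact ENNReal.mul_ne_top hi.2.ne (by simp)
  filter_upwards [ae_all_iff.2 h1] with ω hω
  exact if_pos ((locallyIntegrable_orbit_iff ha ω).2 hω)

lemma normB_ae_eq {q : ℝ≥0∞} (hq0 : q ≠ 0) (hq' : q ≠ ∞) {b : Ω → ℝ} (hb : Measurable b)
    (hi : ∫⁻ ω, lnPlus (∫⁻ r in Icc (0 : ℝ) 1, ‖b (r +ᵥ ω)‖ₑ ^ q.toReal) ∂P < ∞) :
    normB q b =ᵐ[P] b := by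
  have hm := measurable_orbit_setLIntegral hb q.toReal (Icc 0 1)
  have hlm : Measurable lnPlus := by
    exact (EReal.continuous_toENNReal.comp ENNReal.continuous_log).measurable
  have h1 : ∀ᵐ ω ∂P, ∫⁻ r in Icc (0 : ℝ) 1, ‖b (r +ᵥ ω)‖ₑ ^ q.toReal < ∞ := by
    filter_upwards [ae_lt_top (hlm.comp hm) hi.ne] with ω hω
    rw [lt_top_iff_ne_top] at hω ⊢
    intro h
    apply hω
    simp [Function.comp, h, lnPlus]
  have h2 : ∀ k : ℤ, ∀ᵐ ω ∂P, ∫⁻ r in Icc (k : ℝ) (k + 1), ‖b (r +ᵥ ω)‖ₑ ^ q.toReal < ∞ := by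
    intro k
    filter_upwards [(measurePreserving_vadd (k : ℝ) P).quasiMeasurePreserving.ae h1] with ω hω
    rwa [setLIntegral_orbit_vadd hb, zero_add, add_comm 1] at hω
  filter_upwards [ae_all_iff.2 h2] with ω hω
  refine if_pos ((memLp_orbit_iff hq0 hq' hb ω).2 fun n => ?_)
  induction n with
  | zero => simp
  | succ n ih =>
    have hsub : Icc (-((n + 1 : ℕ) : ℝ)) (n + 1 : ℕ) ⊆ (Icc ((-(n + 1 : ℤ) : ℤ) : ℝ)
        ((-(n + 1 : ℤ) : ℤ) + 1) ∪ Icc (-(n : ℝ)) n) ∪ Icc ((n : ℤ) : ℝ) ((n : ℤ) + 1) := by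
      intro s hs
      push_cast at hs ⊢
      rcases le_total s (-n) with h | h
      · exact Or.inl (Or.inl ⟨hs.1, by linarith⟩)
      · rcases le_total s n with h' | h'
        · exact Or.inl (Or.inr ⟨h, h'⟩)
        · exact Or.inr ⟨h', hs.2⟩
    refine (lintegral_mono_set hsub).trans_lt ((lintegral_union_le _ _ _).trans_lt
      (ENNReal.add_lt_top.2 ⟨(lintegral_union_le _ _ _).trans_lt
        (ENNReal.add_lt_top.2 ⟨hω _, ih⟩), hω _⟩))

end Normalized

/-! ### Contraction of the projective oscillation by focusing operators -/

/-- A closed convex cone in a normed space for which the norm is monotone and such that every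
vector is dominated by a vector of the cone. -/
structure IsMonotoneCone {X : Type*} [NormedAddCommGroup X] [NormedSpace ℝ X] (K : Set X) :
    Prop where
  isClosed : IsClosed K
  add_mem : ∀ {u v : X}, u ∈ K → v ∈ K → u + v ∈ K
  smul_mem : ∀ {c : ℝ} {u : X}, 0 ≤ c → u ∈ K → c • u ∈ K
  norm_le : ∀ {u v : X}, u ∈ K → v - u ∈ K → ‖u‖ ≤ ‖v‖
  exists_dominating : ∀ u : X, ∃ v ∈ K, v - u ∈ K ∧ v + u ∈ K

section Cone

variable {X : Type*} [NormedAddCommGroup X] [NormedSpace ℝ X] {K : Set X}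

lemma IsMonotoneCone.eq_zero (hK : IsMonotoneCone K) {u : X} (h1 : u ∈ K) (h2 : -u ∈ K) :
    u = 0 := by
  have := hK.norm_le h1 (v := 0) (by simpa using h2)
  rw [norm_zero] at this
  exact norm_le_zero_iff.1 this

lemma IsMonotoneCone.zero_mem (hK : IsMonotoneCone K) {u : X} (hu : u ∈ K) : (0 : X) ∈ K := by
  simpa using hK.smul_mem le_rfl hu

/-- Order intervals are bounded in terms of their length. -/
lemma IsMonotoneCone.norm_le_of_mem_interval (hK : IsMonotoneCone K) {d v : X} {c₁ c₂ : ℝ}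
    (h0 : 0 ≤ c₁) (h0' : 0 ≤ c₂) (h1 : d + c₁ • v ∈ K) (h2 : c₂ • v - d ∈ K) :
    ‖d‖ ≤ (2 * c₁ + c₂) * ‖v‖ := by
  have h3 := hK.norm_le h1 (v := (c₁ + c₂) • v) (by convert h2 using 1; module)
  rw [norm_smul, Real.norm_eq_abs, abs_of_nonneg (by positivity)] at h3
  have h4 : ‖d‖ ≤ ‖d + c₁ • v‖ + ‖c₁ • v‖ := by
    simpa using norm_sub_le (d + c₁ • v) (c₁ • v)
  rw [norm_smul, Real.norm_eq_abs, abs_of_nonneg h0] at h4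
  linarith

/-- `L` shrinks the projective oscillation with respect to the cone `K` by the factor `δ`: if
`m v ≤ u ≤ M v`, then the same holds for `L u`, `L v` with bounds `m ≤ m' ≤ M' ≤ M` such that
`M' - m' ≤ δ (M - m)`. -/
def ShrinksOsc (K : Set X) (δ : ℝ) (L : X →L[ℝ] X) : Prop :=
  ∀ ⦃u v : X⦄ ⦃m M : ℝ⦄, u ∈ K → v ∈ K → m ≤ M → u - m • v ∈ K → M • v - u ∈ K →
    ∃ m' M' : ℝ, m ≤ m' ∧ m' ≤ M' ∧ M' ≤ M ∧ M' - m' ≤ δ * (M - m) ∧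
      L u - m' • L v ∈ K ∧ M' • L v - L u ∈ K

lemma ShrinksOsc.mono {δ δ' : ℝ} {L : X →L[ℝ] X} (h : ShrinksOsc K δ L) (hδ : δ ≤ δ') :
    ShrinksOsc K δ' L := by
  intro u v m M hu hv hmM h1 h2
  obtain ⟨m', M', a, b, c, d, e⟩ := h hu hv hmM h1 h2
  exact ⟨m', M', a, b, c, d.trans (mul_le_mul_of_nonneg_right hδ (by linarith)), e⟩

lemma shrinksOsc_one_of_positive {L : X →L[ℝ] X} (hL : ∀ u ∈ K, L u ∈ K) : ShrinksOsc K 1 L := by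
  intro u v m M _ _ hmM h1 h2
  refine ⟨m, M, le_rfl, hmM, le_rfl, by simp, ?_, ?_⟩
  · simpa using hL _ h1
  · simpa using hL _ h2

lemma ShrinksOsc.comp {δ₁ δ₂ : ℝ} {L₁ L₂ : X →L[ℝ] X} (h₁ : ShrinksOsc K δ₁ L₁)
    (h₂ : ShrinksOsc K δ₂ L₂) (hδ : 0 ≤ δ₁) (hL : ∀ u ∈ K, L₂ u ∈ K) :
    ShrinksOsc K (δ₁ * δ₂) (L₁.comp L₂) := by
  intro u v m M hu hv hmM h1 h2
  obtain ⟨m', M', a, b, c, d, e, f⟩ := h₂ hu hv hmM h1 h2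
  obtain ⟨m'', M'', a', b', c', d', e', f'⟩ := h₁ (hL u hu) (hL v hv) b e f
  refine ⟨m'', M'', a.trans a', b', c'.trans c, d'.trans ?_, e', f'⟩
  rw [mul_assoc]
  exact mul_le_mul_of_nonneg_left d hδ

/-- A focusing operator with constant `κ` shrinks the projective oscillation by the factor
`1 - 1 / κ`. -/
lemma shrinksOsc_of_focusing (hK : IsMonotoneCone K) {L : X →L[ℝ] X} {e : X} {κ : ℝ}
    (hκ : 1 ≤ κ)
    (hL : ∀ u ∈ K, ∃ β : ℝ, 0 ≤ β ∧ L u - β • e ∈ K ∧ (κ * β) • e - L u ∈ K) :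
    ShrinksOsc K (1 - 1 / κ) L := by
  have hκ0 : 0 < κ := by linarith
  have hκ1 : 1 / κ ≤ 1 := by rw [div_le_one hκ0]; exact hκ
  intro u v m M hu hv hmM h1 h2
  obtain ⟨β₁, hβ₁, a₁, b₁⟩ := hL _ h1
  obtain ⟨β₂, hβ₂, a₂, b₂⟩ := hL _ h2
  simp only [map_sub, map_smul] at a₁ b₁ a₂ b₂
  rcases (add_nonneg hβ₁ hβ₂).eq_or_lt with hs | hs
  · have e1 : β₁ = 0 := by linarith
    simp only [e1, mul_zero, zero_smul, sub_zero, zero_sub] at a₁ b₁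
    have e2 := hK.eq_zero a₁ b₁
    refine ⟨m, m, le_rfl, le_rfl, hmM, ?_, a₁, ?_⟩
    · rw [sub_self]; exact mul_nonneg (by linarith) (by linarith)
    · rw [← neg_sub, e2, neg_zero]
      exact hK.zero_mem hu
  · set s := β₁ + β₂ with hs_def
    -- `(M - m) L v ≤ κ (β₁ + β₂) e`, hence `e` can be bounded below by a multiple of `L v`
    have hkey : e - ((M - m) / (κ * s)) • L v ∈ K := by
      have := hK.smul_mem (c := 1 / (κ * s)) (by positivity) (hK.add_mem b₁ b₂)
      convert this using 1
      have h3 : (1 / (κ * s)) * (κ * β₁ + κ * β₂) = 1 := by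
        rw [← mul_add, ← hs_def]; field_simp
      have h4 : (κ * β₁) • e - (L u - m • L v) + ((κ * β₂) • e - (M • L v - L u))
          = (κ * β₁ + κ * β₂) • e - (M - m) • L v := by module
      rw [h4, smul_sub, smul_smul, smul_smul, h3, one_smul]
      congr 2
      ring
    have hd : 0 ≤ (M - m) / (κ * s) := div_nonneg (by linarith) (by positivity)
    have hsum : β₁ * ((M - m) / (κ * s)) + β₂ * ((M - m) / (κ * s)) = 1 / κ * (M - m) := by
      rw [← add_mul, ← hs_def]; field_simp
    refine ⟨m + β₁ * ((M - m) / (κ * s)), M - β₂ * ((M - m) / (κ * s)),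
      le_add_of_nonneg_right (by positivity), ?_, sub_le_self _ (by positivity), ?_, ?_, ?_⟩
    · have : 1 / κ * (M - m) ≤ M - m := mul_le_of_le_one_left (by linarith) hκ1
      linarith
    · refine le_of_eq ?_
      linear_combination -hsum
    · convert hK.add_mem a₁ (hK.smul_mem hβ₁ hkey) using 1
      module
    · convert hK.add_mem a₂ (hK.smul_mem hβ₂ hkey) using 1
      module

/-- The projective oscillation controls the distance of the normalized vectors. -/
lemma IsMonotoneCone.norm_normalize_sub_le (hK : IsMonotoneCone K) {x y : X} {m M : ℝ}
    (hx : x ∈ K) (hy : y ∈ K) (hx0 : x ≠ 0) (hy0 : y ≠ 0) (hm : 0 < m)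
    (h1 : x - m • y ∈ K) (h2 : M • y - x ∈ K) (hmM : m ≤ M) :
    ‖‖x‖⁻¹ • x - ‖y‖⁻¹ • y‖ ≤ 2 * ((M - m) / m) := by
  have hxn : 0 < ‖x‖ := norm_pos_iff.2 hx0
  have hyn : 0 < ‖y‖ := norm_pos_iff.2 hy0
  set ρ := ‖x‖ / ‖y‖ with hρ
  have hmρ : m ≤ ρ := by
    rw [hρ, le_div_iff₀ hyn]
    have := hK.norm_le (hK.smul_mem hm.le hy) h1
    rwa [norm_smul, Real.norm_eq_abs, abs_of_pos hm] at this
  have hρM : ρ ≤ M := by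
    rw [hρ, div_le_iff₀ hyn]
    have := hK.norm_le hx h2
    rwa [norm_smul, Real.norm_eq_abs, abs_of_pos (hm.trans_le hmM)] at this
  have hρ0 : 0 < ρ := hm.trans_le hmρ
  have h3 : ‖x - ρ • y‖ ≤ (2 * (ρ - m) + (M - ρ)) * ‖y‖ := by
    refine hK.norm_le_of_mem_interval (by linarith) (by linarith) ?_ ?_
    · convert h1 using 1; module
    · convert h2 using 1; module
  have h4 : ‖x‖⁻¹ • x - ‖y‖⁻¹ • y = ‖x‖⁻¹ • (x - ρ • y) := by
    rw [smul_sub, smul_smul, hρ]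
    congr 2
    field_simp
  rw [h4, norm_smul, norm_inv, norm_norm]
  calc ‖x‖⁻¹ * ‖x - ρ • y‖ ≤ ‖x‖⁻¹ * ((2 * (M - m)) * ‖y‖) := by
        gcongr
        exact h3.trans (by gcongr; linarith)
    _ = 2 * ((M - m) / ρ) := by rw [hρ]; field_simp
    _ ≤ 2 * ((M - m) / m) := by
        have : 0 ≤ M - m := by linarith
        gcongr

end Cone

/-! ### The Floquet vector of a focusing semiflow -/

section PrincipalExponent

variable {Ω X : Type*} [MeasurableSpace Ω] [AddAction ℝ Ω]
  [NormedAddCommGroup X] [NormedSpace ℝ X] [MeasurableSpace X]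
  {K : Set X} {Φ : SkewProductSemiflow Ω X} {T : ℝ≥0} {e : X} {κ : Ω → ℝ}

lemma SkewProductSemiflow.U_add_apply (Φ : SkewProductSemiflow Ω X) (ω : Ω) (t s : ℝ≥0) (u : X) :
    Φ.U ω (t + s) u = Φ.U ((s : ℝ) +ᵥ ω) t (Φ.U ω s u) := by
  rw [← Φ.cocycle]; rfl

/-- The pointwise part of the focusing property, together with positivity and the fact that the
vector `e` is never annihilated. -/
structure IsFocusing (K : Set X) (Φ : SkewProductSemiflow Ω X) (T : ℝ≥0) (e : X) (κ : Ω → ℝ) :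
    Prop where
  cone : IsMonotoneCone K
  positive : ∀ ω t, ∀ u ∈ K, Φ.U ω t u ∈ K
  e_mem : e ∈ K
  norm_e : ‖e‖ = 1
  U_e_ne_zero : ∀ ω t, Φ.U ω t e ≠ 0
  one_le : ∀ ω, 1 ≤ κ ω
  focus : ∀ ω, ∀ u ∈ K, Φ.U ω T u = 0 ∨ ∃ β : ℝ, 0 < β ∧ Φ.U ω T u - β • e ∈ K ∧
    (κ ω * β) • e - Φ.U ω T u ∈ K

lemma IsFocusing.exists_focus (h : IsFocusing K Φ T e κ) (ω : Ω) {u : X} (hu : u ∈ K) :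
    ∃ β : ℝ, 0 ≤ β ∧ Φ.U ω T u - β • e ∈ K ∧ (κ ω * β) • e - Φ.U ω T u ∈ K := by
  rcases h.focus ω u hu with h0 | ⟨β, hβ, h1⟩
  · exact ⟨0, le_rfl, by simpa [h0] using h.cone.zero_mem hu, by
      simpa [h0] using h.cone.zero_mem hu⟩
  · exact ⟨β, hβ.le, h1⟩

lemma IsFocusing.exists_pos_focus (h : IsFocusing K Φ T e κ) (ω : Ω) {u : X} (hu : u ∈ K)
    (hu0 : Φ.U ω T u ≠ 0) :
    ∃ β : ℝ, 0 < β ∧ Φ.U ω T u - β • e ∈ K ∧ (κ ω * β) • e - Φ.U ω T u ∈ K :=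
  (h.focus ω u hu).resolve_left hu0

/-- The image at `ω` of the vector `e` started a time `t` ago. -/
def pullback (Φ : SkewProductSemiflow Ω X) (e : X) (t : ℝ≥0) (ω : Ω) : X :=
  Φ.U ((-(t : ℝ)) +ᵥ ω) t e

/-- The normalized image at `ω` of the vector `e` started a time `t` ago. -/
def normPullback (Φ : SkewProductSemiflow Ω X) (e : X) (t : ℝ≥0) (ω : Ω) : X :=
  ‖pullback Φ e t ω‖⁻¹ • pullback Φ e t ω

lemma SkewProductSemiflow.U_neg_add (Φ : SkewProductSemiflow Ω X) (ω : Ω) (t r : ℝ≥0) :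
    Φ.U ((-((t + r : ℝ≥0) : ℝ)) +ᵥ ω) (t + r)
      = (Φ.U ((-(t : ℝ)) +ᵥ ω) t).comp (Φ.U ((-((t + r : ℝ≥0) : ℝ)) +ᵥ ω) r) := by
  rw [← Φ.cocycle, vadd_vadd]
  congr 3
  push_cast
  ring

/-- The set of the points whose past orbit keeps returning, at arbitrarily late times, to a set on
which `κ` is bounded. -/
def recurrentSet (κ : Ω → ℝ) : Set Ω :=
  {ω | ∃ C : ℕ, ∀ N : ℕ, ∃ t : ℝ≥0, N ≤ t ∧ κ ((-(t : ℝ)) +ᵥ ω) ≤ C}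

omit [MeasurableSpace Ω] in
lemma vadd_mem_recurrentSet (r : ℝ) {ω : Ω} (h : ω ∈ recurrentSet κ) :
    r +ᵥ ω ∈ recurrentSet κ := by
  obtain ⟨C, hC⟩ := h
  refine ⟨C, fun N => ?_⟩
  obtain ⟨k, hk⟩ := exists_nat_ge |r|
  obtain ⟨t, ht, hκ⟩ := hC (N + k)
  have ht' : (N : ℝ) + k ≤ t := by exact_mod_cast ht
  have hr := neg_abs_le r
  have h0 : 0 ≤ (t : ℝ) + r := by have := N.cast_nonneg (α := ℝ); linarith
  refine ⟨NNReal.mk (t + r) h0, ?_, ?_⟩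
  · rw [← NNReal.coe_le_coe, NNReal.coe_natCast, NNReal.coe_mk]
    linarith
  · rw [vadd_vadd, NNReal.coe_mk]
    simpa using hκ

/-- By the Poincaré recurrence theorem almost every point is recurrent. -/
lemma ae_mem_recurrentSet [MeasurableVAdd₂ ℝ Ω] (P : Measure Ω) [IsFiniteMeasure P]
    [VAddInvariantMeasure ℝ Ω P] (hκ : Measurable κ) : ∀ᵐ ω ∂P, ω ∈ recurrentSet κ := by
  have hT : MeasurePreserving (fun ω : Ω => (-1 : ℝ) +ᵥ ω) P P := measurePreserving_vadd (-1) P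
  have h1 : ∀ C : ℕ, ∀ᵐ ω ∂P, ω ∈ {ω | κ ω ≤ C} →
      ∃ᶠ n in atTop, (fun ω : Ω => (-1 : ℝ) +ᵥ ω)^[n] ω ∈ {ω | κ ω ≤ C} := fun C =>
    hT.conservative.ae_mem_imp_frequently_image_mem
      (measurableSet_le hκ measurable_const).nullMeasurableSet
  have hit : ∀ (n : ℕ) (ω : Ω), (fun ω : Ω => (-1 : ℝ) +ᵥ ω)^[n] ω = (-(n : ℝ)) +ᵥ ω := by
    intro n ω
    induction n with
    | zero => simp
    | succ n ih =>
      rw [Function.iterate_succ_apply', ih, vadd_vadd]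
      push_cast; congr 1; ring
  filter_upwards [ae_all_iff.2 h1] with ω hω
  obtain ⟨C, hC⟩ := exists_nat_ge (κ ω)
  refine ⟨C, fun N => ?_⟩
  obtain ⟨n, hn, hn'⟩ := (frequently_atTop.1 (hω C hC)) N
  rw [hit] at hn'
  exact ⟨n, by exact_mod_cast hn, by simpa using hn'⟩

/-- Along a recurrent past, the evolution from the remote past shrinks projective oscillations by
an arbitrarily small factor. -/
lemma IsFocusing.exists_shrinksOsc (h : IsFocusing K Φ T e κ) {ω : Ω} {C : ℕ}
    (hC : ∀ N : ℕ, ∃ t : ℝ≥0, N ≤ t ∧ κ ((-(t : ℝ)) +ᵥ ω) ≤ C) (j : ℕ) :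
    ∃ τ : ℝ≥0, ∀ t, τ ≤ t → ShrinksOsc K ((1 - 1 / (C : ℝ)) ^ j) (Φ.U ((-(t : ℝ)) +ᵥ ω) t) := by
  have hC1 : (1 : ℝ) ≤ C := by
    obtain ⟨t, -, ht⟩ := hC 0
    exact (h.one_le _).trans ht
  have hδ0 : 0 ≤ 1 - 1 / (C : ℝ) := by
    rw [sub_nonneg, div_le_one (by linarith)]; exact hC1
  induction j with
  | zero =>
    exact ⟨0, fun t _ => by simpa using shrinksOsc_one_of_positive (h.positive _ t)⟩
  | succ j ih =>
    -- prepend one more focusing passage of length `T`, starting at a return time `t₀ ≥ τ + T`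
    obtain ⟨τ, hτ⟩ := ih
    obtain ⟨N, hN⟩ := exists_nat_ge (τ + T)
    obtain ⟨t₀, ht₀, hκ⟩ := hC N
    refine ⟨t₀, fun t ht => ?_⟩
    obtain ⟨r, rfl⟩ := exists_add_of_le ht
    obtain ⟨r₀, hr₀⟩ := exists_add_of_le (hN.trans ht₀)
    rw [Φ.U_neg_add]
    have h1 : ShrinksOsc K ((1 - 1 / (C : ℝ)) ^ (j + 1)) (Φ.U ((-(t₀ : ℝ)) +ᵥ ω) t₀) := by
      have e1 : t₀ = (τ + r₀) + T := by rw [hr₀]; ring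
      have h2 := hτ (τ + r₀) le_self_add
      have h3 : ShrinksOsc K (1 - 1 / (C : ℝ)) (Φ.U ((-(t₀ : ℝ)) +ᵥ ω) T) := by
        refine (shrinksOsc_of_focusing h.cone (h.one_le _) fun u hu =>
          h.exists_focus _ hu).mono ?_
        have := h.one_le ((-(t₀ : ℝ)) +ᵥ ω)
        gcongr
      rw [pow_succ]
      rw [e1] at h3 ⊢
      rw [Φ.U_neg_add]
      exact h2.comp h3 (pow_nonneg hδ0 j) (h.positive _ _)
    have h4 := h1.comp (shrinksOsc_one_of_positive
      (h.positive ((-((t₀ + r : ℝ≥0) : ℝ)) +ᵥ ω) r)) (pow_nonneg hδ0 _) (h.positive _ _)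
    rwa [mul_one] at h4

lemma IsFocusing.pullback_mem (h : IsFocusing K Φ T e κ) (t : ℝ≥0) (ω : Ω) :
    pullback Φ e t ω ∈ K := h.positive _ _ _ h.e_mem

lemma IsFocusing.pullback_ne_zero (h : IsFocusing K Φ T e κ) (t : ℝ≥0) (ω : Ω) :
    pullback Φ e t ω ≠ 0 := h.U_e_ne_zero _ _

lemma IsFocusing.norm_normPullback (h : IsFocusing K Φ T e κ) (t : ℝ≥0) (ω : Ω) :
    ‖normPullback Φ e t ω‖ = 1 := by
  rw [normPullback, norm_smul, norm_inv, norm_norm,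
    inv_mul_cancel₀ (norm_ne_zero_iff.2 (h.pullback_ne_zero t ω))]

lemma IsFocusing.normPullback_mem (h : IsFocusing K Φ T e κ) (t : ℝ≥0) (ω : Ω) :
    normPullback Φ e t ω ∈ K :=
  h.cone.smul_mem (by positivity) (h.pullback_mem t ω)

/-- The normalized pullbacks form a Cauchy family along a recurrent past. -/
lemma IsFocusing.cauchy_normPullback (h : IsFocusing K Φ T e κ) {ω : Ω}
    (hω : ω ∈ recurrentSet κ) : Cauchy (map (fun t => normPullback Φ e t ω) atTop) := by
  obtain ⟨C, hC⟩ := hω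
  have hC1 : (1 : ℝ) ≤ C := by
    obtain ⟨t, -, ht⟩ := hC 0
    exact (h.one_le _).trans ht
  have hC0 : (0 : ℝ) < C := by linarith
  have hδ0 : 0 ≤ 1 - 1 / (C : ℝ) := by
    rw [sub_nonneg, div_le_one (by linarith)]; exact hC1
  have hδ1 : 1 - 1 / (C : ℝ) < 1 := by
    have : 0 < 1 / (C : ℝ) := by positivity
    linarith
  have key : ∀ j : ℕ, ∃ τ : ℝ≥0, ∀ s, τ ≤ s → ∀ s', τ ≤ s' →
      ‖normPullback Φ e s ω - normPullback Φ e s' ω‖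
        ≤ 2 * (C ^ 2 * (1 - 1 / (C : ℝ)) ^ j) := by
    intro j
    obtain ⟨τ, hτ⟩ := h.exists_shrinksOsc hC j
    obtain ⟨N, hN⟩ := exists_nat_ge (τ + T)
    obtain ⟨t₀, ht₀, hκ⟩ := hC N
    obtain ⟨r₀, hr₀⟩ := exists_add_of_le (hN.trans ht₀)
    have e1 : t₀ = (τ + r₀) + T := by rw [hr₀]; ring
    set κ₀ := κ ((-(t₀ : ℝ)) +ᵥ ω) with hκ₀
    -- the pullbacks are images of vectors in the order interval `[β e, C β e]`
    have hfac : ∀ s, t₀ ≤ s → ∃ y ∈ K, pullback Φ e s ω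
        = Φ.U ((-((τ + r₀ : ℝ≥0) : ℝ)) +ᵥ ω) (τ + r₀) y ∧
        ∃ β : ℝ, 0 < β ∧ y - β • e ∈ K ∧ (C * β) • e - y ∈ K := by
      intro s hs
      obtain ⟨r, rfl⟩ := exists_add_of_le hs
      have hv := h.positive ((-((t₀ + r : ℝ≥0) : ℝ)) +ᵥ ω) r e h.e_mem
      set v := Φ.U ((-((t₀ + r : ℝ≥0) : ℝ)) +ᵥ ω) r e
      have e2 : pullback Φ e (t₀ + r) ω = Φ.U ((-((τ + r₀ : ℝ≥0) : ℝ)) +ᵥ ω) (τ + r₀)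
          (Φ.U ((-(t₀ : ℝ)) +ᵥ ω) T v) := by
        rw [pullback, Φ.U_neg_add, ContinuousLinearMap.comp_apply]
        change Φ.U ((-(t₀ : ℝ)) +ᵥ ω) t₀ v = _
        have h5 := DFunLike.congr_fun (Φ.U_neg_add ω (τ + r₀) T) v
        rw [← e1] at h5
        exact h5
      have hne : Φ.U ((-(t₀ : ℝ)) +ᵥ ω) T v ≠ 0 := by
        intro h0
        rw [h0, map_zero] at e2
        exact h.pullback_ne_zero _ _ e2
      obtain ⟨β, hβ, a, b⟩ := h.exists_pos_focus _ hv hne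
      refine ⟨_, h.positive _ _ _ hv, e2, β, hβ, a, ?_⟩
      convert h.cone.add_mem b (h.cone.smul_mem (c := (C - κ₀) * β)
        (mul_nonneg (sub_nonneg.2 hκ) hβ.le) h.e_mem) using 1
      module
    refine ⟨t₀, fun s hs s' hs' => ?_⟩
    obtain ⟨y, hy, hyx, β, hβ, a, b⟩ := hfac s hs
    obtain ⟨y', hy', hyx', β', hβ', a', b'⟩ := hfac s' hs'
    set m := β / (C * β') with hm
    set M := C * β / β' with hM
    have hm0 : 0 < m := by positivity
    have hMm : M = C ^ 2 * m := by rw [hM, hm]; field_simp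
    have hmM : m ≤ M := by rw [hMm]; nlinarith [sq_nonneg ((C : ℝ) - 1)]
    have h1 : y - m • y' ∈ K := by
      convert h.cone.add_mem a (h.cone.smul_mem hm0.le b') using 1
      have : m * (C * β') = β := by rw [hm]; field_simp
      rw [smul_sub, smul_smul, this]
      module
    have h2 : M • y' - y ∈ K := by
      convert h.cone.add_mem b (h.cone.smul_mem (hm0.le.trans hmM) a') using 1
      have : M * β' = C * β := by rw [hM]; field_simp
      rw [smul_sub, smul_smul, this]
      module
    obtain ⟨m', M', c1, c2, c3, c4, c5, c6⟩ := hτ (τ + r₀) le_self_add hy hy' hmM h1 h2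
    rw [← hyx, ← hyx'] at c5 c6
    have h3 := h.cone.norm_normalize_sub_le (h.pullback_mem _ _) (h.pullback_mem _ _)
      (h.pullback_ne_zero _ _) (h.pullback_ne_zero _ _) (hm0.trans_le c1) c5 c6 c2
    refine h3.trans (mul_le_mul_of_nonneg_left ?_ zero_le_two)
    have hm'0 := hm0.trans_le c1
    rw [div_le_iff₀ hm'0]
    have hp : 0 ≤ (1 - 1 / (C : ℝ)) ^ j := pow_nonneg hδ0 j
    calc M' - m' ≤ (1 - 1 / (C : ℝ)) ^ j * (M - m) := c4
      _ ≤ (1 - 1 / (C : ℝ)) ^ j * (C ^ 2 * m) := by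
          rw [← hMm]; gcongr; linarith
      _ ≤ (1 - 1 / (C : ℝ)) ^ j * (C ^ 2 * m') := by gcongr
      _ = _ := by ring
  rw [Metric.cauchy_iff]
  refine ⟨inferInstance, fun ε hε => ?_⟩
  have hlim : Tendsto (fun j : ℕ => 2 * ((C : ℝ) ^ 2 * (1 - 1 / (C : ℝ)) ^ j)) atTop (𝓝 0) := by
    simpa using
      ((tendsto_pow_atTop_nhds_zero_of_lt_one hδ0 hδ1).const_mul ((C : ℝ) ^ 2)).const_mul 2
  obtain ⟨j, hj⟩ := (hlim.eventually (gt_mem_nhds hε)).exists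
  obtain ⟨τ, hτ⟩ := key j
  refine ⟨(fun t => normPullback Φ e t ω) '' Ici τ, image_mem_map (Ici_mem_atTop τ), ?_⟩
  rintro _ ⟨s, hs, rfl⟩ _ ⟨s', hs', rfl⟩
  rw [dist_eq_norm]
  exact (hτ s hs s' hs').trans_lt hj

/-- The generalized principal Floquet vector: the limit of the normalized pullbacks of `e`, which
exists on the recurrent set and is a junk value elsewhere. -/
def floquetVector (Φ : SkewProductSemiflow Ω X) (e : X) (ω : Ω) : X :=
  limUnder atTop (fun t => normPullback Φ e t ω)

variable [CompleteSpace X]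

lemma IsFocusing.tendsto_normPullback (h : IsFocusing K Φ T e κ) {ω : Ω}
    (hω : ω ∈ recurrentSet κ) :
    Tendsto (fun t => normPullback Φ e t ω) atTop (𝓝 (floquetVector Φ e ω)) :=
  tendsto_nhds_limUnder (cauchy_map_iff_exists_tendsto.1 (h.cauchy_normPullback hω))

lemma IsFocusing.norm_floquetVector (h : IsFocusing K Φ T e κ) {ω : Ω}
    (hω : ω ∈ recurrentSet κ) : ‖floquetVector Φ e ω‖ = 1 :=
  tendsto_nhds_unique (h.tendsto_normPullback hω).norm
    (by simp only [h.norm_normPullback]; exact tendsto_const_nhds)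

lemma IsFocusing.floquetVector_mem (h : IsFocusing K Φ T e κ) {ω : Ω}
    (hω : ω ∈ recurrentSet κ) : floquetVector Φ e ω ∈ K :=
  h.cone.isClosed.mem_of_tendsto (h.tendsto_normPullback hω)
    (Eventually.of_forall fun t => h.normPullback_mem t ω)

/-- The Floquet vector dominates `κ(θ_{-T} ω)⁻¹ e`. -/
lemma IsFocusing.floquetVector_sub_mem (h : IsFocusing K Φ T e κ) {ω : Ω}
    (hω : ω ∈ recurrentSet κ) :
    floquetVector Φ e ω - (κ ((-(T : ℝ)) +ᵥ ω))⁻¹ • e ∈ K := by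
  refine h.cone.isClosed.mem_of_tendsto ((h.tendsto_normPullback hω).sub_const _) ?_
  filter_upwards [eventually_ge_atTop T] with t ht
  obtain ⟨r, rfl⟩ := exists_add_of_le ht
  have hκ := h.one_le ((-(T : ℝ)) +ᵥ ω)
  set k := κ ((-(T : ℝ)) +ᵥ ω)
  have hv := h.positive ((-((T + r : ℝ≥0) : ℝ)) +ᵥ ω) r e h.e_mem
  have e1 : pullback Φ e (T + r) ω = Φ.U ((-(T : ℝ)) +ᵥ ω) T
      (Φ.U ((-((T + r : ℝ≥0) : ℝ)) +ᵥ ω) r e) := by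
    rw [pullback, Φ.U_neg_add]; rfl
  have hne := h.pullback_ne_zero (T + r) ω
  rw [e1] at hne
  obtain ⟨β, hβ, a, b⟩ := h.exists_pos_focus _ hv hne
  rw [← e1] at hne a b
  have hn := norm_pos_iff.2 hne
  have h2 := h.cone.norm_le (h.pullback_mem _ _) b
  rw [norm_smul, h.norm_e, mul_one, Real.norm_eq_abs, abs_of_nonneg (by positivity)] at h2
  have h3 : k⁻¹ ≤ ‖pullback Φ e (T + r) ω‖⁻¹ * β := by
    rw [inv_le_iff_one_le_mul₀ (by linarith), mul_assoc, mul_comm β, inv_mul_eq_div, one_le_div hn]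
    exact h2
  convert h.cone.add_mem (h.cone.smul_mem (inv_nonneg.2 hn.le) a)
    (h.cone.smul_mem (sub_nonneg.2 h3) h.e_mem) using 1
  rw [normPullback]
  module

/-- The orbit of the Floquet vector inherits lower bounds from the orbit of `e`. -/
lemma IsFocusing.norm_U_e_le (h : IsFocusing K Φ T e κ) {ω : Ω}
    (hω : ω ∈ recurrentSet κ) (t : ℝ≥0) :
    (κ ((-(T : ℝ)) +ᵥ ω))⁻¹ * ‖Φ.U ω t e‖ ≤ ‖Φ.U ω t (floquetVector Φ e ω)‖ := by
  have hκ := h.one_le ((-(T : ℝ)) +ᵥ ω)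
  have hκ0 : 0 ≤ (κ ((-(T : ℝ)) +ᵥ ω))⁻¹ := inv_nonneg.2 (by linarith)
  have h1 := h.positive ω t _ (h.floquetVector_sub_mem hω)
  rw [map_sub, map_smul] at h1
  have h2 := h.cone.norm_le (h.cone.smul_mem hκ0 (h.positive ω t e h.e_mem)) h1
  rwa [norm_smul, Real.norm_eq_abs, abs_of_nonneg hκ0] at h2

lemma IsFocusing.norm_U_floquetVector_pos (h : IsFocusing K Φ T e κ) {ω : Ω}
    (hω : ω ∈ recurrentSet κ) (t : ℝ≥0) : 0 < ‖Φ.U ω t (floquetVector Φ e ω)‖ := by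
  have hκ := h.one_le ((-(T : ℝ)) +ᵥ ω)
  refine lt_of_lt_of_le (mul_pos (inv_pos.2 (by linarith)) (norm_pos_iff.2 ?_)) (h.norm_U_e_le hω t)
  exact h.U_e_ne_zero ω t

/-- The Floquet directions are invariant under the semiflow. -/
lemma IsFocusing.U_floquetVector (h : IsFocusing K Φ T e κ) {ω : Ω}
    (hω : ω ∈ recurrentSet κ) (t : ℝ≥0) :
    Φ.U ω t (floquetVector Φ e ω)
      = ‖Φ.U ω t (floquetVector Φ e ω)‖ • floquetVector Φ e ((t : ℝ) +ᵥ ω) := by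
  have hpos := h.norm_U_floquetVector_pos hω t
  have h1 := (Φ.U ω t).continuous.tendsto _ |>.comp (h.tendsto_normPullback hω)
  have h2 : Tendsto (fun s => ‖Φ.U ω t (normPullback Φ e s ω)‖⁻¹ •
      Φ.U ω t (normPullback Φ e s ω)) atTop
      (𝓝 (‖Φ.U ω t (floquetVector Φ e ω)‖⁻¹ • Φ.U ω t (floquetVector Φ e ω))) :=
    (h1.norm.inv₀ hpos.ne').smul h1
  have h3 : ∀ s : ℝ≥0, ‖Φ.U ω t (normPullback Φ e s ω)‖⁻¹ • Φ.U ω t (normPullback Φ e s ω)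
      = normPullback Φ e (s + t) ((t : ℝ) +ᵥ ω) := by
    intro s
    have e1 : pullback Φ e (s + t) ((t : ℝ) +ᵥ ω) = Φ.U ω t (pullback Φ e s ω) := by
      rw [pullback, pullback, vadd_vadd, add_comm s t, Φ.U_add_apply, vadd_vadd]
      have e2 : (-((t + s : ℝ≥0) : ℝ) + t : ℝ) = -(s : ℝ) := by push_cast; ring
      rw [e2]
      simp
    rw [normPullback, normPullback, e1, map_smul, norm_smul, norm_inv, norm_norm, smul_smul]
    congr 1
    have := norm_pos_iff.2 (h.pullback_ne_zero s ω)
    rw [mul_inv, inv_inv]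
    field_simp
  simp only [h3] at h2
  have h4 := (h.tendsto_normPullback (vadd_mem_recurrentSet (t : ℝ) hω)).comp
    (tendsto_atTop_mono (fun s : ℝ≥0 => (le_self_add : s ≤ s + t)) tendsto_id)
  have h5 := tendsto_nhds_unique h2 h4
  rw [← h5, smul_smul, mul_inv_cancel₀ hpos.ne', one_smul]

/-- Every orbit is eventually dominated by the orbit of the Floquet vector. -/
lemma IsFocusing.exists_norm_U_le (h : IsFocusing K Φ T e κ) {ω : Ω}
    (hω : ω ∈ recurrentSet κ) (u : X) :
    ∃ c : ℝ, 0 < c ∧ ∀ t, T ≤ t → ‖Φ.U ω t u‖ ≤ c * ‖Φ.U ω t (floquetVector Φ e ω)‖ := by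
  obtain ⟨v, hv, h1, h2⟩ := h.cone.exists_dominating u
  obtain ⟨β, hβ, -, b⟩ := h.exists_focus ω hv
  obtain ⟨β', hβ', a', -⟩ := h.exists_pos_focus ω (h.floquetVector_mem hω)
    (norm_pos_iff.1 (h.norm_U_floquetVector_pos hω T))
  have hκ := h.one_le ω
  set w := floquetVector Φ e ω
  set c := κ ω * β / β' with hc
  have hc0 : 0 ≤ c := by positivity
  have h3 : c • Φ.U ω T w - Φ.U ω T v ∈ K := by
    convert h.cone.add_mem b (h.cone.smul_mem hc0 a') using 1
    have : c * β' = κ ω * β := by rw [hc]; field_simp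
    rw [smul_sub, smul_smul, this]
    module
  refine ⟨3 * c + 1, by positivity, fun t ht => ?_⟩
  obtain ⟨r, rfl⟩ := exists_add_of_le ht
  rw [add_comm T r]
  have h4 := h.positive ((T : ℝ) +ᵥ ω) r _ h3
  rw [map_sub, map_smul, ← Φ.U_add_apply, ← Φ.U_add_apply] at h4
  have h5 := h.cone.norm_le (h.positive ω (r + T) v hv) h4
  rw [norm_smul, Real.norm_eq_abs, abs_of_nonneg hc0] at h5
  have h6 := h.positive ω (r + T) _ h1
  have h7 := h.positive ω (r + T) _ h2
  rw [map_sub] at h6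
  rw [map_add, add_comm] at h7
  have h8 := h.cone.norm_le_of_mem_interval (d := Φ.U ω (r + T) u) (v := Φ.U ω (r + T) v)
    zero_le_one zero_le_one (by simpa using h7) (by simpa using h6)
  have := norm_nonneg (Φ.U ω (r + T) w)
  nlinarith

end PrincipalExponent

/-! ### The principal Lyapunov exponent -/

/-- The growth rate of an additive cocycle is constant along orbits. -/
lemma IsAdditiveCocycle.tendsto_div_vadd {Ω : Type*} [AddAction ℝ Ω] {F : ℝ≥0 → Ω → ℝ}
    (hF : IsAdditiveCocycle F) {I : ℝ} (r : ℝ) {ω : Ω}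
    (h : Tendsto (fun t : ℝ≥0 => F t ω / t) atTop (𝓝 I)) :
    Tendsto (fun t : ℝ≥0 => F t (r +ᵥ ω) / t) atTop (𝓝 I) := by
  have hconst : ∀ c : ℝ, Tendsto (fun t : ℝ≥0 => c / (t : ℝ)) atTop (𝓝 0) := fun c =>
    tendsto_const_nhds.div_atTop (NNReal.tendsto_coe_atTop.2 tendsto_id)
  have hpos : ∀ᶠ t : ℝ≥0 in atTop, (0 : ℝ) < t := by
    filter_upwards [eventually_gt_atTop 0] with t ht
    exact_mod_cast ht
  rcases le_total 0 r with hr | hr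
  · lift r to ℝ≥0 using hr
    have hmap : Tendsto (fun t : ℝ≥0 => t + r) atTop atTop :=
      tendsto_atTop_mono (fun s : ℝ≥0 => (le_self_add : s ≤ s + r)) tendsto_id
    -- `F t (r +ᵥ ω) = F (r + t) ω - F r ω`
    have h1 := (h.comp hmap).mul ((tendsto_const_nhds (x := (1 : ℝ))).add (hconst r))
    have h2 := h1.sub (hconst (F r ω))
    simp only [add_zero, mul_one, sub_zero] at h2
    refine h2.congr' ?_
    filter_upwards [hpos] with t ht
    have := hF r t ω
    have hr0 : (0 : ℝ) ≤ r := r.2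
    simp only [Function.comp, NNReal.coe_add, add_comm t r, this]
    field_simp
    ring
  · obtain ⟨s, hs⟩ : ∃ s : ℝ≥0, (s : ℝ) = -r := ⟨Real.toNNReal (-r), by
      rw [Real.coe_toNNReal _ (by linarith)]⟩
    have hω : ω = (s : ℝ) +ᵥ (r +ᵥ ω) := by rw [vadd_vadd, hs]; simp
    have hmap : Tendsto (fun t : ℝ≥0 => t - s) atTop atTop := by
      refine tendsto_atTop.2 fun b => ?_
      filter_upwards [eventually_ge_atTop (b + s)] with t ht
      exact le_tsub_of_add_le_right ht
    -- `F t (r +ᵥ ω) = F s (r +ᵥ ω) + F (t - s) ω`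
    have h1 := (h.comp hmap).mul ((tendsto_const_nhds (x := (1 : ℝ))).sub (hconst s))
    have h2 := h1.add (hconst (F s (r +ᵥ ω)))
    simp only [sub_zero, mul_one, add_zero] at h2
    refine h2.congr' ?_
    filter_upwards [hpos, eventually_gt_atTop s] with t ht hst
    have := hF s (t - s) (r +ᵥ ω)
    rw [← hω, add_tsub_cancel_of_le hst.le] at this
    have hst' : (0 : ℝ) < t - s := by
      rw [sub_pos]; exact_mod_cast hst
    simp only [Function.comp, this, NNReal.coe_sub hst.le]
    field_simp
    ring

lemma log_enorm_of_ne_zero {X : Type*} [NormedAddCommGroup X] {x : X} (hx : x ≠ 0) :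
    ENNReal.log ‖x‖ₑ = ((Real.log ‖x‖ : ℝ) : EReal) := by
  rw [← ofReal_norm, ENNReal.log_ofReal_of_pos (norm_pos_iff.2 hx)]

section PrincipalExponent

variable {Ω X : Type*} [MeasurableSpace Ω] [AddAction ℝ Ω] [MeasurableVAdd₂ ℝ Ω]
  {P : Measure Ω} [IsProbabilityMeasure P] [ErgodicVAdd ℝ Ω P]
  [NormedAddCommGroup X] [NormedSpace ℝ X] [MeasurableSpace X] [CompleteSpace X]
  [SecondCountableTopology X] [BorelSpace X]
  {K : Set X} {Φ : SkewProductSemiflow Ω X} {T : ℝ≥0} {e : X} {κ : Ω → ℝ}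

omit [CompleteSpace X] in
lemma measurable_normPullback (Φ : SkewProductSemiflow Ω X) (e : X)
    (t : ℝ≥0) : Measurable (normPullback Φ e t) := by
  have h : Measurable (pullback Φ e t) :=
    Φ.measurable_U.comp (measurable_const.prodMk
      ((measurable_const_vadd (-(t : ℝ))).prodMk measurable_const))
  exact h.norm.inv.smul h

omit [MeasurableVAdd₂ ℝ Ω] [SecondCountableTopology X] [BorelSpace X] in
/-- Along a recurrent past, the growth rate of the Floquet vector is an upper bound for all growth
rates. -/
lemma IsFocusing.limsup_log_norm_le (h : IsFocusing K Φ T e κ) {ω : Ω}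
    (hω : ω ∈ recurrentSet κ) {I : ℝ}
    (hI : Tendsto (fun t : ℝ≥0 => Real.log ‖Φ.U ω t (floquetVector Φ e ω)‖ / t) atTop (𝓝 I))
    (u : X) :
    limsup (fun t : ℝ≥0 => ENNReal.log ‖Φ.U ω t u‖ₑ / (((t : ℝ) : EReal))) atTop ≤ I := by
  obtain ⟨c, hc, hcu⟩ := h.exists_norm_U_le hω u
  have h1 : Tendsto (fun t : ℝ≥0 => Real.log c / t +
      Real.log ‖Φ.U ω t (floquetVector Φ e ω)‖ / t) atTop (𝓝 I) := by
    have h2 : Tendsto (fun t : ℝ≥0 => Real.log c / (t : ℝ)) atTop (𝓝 0) :=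
      tendsto_const_nhds.div_atTop (NNReal.tendsto_coe_atTop.2 tendsto_id)
    simpa using h2.add hI
  have h3 := (continuous_coe_real_ereal.tendsto I).comp h1
  rw [← h3.limsup_eq]
  refine limsup_le_limsup ?_
  filter_upwards [eventually_ge_atTop T] with t ht
  have hpos := h.norm_U_floquetVector_pos hω t
  have h4 : ENNReal.log ‖Φ.U ω t u‖ₑ
      ≤ ((Real.log c + Real.log ‖Φ.U ω t (floquetVector Φ e ω)‖ : ℝ) : EReal) := by
    rw [← Real.log_mul hc.ne' hpos.ne', ← ENNReal.log_ofReal_of_pos (mul_pos hc hpos)]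
    refine ENNReal.log_monotone ?_
    rw [← ofReal_norm]
    exact ENNReal.ofReal_le_ofReal (hcu t ht)
  refine (EReal.div_le_div_right_of_nonneg (by exact_mod_cast t.2) h4).trans_eq ?_
  simp only [Function.comp, ← add_div]
  rw [EReal.coe_div]

/-- A focusing semiflow over an ergodic flow has a principal Lyapunov exponent as soon as the
growth of norms and the decay of the orbits of `e` over a unit of time, as well as `κ`, are
logarithmically integrable: on the recurrent set, `log ‖U_ω(t) w(ω)‖` is an additive cocycle, to
which the pointwise ergodic theorem applies. -/
theorem IsFocusing.exists_isPrincipalLyapunovExponent (h : IsFocusing K Φ T e κ)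
    (hκm : Measurable κ) (hκi : Integrable (fun ω => Real.log (κ ω)) P) {H L : Ω → ℝ}
    (hHm : Measurable H) (hHi : Integrable H P) (hLm : Measurable L) (hLi : Integrable L P)
    (hH : ∀ ω, ∀ t ≤ (1 : ℝ≥0), ‖Φ.U ω t‖ ≤ Real.exp (H ω))
    (hL : ∀ ω, ∀ t ≤ (1 : ℝ≥0), Real.exp (-L ω) ≤ ‖Φ.U ω t e‖) :
    ∃ lam : EReal, IsPrincipalLyapunovExponent P K Φ lam := by
  classical
  obtain ⟨S, hSA, hSm, hSinv, hSP⟩ := exists_measurableSet_invariant_subset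
    (P := P) (A := recurrentSet κ) (fun t _ => vadd_mem_recurrentSet t)
    (ae_mem_recurrentSet P hκm)
  have hSv : ∀ (t : ℝ) (ω : Ω), t +ᵥ ω ∈ S ↔ ω ∈ S := fun t ω => by
    have : ω ∈ (fun ω => t +ᵥ ω) ⁻¹' S ↔ ω ∈ S := by rw [hSinv]
    exact this
  set w : Ω → X := S.indicator (floquetVector Φ e) with hw
  have hwS : ∀ ω ∈ S, w ω = floquetVector Φ e ω := fun ω hω => indicator_of_mem hω _
  have hwm : Measurable w := by
    refine measurable_of_tendsto_metrizable
      (f := fun n : ℕ => S.indicator (normPullback Φ e n))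
      (fun n => (measurable_normPullback Φ e n).indicator hSm) ?_
    rw [tendsto_pi_nhds]
    intro ω
    by_cases hω : ω ∈ S
    · simp only [hw, indicator_of_mem hω]
      exact (h.tendsto_normPullback (hSA hω)).comp tendsto_natCast_atTop_atTop
    · simp only [hw, indicator_of_notMem hω]
      exact tendsto_const_nhds
  set F : ℝ≥0 → Ω → ℝ := fun t ω => if ω ∈ S then Real.log ‖Φ.U ω t (w ω)‖ else 0 with hF
  have hFcoc : IsAdditiveCocycle F := by
    intro s t ω
    by_cases hω : ω ∈ S
    · have hsω := (hSv s ω).2 hω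
      simp only [hF, if_pos hω, if_pos hsω, hwS ω hω, hwS _ hsω]
      have h1 := h.norm_U_floquetVector_pos (hSA hω) s
      have h2 := h.norm_U_floquetVector_pos (hSA hsω) t
      rw [add_comm s t, Φ.U_add_apply, h.U_floquetVector (hSA hω) s, map_smul, norm_smul,
        norm_norm, Real.log_mul h1.ne' h2.ne']
      congr 2
      rw [norm_smul, norm_norm, h.norm_floquetVector (hSA hsω), mul_one]
    · have hsω := fun hc => hω ((hSv s ω).1 hc)
      simp [hF, if_neg hω, if_neg hsω]
  have hFm : Measurable (F 1) := by
    refine Measurable.ite hSm ?_ measurable_const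
    exact Real.measurable_log.comp (Φ.measurable_U.comp
      (measurable_const.prodMk (measurable_id.prodMk hwm))).norm
  have hTm : MeasurePreserving (fun ω : Ω => (-(T : ℝ)) +ᵥ ω) P P :=
    measurePreserving_vadd (-(T : ℝ)) P
  set G : Ω → ℝ := fun ω => |H ω| + |L ω| + |Real.log (κ ((-(T : ℝ)) +ᵥ ω))| with hG
  have hGi : Integrable G P :=
    (hHi.abs.add hLi.abs).add (hTm.integrable_comp_of_integrable hκi).abs
  have hGm : Measurable G := by
    have h1 : Measurable fun ω => Real.log (κ ((-(T : ℝ)) +ᵥ ω)) :=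
      Real.measurable_log.comp (hκm.comp hTm.measurable)
    simp only [hG, ← Real.norm_eq_abs]
    exact (hHm.norm.add hLm.norm).add h1.norm
  have hFG : ∀ t ≤ (1 : ℝ≥0), ∀ ω, |F t ω| ≤ G ω := by
    intro t ht ω
    have a1 := abs_nonneg (H ω)
    have a2 := abs_nonneg (L ω)
    have a3 := abs_nonneg (Real.log (κ ((-(T : ℝ)) +ᵥ ω)))
    by_cases hω : ω ∈ S
    · simp only [hF, if_pos hω, hwS ω hω, hG]
      have hpos := h.norm_U_floquetVector_pos (hSA hω) t
      have hκ := h.one_le ((-(T : ℝ)) +ᵥ ω)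
      have hκ0 : 0 < κ ((-(T : ℝ)) +ᵥ ω) := by linarith
      rw [abs_le]
      constructor
      · have h1 := (mul_le_mul_of_nonneg_left (hL ω t ht) (inv_nonneg.2 hκ0.le)).trans
          (h.norm_U_e_le (hSA hω) t)
        have h2 := Real.log_le_log (by positivity) h1
        rw [Real.log_mul (by positivity) (by positivity), Real.log_inv, Real.log_exp] at h2
        have := le_abs_self (L ω)
        have := le_abs_self (Real.log (κ ((-(T : ℝ)) +ᵥ ω)))
        linarith
      · have h1 := (Φ.U ω t).le_opNorm (floquetVector Φ e ω)
        rw [h.norm_floquetVector (hSA hω), mul_one] at h1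
        have h2 := Real.log_le_log hpos (h1.trans (hH ω t ht))
        rw [Real.log_exp] at h2
        have := le_abs_self (H ω)
        linarith
    · simp only [hF, if_neg hω, abs_zero, hG]
      positivity
  have hlim := hFcoc.tendsto_div (P := P) hFm hGi hGm hFG
  set I := ∫ ω, F 1 ω ∂P
  obtain ⟨S', hS'A, hS'm, hS'inv, hS'P⟩ := exists_measurableSet_invariant_subset
    (P := P) (A := {ω | ω ∈ S ∧ Tendsto (fun t : ℝ≥0 => F t ω / t) atTop (𝓝 I)})
    (fun t ω hω => ⟨(hSv t ω).2 hω.1, hFcoc.tendsto_div_vadd t hω.2⟩)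
    (by filter_upwards [hSP, hlim] with ω h1 h2 using ⟨h1, h2⟩)
  refine ⟨(I : EReal), EReal.coe_lt_top I, S', w, hS'm, hS'inv, ?_,
    hwm.comp measurable_subtype_coe, fun ω hω => ?_⟩
  · rw [← prob_compl_eq_zero_iff hS'm]
    exact hS'P
  obtain ⟨hωS, hωI⟩ := hS'A hω
  have hrec := hSA hωS
  simp only [hF, if_pos hωS, hwS ω hωS] at hωI
  rw [hwS ω hωS]
  refine ⟨h.floquetVector_mem hrec, ?_, fun t _ => ?_, ?_, fun u _ => ?_⟩
  · rw [← norm_pos_iff, h.norm_floquetVector hrec]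
    exact one_pos
  · rw [hwS _ ((hSv t ω).2 hωS), Submodule.map_span, image_singleton]
    change Submodule.span ℝ {Φ.U ω t (floquetVector Φ e ω)} = _
    rw [h.U_floquetVector hrec t]
    exact Submodule.span_singleton_smul_eq
      (isUnit_iff_ne_zero.2 (h.norm_U_floquetVector_pos hrec t).ne') _
  · refine ((continuous_coe_real_ereal.tendsto I).comp hωI).congr fun t => ?_
    rw [log_enorm_of_ne_zero (norm_pos_iff.1 (h.norm_U_floquetVector_pos hrec t))]
    simp only [Function.comp]
    rw [EReal.coe_div]
  · exact h.limsup_log_norm_le hrec hωI u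

end PrincipalExponent

/-! ### Positivity and focusing for the deterministic equation -/

section Deterministic

variable {p q : ℝ≥0∞}

lemma mem_posCone_iff {u : DelaySpace p} : u ∈ posCone p ↔ 0 ≤ u.fst ∧ 0 ≤ u.snd :=
  and_congr_right fun _ => (Lp.coeFn_nonneg u.snd)

lemma isMonotoneCone_posCone [Fact (1 ≤ p)] : IsMonotoneCone (posCone p) where
  isClosed := by
    have h : posCone p = {u : DelaySpace p | 0 ≤ u.fst} ∩ {u | 0 ≤ u.snd} := by
      ext u
      exact mem_posCone_iff
    rw [h]
    have hc : Continuous (WithLp.ofLp : DelaySpace p → ℝ × Lp ℝ p histMeasure) :=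
      WithLp.prod_continuous_ofLp 1 _ _
    exact (isClosed_Ici.preimage hc.fst).inter (isClosed_nonneg.preimage hc.snd)
  add_mem {u v} hu hv := by
    rw [mem_posCone_iff] at *
    exact ⟨add_nonneg hu.1 hv.1, add_nonneg hu.2 hv.2⟩
  smul_mem {c u} hc hu := by
    refine ⟨mul_nonneg hc hu.1, ?_⟩
    filter_upwards [hu.2, Lp.coeFn_smul c u.snd] with s h1 h2
    rw [WithLp.smul_snd, h2]
    exact mul_nonneg hc h1
  norm_le {u v} hu hv := by
    rw [mem_posCone_iff] at *
    have h1 : u.fst ≤ v.fst := sub_nonneg.1 hv.1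
    have h2 : u.snd ≤ v.snd := sub_nonneg.1 hv.2
    rw [DelaySpace.norm_eq, DelaySpace.norm_eq]
    refine add_le_add (abs_le_abs_of_nonneg hu.1 h1) (norm_le_norm_of_abs_le_abs ?_)
    exact abs_le_abs_of_nonneg hu.2 h2
  exists_dominating u := by
    refine ⟨WithLp.toLp 1 (|u.fst|, |u.snd|), ?_, ?_, ?_⟩ <;> rw [mem_posCone_iff]
    · exact ⟨abs_nonneg _, abs_nonneg _⟩
    · exact ⟨sub_nonneg.2 (le_abs_self _), sub_nonneg.2 (le_abs_self _)⟩
    · have h1 : 0 ≤ |u.fst| + u.fst := neg_le_iff_add_nonneg'.1 (neg_le.1 (neg_le_abs u.fst))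
      have h2 : 0 ≤ |u.snd| + u.snd := neg_le_iff_add_nonneg'.1 (neg_le.1 (neg_le_abs u.snd))
      exact ⟨h1, h2⟩

variable [p.HolderConjugate q] {α β : ℝ → ℝ} {u : DelaySpace p}

lemma delayOp_mem_posCone (h : IsDelayCoeff q α β) (hβ : ∀ t, 0 ≤ β t) {t : ℝ} (ht : 0 ≤ t)
    (hu : u ∈ posCone p) : delayOp α β t u ∈ posCone p := by
  have hm := isMild_delaySol (α := α) (β := β) (u := u)
  have hnn := hm.nonneg hβ hu
  refine ⟨hnn t ht, ?_⟩
  have h1 : ∀ᵐ s, 0 ≤ histExt u s := by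
    have := hu.2
    rw [ae_restrict_iff' measurableSet_Icc] at this
    filter_upwards [this] with s hs
    exact indicator_apply_nonneg hs
  have hq := (measurePreserving_add_left volume t).quasiMeasurePreserving
  filter_upwards [delayOp_snd (u := u) h ht, ae_restrict_of_ae (hq.ae h1),
    ae_restrict_of_ae (hq.ae hm.ae_eq_histExt), ae_restrict_mem measurableSet_Icc]
    with s e1 e2 e3 hs
  rw [e1]
  rcases lt_or_ge (t + s) 0 with hlt | hge
  · rw [e3 ⟨by linarith [hs.1], hlt⟩]
    exact e2
  · exact hnn _ hge

variable {z : ℝ → ℝ}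

lemma IsMild.exp_neg_mul_sub (h : IsDelayCoeff q α β) (hz : IsMild α β u z) {r t : ℝ} (hr : 0 ≤ r)
    (ht : 0 ≤ t) : Real.exp (-prim α t) * z t - Real.exp (-prim α r) * z r
      = ∫ s in r..t, vocIntegrand α β z s := by
  have e : ∀ t, 0 ≤ t → Real.exp (-prim α t) * z t
      = u.fst + ∫ s in (0 : ℝ)..t, vocIntegrand α β z s := fun t ht => by
    rw [hz.2 t ht, ← mul_assoc, ← Real.exp_add]
    simp
  rw [e t ht, e r hr, ← intervalIntegral.integral_add_adjacent_intervals
    (hz.intervalIntegrable h le_rfl hr) (hz.intervalIntegrable h hr ht)]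
  ring

/-- A nonnegative solution grows at least as fast as the solution of the equation without delay. -/
lemma IsMild.exp_mul_le (h : IsDelayCoeff q α β) (hβ : ∀ t, 0 ≤ β t) (hu : u ∈ posCone p)
    (hz : IsMild α β u z) {r t : ℝ} (hr : 0 ≤ r) (hrt : r ≤ t) :
    Real.exp (prim α t - prim α r) * z r ≤ z t := by
  have hhist : ∀ᵐ s, s ∈ Ico (-1 : ℝ) 0 → 0 ≤ z s := by
    have h1 := hu.2
    rw [ae_restrict_iff' measurableSet_Icc] at h1
    have h2 := hz.1
    rw [ae_restrict_iff' measurableSet_Ico] at h2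
    filter_upwards [h1, h2] with s h1 h2 hs
    rw [h2 hs]
    exact h1 (Ico_subset_Icc_self hs)
  have h1 := hz.exp_neg_mul_sub h hr (hr.trans hrt)
  have h2 : 0 ≤ ∫ s in r..t, vocIntegrand α β z s := by
    rw [intervalIntegral.integral_of_le hrt]
    refine setIntegral_nonneg_of_ae_restrict ?_
    rw [EventuallyLE, ae_restrict_iff' measurableSet_Ioc]
    filter_upwards [(measurePreserving_sub_right volume (1 : ℝ)).quasiMeasurePreserving.ae hhist]
      with s hs hs'
    refine mul_nonneg (Real.exp_pos _).le (mul_nonneg (hβ s) ?_)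
    rcases lt_or_ge (s - 1) 0 with h | h
    · exact hs ⟨by linarith [hs'.1], h⟩
    · exact hz.nonneg hβ hu _ h
  rw [← h1, sub_nonneg] at h2
  calc Real.exp (prim α t - prim α r) * z r
      = Real.exp (prim α t) * (Real.exp (-prim α r) * z r) := by
        rw [sub_eq_add_neg, Real.exp_add]; ring
    _ ≤ Real.exp (prim α t) * (Real.exp (-prim α t) * z t) := by gcongr
    _ = z t := by rw [← mul_assoc, ← Real.exp_add]; simp

/-- The weight `∫₁² exp (- ∫_{s-1}^s α) β(s) ds` in the focusing constant. -/
def focusWeight (α β : ℝ → ℝ) : ℝ :=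
  ∫ s in (1 : ℝ)..2, Real.exp (-∫ r in (s - 1)..s, α r) * β s

lemma IsDelayCoeff.integral_eq_prim_sub (h : IsDelayCoeff q α β) (x y : ℝ) :
    ∫ r in x..y, α r = prim α y - prim α x := by
  rw [prim, prim, intervalIntegral.integral_interval_sub_left (h.intervalIntegrable _ _)
    (h.intervalIntegrable _ _)]

omit [p.HolderConjugate q] in
lemma IsDelayCoeff.intervalIntegrable_weight [Fact (1 ≤ q)] (h : IsDelayCoeff q α β) :
    IntervalIntegrable (fun s => Real.exp (-∫ r in (s - 1)..s, α r) * β s) volume 1 2 := by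
  have h1 : IntervalIntegrable β volume 1 2 := by
    rw [intervalIntegrable_iff_integrableOn_Icc_of_le one_le_two]
    exact (h.memLp 1 2).integrable Fact.out
  refine h1.continuousOn_mul (Continuous.continuousOn ?_)
  simp only [h.integral_eq_prim_sub]
  have := h.continuous_prim
  fun_prop

lemma focusWeight_nonneg (hβ : ∀ t, 0 ≤ β t) : 0 ≤ focusWeight α β :=
  intervalIntegral.integral_nonneg one_le_two fun s _ => mul_nonneg (Real.exp_pos _).le (hβ s)

/-- On `[1, 2]` a nonnegative solution is controlled by its value at time `1`, since the delayed
term there involves only values on `[0, 1]`, which are bounded by the value at time `1`. -/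
lemma IsMild.le_exp_mul [Fact (1 ≤ q)] (h : IsDelayCoeff q α β) (hβ : ∀ t, 0 ≤ β t)
    (hu : u ∈ posCone p) (hz : IsMild α β u z) {t : ℝ} (ht : t ∈ Icc (1 : ℝ) 2) :
    z t ≤ Real.exp (prim α t - prim α 1) * z 1 * (1 + focusWeight α β) := by
  have hz1 := hz.nonneg hβ hu 1 zero_le_one
  have hI := hz.exp_neg_mul_sub h zero_le_one (zero_le_one.trans ht.1)
  have hw := (h.intervalIntegrable_weight).const_mul (Real.exp (-prim α 1) * z 1)
  have hsub : uIcc 1 t ⊆ uIcc (1 : ℝ) 2 := by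
    rw [uIcc_of_le ht.1, uIcc_of_le one_le_two]
    exact Icc_subset_Icc_right ht.2
  have h1 : ∫ s in (1 : ℝ)..t, vocIntegrand α β z s ≤
      Real.exp (-prim α 1) * z 1 * focusWeight α β := by
    calc ∫ s in (1 : ℝ)..t, vocIntegrand α β z s
        ≤ ∫ s in (1 : ℝ)..t, (Real.exp (-prim α 1) * z 1) *
            (Real.exp (-∫ r in (s - 1)..s, α r) * β s) := by
          refine intervalIntegral.integral_mono_on ht.1
            (hz.intervalIntegrable h zero_le_one (zero_le_one.trans ht.1))
            (hw.mono_set hsub) fun s hs => ?_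
          -- on `[0, 1]` the solution is bounded by its value at `1`
          have h2 := hz.exp_mul_le h hβ hu (r := s - 1) (t := 1) (by linarith [hs.1])
            (by linarith [hs.2, ht.2])
          have h3 : z (s - 1) ≤ Real.exp (prim α (s - 1) - prim α 1) * z 1 := by
            calc z (s - 1) = Real.exp (prim α (s - 1) - prim α 1) *
                  (Real.exp (prim α 1 - prim α (s - 1)) * z (s - 1)) := by
                  rw [← mul_assoc, ← Real.exp_add]; simp
              _ ≤ _ := by gcongr
          rw [vocIntegrand, h.integral_eq_prim_sub]
          calc Real.exp (-prim α s) * (β s * z (s - 1))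
              ≤ Real.exp (-prim α s) * (β s * (Real.exp (prim α (s - 1) - prim α 1) * z 1)) := by
                have := hβ s
                gcongr
            _ = _ := by
                have e : Real.exp (-prim α s) * Real.exp (prim α (s - 1) - prim α 1)
                    = Real.exp (-prim α 1) * Real.exp (-(prim α s - prim α (s - 1))) := by
                  rw [← Real.exp_add, ← Real.exp_add]; congr 1; ring
                linear_combination (β s * z 1) * e
      _ ≤ ∫ s in (1 : ℝ)..2, (Real.exp (-prim α 1) * z 1) *
            (Real.exp (-∫ r in (s - 1)..s, α r) * β s) := by
          refine intervalIntegral.integral_mono_interval le_rfl ht.1 ht.2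
            (Eventually.of_forall fun s => ?_) hw
          exact mul_nonneg (mul_nonneg (Real.exp_pos _).le hz1)
            (mul_nonneg (Real.exp_pos _).le (hβ s))
      _ = _ := intervalIntegral.integral_const_mul _ _
  have h4 : Real.exp (-prim α t) * z t ≤ Real.exp (-prim α 1) * z 1 * (1 + focusWeight α β) := by
    linarith
  calc z t = Real.exp (prim α t) * (Real.exp (-prim α t) * z t) := by
        rw [← mul_assoc, ← Real.exp_add]; simp
    _ ≤ Real.exp (prim α t) * (Real.exp (-prim α 1) * z 1 * (1 + focusWeight α β)) := by gcongr
    _ = _ := by rw [sub_eq_add_neg, Real.exp_add]; ring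

lemma halfVec_snd (p : ℝ≥0∞) : ∀ᵐ s ∂histMeasure, (halfVec p).snd s = 1 / 2 :=
  Lp.coeFn_const p histMeasure (1 / 2 : ℝ)

lemma halfVec_mem_posCone (p : ℝ≥0∞) : halfVec p ∈ posCone p := by
  refine ⟨by norm_num [halfVec], ?_⟩
  filter_upwards [halfVec_snd p] with s hs
  rw [hs]
  norm_num

lemma norm_halfVec [Fact (1 ≤ p)] : ‖halfVec p‖ = 1 := by
  have hp0 : p ≠ 0 := (zero_lt_one.trans_le (Fact.out : 1 ≤ p)).ne'
  rw [DelaySpace.norm_eq]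
  have h1 : ‖(halfVec p).snd‖ = 1 / 2 := by
    change ‖Lp.const p histMeasure (1 / 2 : ℝ)‖ = 1 / 2
    have hμ : histMeasure.real univ = 1 := by simp [Measure.real]
    have : NeZero histMeasure := ⟨fun h => by simp [h] at hμ⟩
    rw [Lp.norm_const p histMeasure (1 / 2 : ℝ) hp0, hμ]
    norm_num
  rw [h1]
  norm_num [halfVec]

/-- Comparison of a multiple of `(1/2, 1/2)` with the state at time `2`. -/
lemma delayOp_two_sub_smul_halfVec_mem [Fact (1 ≤ p)] (h : IsDelayCoeff q α β) {c : ℝ}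
    (hc : ∀ t ∈ Icc (1 : ℝ) 2, c / 2 ≤ delaySol α β u t) :
    delayOp α β 2 u - c • halfVec p ∈ posCone p := by
  refine ⟨?_, ?_⟩
  · have h1 : c / 2 ≤ (delayOp α β 2 u).fst := hc 2 ⟨one_le_two, le_rfl⟩
    have h2 : (halfVec p).fst = 1 / 2 := rfl
    rw [WithLp.sub_fst, WithLp.smul_fst, smul_eq_mul, h2]
    linarith
  · filter_upwards [delayOp_snd (u := u) h zero_le_two, halfVec_snd p,
      Lp.coeFn_sub (delayOp α β 2 u).snd (c • halfVec p).snd, Lp.coeFn_smul c (halfVec p).snd,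
      ae_restrict_mem measurableSet_Icc] with s e1 e2 e3 e4 hs
    have h1 := hc (2 + s) ⟨by linarith [hs.1], by linarith [hs.2]⟩
    rw [WithLp.sub_snd, e3, Pi.sub_apply, WithLp.smul_snd, e4, Pi.smul_apply, e1, e2, smul_eq_mul]
    linarith

lemma smul_halfVec_sub_delayOp_two_mem [Fact (1 ≤ p)] (h : IsDelayCoeff q α β) {c : ℝ}
    (hc : ∀ t ∈ Icc (1 : ℝ) 2, delaySol α β u t ≤ c / 2) :
    c • halfVec p - delayOp α β 2 u ∈ posCone p := by
  refine ⟨?_, ?_⟩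
  · have h1 : (delayOp α β 2 u).fst ≤ c / 2 := hc 2 ⟨one_le_two, le_rfl⟩
    have h2 : (halfVec p).fst = 1 / 2 := rfl
    rw [WithLp.sub_fst, WithLp.smul_fst, smul_eq_mul, h2]
    linarith
  · filter_upwards [delayOp_snd (u := u) h zero_le_two, halfVec_snd p,
      Lp.coeFn_sub (c • halfVec p).snd (delayOp α β 2 u).snd, Lp.coeFn_smul c (halfVec p).snd,
      ae_restrict_mem measurableSet_Icc] with s e1 e2 e3 e4 hs
    have h1 := hc (2 + s) ⟨by linarith [hs.1], by linarith [hs.2]⟩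
    rw [WithLp.sub_snd, e3, Pi.sub_apply, WithLp.smul_snd, e4, Pi.smul_apply, e1, e2, smul_eq_mul]
    linarith

/-- A positive solution vanishing at time `1` vanishes identically on `[1, 2]`. -/
lemma delayOp_two_eq_zero [Fact (1 ≤ p)] [Fact (1 ≤ q)] (h : IsDelayCoeff q α β)
    (hβ : ∀ t, 0 ≤ β t) (hu : u ∈ posCone p) (h1 : delaySol α β u 1 = 0) :
    delayOp α β 2 u = 0 := by
  have hm := isMild_delaySol (α := α) (β := β) (u := u)
  have h2 := smul_halfVec_sub_delayOp_two_mem (u := u) h (c := 0) fun t ht => by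
    have := hm.le_exp_mul h hβ hu ht
    rw [h1] at this
    simpa using this
  rw [zero_smul, zero_sub] at h2
  exact isMonotoneCone_posCone.eq_zero (delayOp_mem_posCone h hβ zero_le_two hu) h2

/-- The focusing property of the solution operator at time `2`. -/
theorem delayOp_two_focusing [Fact (1 ≤ p)] [Fact (1 ≤ q)] (h : IsDelayCoeff q α β)
    (hβ : ∀ t, 0 ≤ β t) (hu : u ∈ posCone p) :
    delayOp α β 2 u = 0 ∨ (delayOp α β 2 u ≠ 0 ∧ ∃ c : ℝ, 0 < c ∧
      delayOp α β 2 u - c • halfVec p ∈ posCone p ∧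
      ((Real.exp (∫ r in (1 : ℝ)..2, |α r|) * (1 + focusWeight α β)) * c) • halfVec p
        - delayOp α β 2 u ∈ posCone p) := by
  have hm := isMild_delaySol (α := α) (β := β) (u := u)
  rcases (hm.nonneg hβ hu 1 zero_le_one).eq_or_lt with hz | hz
  · exact Or.inl (delayOp_two_eq_zero h hβ hu hz.symm)
  refine Or.inr ⟨fun h0 => ?_, ?_⟩
  · have h1 : (delayOp α β 2 u).fst = delaySol α β u 2 := rfl
    have h2 := hm.exp_mul_le h hβ hu zero_le_one one_le_two
    rw [← h1, h0] at h2
    have := mul_pos (Real.exp_pos (prim α 2 - prim α 1)) hz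
    rw [WithLp.zero_fst] at h2
    linarith
  -- the multiple of `e` is the minimum over `[1, 2]` of the lower bound `exp (∫₁ᵗ α) z(1)`
  obtain ⟨t₀, ht₀, hmin⟩ := isCompact_Icc.exists_isMinOn (nonempty_Icc.2 (one_le_two (α := ℝ)))
    h.continuous_prim.continuousOn
  have hosc : ∀ t ∈ Icc (1 : ℝ) 2, prim α t - prim α t₀ ≤ ∫ r in (1 : ℝ)..2, |α r| := by
    intro t ht
    rw [← h.integral_eq_prim_sub]
    refine (le_abs_self _).trans ?_
    have h0 : |∫ r in t₀..t, α r| ≤ |∫ r in t₀..t, (|α r|)| := by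
      simpa [Real.norm_eq_abs] using intervalIntegral.norm_integral_le_abs_integral_norm
        (f := α) (μ := volume) (a := t₀) (b := t)
    refine h0.trans ?_
    refine le_trans (intervalIntegral.abs_integral_mono_interval (c := 1) (d := 2) ?_
      (Eventually.of_forall fun _ => abs_nonneg _) (h.intervalIntegrable 1 2).abs) ?_
    · rw [uIoc_of_le one_le_two, uIoc]
      exact Ioc_subset_Ioc (le_min ht₀.1 ht.1) (max_le ht₀.2 ht.2)
    · rw [abs_of_nonneg (intervalIntegral.integral_nonneg one_le_two fun _ _ => abs_nonneg _)]
  have hw := focusWeight_nonneg (α := α) hβ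
  refine ⟨2 * (Real.exp (prim α t₀ - prim α 1) * delaySol α β u 1), by positivity,
    delayOp_two_sub_smul_halfVec_mem h fun t ht => ?_,
    smul_halfVec_sub_delayOp_two_mem h fun t ht => ?_⟩
  · rw [mul_div_cancel_left₀ _ two_ne_zero]
    refine le_trans ?_ (hm.exp_mul_le h hβ hu zero_le_one ht.1)
    have : prim α t₀ ≤ prim α t := hmin ht
    gcongr
  · refine (hm.le_exp_mul h hβ hu ht).trans ?_
    have e : Real.exp (prim α t - prim α 1)
        ≤ Real.exp (∫ r in (1 : ℝ)..2, |α r|) * Real.exp (prim α t₀ - prim α 1) := by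
      rw [← Real.exp_add]
      exact Real.exp_le_exp.2 (by linarith [hosc t ht])
    calc Real.exp (prim α t - prim α 1) * delaySol α β u 1 * (1 + focusWeight α β)
        ≤ (Real.exp (∫ r in (1 : ℝ)..2, |α r|) * Real.exp (prim α t₀ - prim α 1)) *
          delaySol α β u 1 * (1 + focusWeight α β) := by gcongr
      _ = _ := by ring

/-- The lower bound for the orbit of `(1/2, 1/2)`. -/
lemma le_norm_delayOp_halfVec [Fact (1 ≤ p)] (h : IsDelayCoeff q α β) (hβ : ∀ t, 0 ≤ β t) {t : ℝ}
    (ht : 0 ≤ t) : Real.exp (prim α t) / 2 ≤ ‖delayOp α β t (halfVec p)‖ := by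
  have hm := isMild_delaySol (α := α) (β := β) (u := halfVec p)
  have h1 := hm.exp_mul_le h hβ (halfVec_mem_posCone p) le_rfl ht
  have h2 : delaySol α β (halfVec p) 0 = 1 / 2 := by
    rw [hm.2 0 le_rfl]
    simp [prim, halfVec]
  have h3 : (delayOp α β t (halfVec p)).fst = delaySol α β (halfVec p) t := rfl
  rw [h2, ← h3] at h1
  have h4 : prim α 0 = 0 := by simp [prim]
  rw [h4, sub_zero] at h1
  rw [DelaySpace.norm_eq]
  have := le_abs_self (delayOp α β t (halfVec p)).fst
  have := norm_nonneg (delayOp α β t (halfVec p)).snd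
  linarith

end Deterministic

/-! ### Integrability of suprema of operator norms -/

lemma lnPlus_le_iff {x M : ℝ≥0∞} : lnPlus x ≤ M ↔ x ≤ EReal.exp (M : EReal) := by
  have h1 : lnPlus x ≤ M ↔ ENNReal.log x ≤ (M : EReal) := by
    constructor
    · intro h
      have h2 : ((ENNReal.log x).toENNReal : EReal) ≤ M := by exact_mod_cast h
      rw [EReal.coe_toENNReal_eq_max] at h2
      exact (le_max_right _ _).trans h2
    · intro h
      exact (EReal.toENNReal_le_toENNReal h).trans_eq EReal.toENNReal_coe
  rw [h1, ← EReal.exp_le_exp_iff, ENNReal.exp_log]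

lemma lnPlus_mono : Monotone lnPlus := fun _ _ h =>
  EReal.toENNReal_le_toENNReal (ENNReal.log_monotone h)

lemma lnPlus_ofReal {x : ℝ} (hx : 0 < x) :
    lnPlus (ENNReal.ofReal x) = ENNReal.ofReal (Real.log x) := by
  rw [lnPlus, ENNReal.log_ofReal_of_pos hx]
  rfl

lemma measurable_lnPlus : Measurable lnPlus :=
  (EReal.continuous_toENNReal.comp ENNReal.continuous_log).measurable

section Suprema

variable {Ω X : Type*} [MeasurableSpace Ω] [NormedAddCommGroup X] [NormedSpace ℝ X]
  [MeasurableSpace X] [BorelSpace X] [SecondCountableTopology X]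

lemma measurable_opENorm {V : Ω → X →L[ℝ] X} (hV : ∀ u, Measurable fun ω => V ω u) :
    Measurable fun ω => ‖V ω‖ₑ := by
  refine measurable_of_Iic fun c => ?_
  have hd := TopologicalSpace.denseRange_denseSeq X
  set d := TopologicalSpace.denseSeq X
  have h1 : (fun ω => ‖V ω‖ₑ) ⁻¹' Iic c = ⋂ n, {ω | ‖V ω (d n)‖ₑ ≤ c * ‖d n‖ₑ} := by
    ext ω
    simp only [mem_preimage, mem_Iic, mem_iInter, mem_ofPred_eq]
    refine ⟨fun h n => ((V ω).le_opENorm _).trans (by gcongr), fun h => ?_⟩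
    rcases eq_or_ne c ∞ with rfl | hc
    · exact le_top
    refine (V ω).opENorm_le_bound fun x => ?_
    have hcl : IsClosed {x : X | ‖V ω x‖ₑ ≤ c * ‖x‖ₑ} :=
      isClosed_le (V ω).continuous.enorm
        ((ENNReal.continuous_const_mul hc).comp continuous_enorm)
    exact hd.induction_on (p := fun x => ‖V ω x‖ₑ ≤ c * ‖x‖ₑ) x hcl h
  rw [h1]
  exact MeasurableSet.iInter fun n => measurableSet_le (hV (d n)).enorm measurable_const

/-- Strong right continuity reduces the supremum of the norms to a countable set of times. -/
lemma measurable_iSup_lnPlus_opENorm {V : Ω → ℝ≥0 → X →L[ℝ] X} {T : ℝ≥0}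
    (hV : ∀ s u, Measurable fun ω => V ω s u)
    (hc : ∀ ω, ∀ s < T, ∀ u, Tendsto (fun r => V ω r u) (𝓝[≥] s) (𝓝 (V ω s u))) :
    Measurable fun ω => ⨆ s ∈ Iic T, lnPlus ‖V ω s‖ₑ := by
  obtain ⟨D, hDc, hDd⟩ := TopologicalSpace.exists_countable_dense ℝ≥0
  have h1 : ∀ ω, ⨆ s ∈ Iic T, lnPlus ‖V ω s‖ₑ = ⨆ s ∈ insert T (D ∩ Iic T), lnPlus ‖V ω s‖ₑ := by
    intro ω
    refine le_antisymm (iSup₂_le fun s hs => ?_) (biSup_mono fun s hs => ?_)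
    · rcases (mem_Iic.1 hs).eq_or_lt with rfl | hsT
      · exact le_biSup (fun s => lnPlus ‖V ω s‖ₑ) (mem_insert _ _)
      rw [lnPlus_le_iff]
      refine (V ω s).opENorm_le_bound fun u => ?_
      refine le_of_tendsto_of_frequently (hc ω s hsT u).enorm ?_
      rw [frequently_nhdsWithin_iff]
      have hcl : s ∈ closure (Ioo s T ∩ D) :=
        closure_minimal (hDd.open_subset_closure_inter isOpen_Ioo) isClosed_closure
          (by rw [closure_Ioo hsT.ne]; exact left_mem_Icc.2 hsT.le)
      refine (mem_closure_iff_frequently.1 hcl).mono fun r hr => ⟨?_, hr.1.1.le⟩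
      refine ((V ω r).le_opENorm u).trans ?_
      gcongr
      rw [← lnPlus_le_iff]
      exact le_biSup (fun s => lnPlus ‖V ω s‖ₑ) (mem_insert_of_mem _ ⟨hr.2, hr.1.2.le⟩)
    · rcases hs with rfl | hs
      · exact mem_Iic.2 le_rfl
      · exact hs.2
  simp only [h1]
  exact Measurable.biSup _ ((hDc.mono inter_subset_left).insert T) fun s _ =>
    measurable_lnPlus.comp (measurable_opENorm (hV s))

variable [AddAction ℝ Ω] [MeasurableVAdd₂ ℝ Ω]

/-- A strongly continuous semiflow satisfies the integrability condition as soon as the logarithms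
of its norms over subintervals of `[0, T]` have a common integrable bound. -/
theorem integrabilityA1_of_norm_le {P : Measure Ω} {Φ : SkewProductSemiflow Ω X} {T : ℝ≥0}
    (hc : ∀ ω u, Tendsto (fun t => Φ.U ω t u) (𝓝 0) (𝓝 u)) {H : Ω → ℝ} (hHi : Integrable H P)
    (hH : ∀ ω, ∀ s t : ℝ≥0, s + t ≤ T → ‖Φ.U ((s : ℝ) +ᵥ ω) t‖ ≤ Real.exp (H ω)) :
    IntegrabilityA1 P Φ T := by
  have hbound : ∀ V : Ω → ℝ≥0 → X →L[ℝ] X, (∀ s u, Measurable fun ω => V ω s u) →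
      (∀ ω, ∀ s < T, ∀ u, Tendsto (fun r => V ω r u) (𝓝[≥] s) (𝓝 (V ω s u))) →
      (∀ ω, ∀ s ≤ T, ‖V ω s‖ ≤ Real.exp (H ω)) →
      FiniteL1 P (fun ω => ⨆ s ∈ Iic T, lnPlus ‖V ω s‖ₑ) := by
    intro V hV hVc hVH
    have hle : ∀ ω, ⨆ s ∈ Iic T, lnPlus ‖V ω s‖ₑ ≤ ENNReal.ofReal (H ω) := fun ω =>
      iSup₂_le fun s hs => by
        rw [← Real.log_exp (H ω), ← lnPlus_ofReal (Real.exp_pos _), ← ofReal_norm]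
        exact lnPlus_mono (ENNReal.ofReal_le_ofReal (hVH ω s hs))
    exact ⟨fun ω => (hle ω).trans_lt ENNReal.ofReal_lt_top,
      (measurable_iSup_lnPlus_opENorm hV hVc).aemeasurable,
      (lintegral_mono hle).trans_lt hHi.lintegral_lt_top⟩
  have hsub : ∀ s : ℝ≥0, Tendsto (fun r => r - s) (𝓝[≥] s) (𝓝 0) := fun s => by
    have : Continuous fun r : ℝ≥0 => r - s := by fun_prop
    simpa using (this.tendsto s).mono_left nhdsWithin_le_nhds
  refine ⟨hbound _ (fun s u => Φ.measurable_U.comp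
      (measurable_const.prodMk (measurable_id.prodMk measurable_const)))
      (fun ω s _ u => ?_) (fun ω s hs => by simpa using hH ω 0 s (by simpa using hs)),
    hbound (fun ω s => Φ.U ((s : ℝ) +ᵥ ω) (T - s)) (fun s u => Φ.measurable_U.comp
      (measurable_const.prodMk ((measurable_const_vadd (s : ℝ)).prodMk measurable_const)))
      (fun ω s hs u => ?_) (fun ω s hs => hH ω s (T - s) (add_tsub_cancel_of_le hs).le)⟩
  · refine ((hc ((s : ℝ) +ᵥ ω) (Φ.U ω s u)).comp (hsub s)).congr' ?_
    filter_upwards [self_mem_nhdsWithin] with r hr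
    rw [Function.comp, ← Φ.U_add_apply, tsub_add_cancel_of_le hr]
  · -- `U_{s + ω}(T - s) = U_{r + ω}(T - r) ∘ U_{s + ω}(r - s)` for `s ≤ r ≤ T`
    rw [tendsto_iff_norm_sub_tendsto_zero]
    have h1 := (tendsto_iff_norm_sub_tendsto_zero.1
      ((hc ((s : ℝ) +ᵥ ω) u).comp (hsub s))).const_mul (Real.exp (H ω))
    rw [mul_zero] at h1
    refine squeeze_zero' (Eventually.of_forall fun _ => norm_nonneg _) ?_ h1
    filter_upwards [self_mem_nhdsWithin, mem_nhdsWithin_of_mem_nhds (Iic_mem_nhds hs)]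
      with r hr hrT
    have h2 : Φ.U ((s : ℝ) +ᵥ ω) (T - s) u
        = Φ.U ((r : ℝ) +ᵥ ω) (T - r) (Φ.U ((s : ℝ) +ᵥ ω) (r - s) u) := by
      have h3 : (((r - s : ℝ≥0) : ℝ) +ᵥ ((s : ℝ) +ᵥ ω)) = (r : ℝ) +ᵥ ω := by
        rw [vadd_vadd, NNReal.coe_sub hr, sub_add_cancel]
      rw [← h3, ← Φ.U_add_apply, tsub_add_tsub_cancel hrT hr]
    rw [h2, ← map_sub, Function.comp, norm_sub_rev _ u]
    refine ((Φ.U ((r : ℝ) +ᵥ ω) (T - r)).le_opNorm _).trans ?_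
    gcongr
    exact hH ω r (T - r) (add_tsub_cancel_of_le hrT).le

end Suprema

/-! ### Integrability along orbits -/

section Orbits

variable {Ω : Type*} [MeasurableSpace Ω] [AddAction ℝ Ω] [MeasurableVAdd₂ ℝ Ω]

section Measure

variable (P : Measure Ω) [SFinite P] [VAddInvariantMeasure ℝ Ω P]

lemma integrable_orbit_prod {a : Ω → ℝ} (ha : Measurable a) (hi : Integrable a P) (x y : ℝ) :
    Integrable (Function.uncurry fun (ω : Ω) (r : ℝ) => a (r +ᵥ ω))
      (P.prod (volume.restrict (Ioc x y))) := by
  have hm : Measurable (Function.uncurry fun (ω : Ω) (r : ℝ) => a (r +ᵥ ω)) :=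
    (measurable_orbit ha).comp measurable_swap
  rw [integrable_prod_iff' hm.aestronglyMeasurable]
  have h1 : ∀ r : ℝ, Integrable (fun ω => a (r +ᵥ ω)) P := fun r =>
    (measurePreserving_vadd r P).integrable_comp_of_integrable hi
  have h2 : ∀ r : ℝ, ∫ ω, ‖a (r +ᵥ ω)‖ ∂P = ∫ ω, ‖a ω‖ ∂P := fun r =>
    (measurePreserving_vadd r P).integral_comp (measurableEmbedding_const_vadd r) fun ω => ‖a ω‖
  refine ⟨Eventually.of_forall h1, ?_⟩
  simp only [Function.uncurry_apply_pair, h2]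
  exact integrable_const _

lemma integrable_orbit_integral {a : Ω → ℝ} (ha : Measurable a) (hi : Integrable a P) {x y : ℝ}
    (hxy : x ≤ y) : Integrable (fun ω => ∫ r in x..y, a (r +ᵥ ω)) P := by
  simp only [intervalIntegral.integral_of_le hxy]
  exact (integrable_orbit_prod P ha hi x y).integral_prod_left

lemma integral_orbit_integral {a : Ω → ℝ} (ha : Measurable a) (hi : Integrable a P) :
    ∫ ω, (∫ r in (0 : ℝ)..1, a (r +ᵥ ω)) ∂P = ∫ ω, a ω ∂P := by
  have h2 : ∀ r : ℝ, ∫ ω, a (r +ᵥ ω) ∂P = ∫ ω, a ω ∂P := fun r =>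
    (measurePreserving_vadd r P).integral_comp (measurableEmbedding_const_vadd r) a
  simp only [intervalIntegral.integral_of_le zero_le_one]
  rw [integral_integral_swap (integrable_orbit_prod P ha hi 0 1)]
  simp [h2]

end Measure

/-- The energy `∫₀¹ |b(θ_r ω)|^q dr`, as a real number. -/
def orbitEnergy (q : ℝ≥0∞) (b : Ω → ℝ) (ω : Ω) : ℝ :=
  (∫⁻ r in Icc (0 : ℝ) 1, ‖b (r +ᵥ ω)‖ₑ ^ q.toReal).toReal

omit [MeasurableSpace Ω] [MeasurableVAdd₂ ℝ Ω] in
lemma orbitEnergy_nonneg (q : ℝ≥0∞) (b : Ω → ℝ) (ω : Ω) : 0 ≤ orbitEnergy q b ω :=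
  ENNReal.toReal_nonneg

lemma measurable_orbitEnergy (q : ℝ≥0∞) {b : Ω → ℝ} (hb : Measurable b) :
    Measurable (orbitEnergy q b) :=
  (measurable_orbit_setLIntegral hb q.toReal _).ennreal_toReal

variable {p q : ℝ≥0∞} {a b : Ω → ℝ}

omit [MeasurableSpace Ω] [MeasurableVAdd₂ ℝ Ω] in
lemma IsDelayCoeff.ofReal_orbitEnergy (hq0 : q ≠ 0) (hq' : q ≠ ∞) {ω : Ω}
    (h : IsDelayCoeff q (fun t : ℝ => a (t +ᵥ ω)) (fun t : ℝ => b (t +ᵥ ω))) :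
    ENNReal.ofReal (orbitEnergy q b ω) = ∫⁻ r in Icc (0 : ℝ) 1, ‖b (r +ᵥ ω)‖ₑ ^ q.toReal :=
  ENNReal.ofReal_toReal
    ((eLpNorm_lt_top_iff_lintegral_rpow_enorm_lt_top hq0 hq').1 (h.memLp 0 1).2).ne

/-- `log (1 + x) ≤ log 2 + ln⁺ x` turns the integrability of `ln⁺` of the energy into that of a
logarithm without singularity. -/
lemma integrable_log_one_add_orbitEnergy {P : Measure Ω} [IsFiniteMeasure P] (hq0 : q ≠ 0)
    (hq' : q ≠ ∞) (hb : Measurable b)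
    (h : ∀ ω, IsDelayCoeff q (fun t : ℝ => a (t +ᵥ ω)) (fun t : ℝ => b (t +ᵥ ω)))
    (hi : ∫⁻ ω, lnPlus (∫⁻ r in Icc (0 : ℝ) 1, ‖b (r +ᵥ ω)‖ₑ ^ q.toReal) ∂P < ∞) :
    Integrable (fun ω => Real.log (1 + orbitEnergy q b ω)) P := by
  have hm : Measurable fun ω => Real.log (1 + orbitEnergy q b ω) :=
    Real.measurable_log.comp ((measurable_orbitEnergy q hb).const_add 1)
  have h0 : ∀ ω, 0 ≤ Real.log (1 + orbitEnergy q b ω) := fun ω =>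
    Real.log_nonneg (by linarith [orbitEnergy_nonneg q b ω])
  rw [← lintegral_ofReal_ne_top_iff_integrable hm.aestronglyMeasurable (Eventually.of_forall h0)]
  refine ne_top_of_le_ne_top ?_ (lintegral_mono (g := fun ω => ENNReal.ofReal (Real.log 2) +
    lnPlus (∫⁻ r in Icc (0 : ℝ) 1, ‖b (r +ᵥ ω)‖ₑ ^ q.toReal)) fun ω => ?_)
  · rw [lintegral_add_left measurable_const, lintegral_const]
    exact ENNReal.add_ne_top.2 ⟨ENNReal.mul_ne_top ENNReal.ofReal_ne_top (measure_ne_top _ _),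
      hi.ne⟩
  · have hE := orbitEnergy_nonneg q b ω
    beta_reduce
    rw [← (h ω).ofReal_orbitEnergy hq0 hq']
    rcases le_or_gt (orbitEnergy q b ω) 1 with h1 | h1
    · refine le_add_right (ENNReal.ofReal_le_ofReal (Real.log_le_log (by linarith) (by linarith)))
    · rw [lnPlus_ofReal (by linarith), ← ENNReal.ofReal_add (Real.log_nonneg one_le_two)
        (Real.log_nonneg h1.le), ← Real.log_mul two_ne_zero (by linarith)]
      exact ENNReal.ofReal_le_ofReal (Real.log_le_log (by linarith) (by linarith))

/-- The exponent in the bound for the norms of the solution operators over subintervals of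
`[0, 2]` of length at most `1`. -/
def growthExponent (q : ℝ≥0∞) (a b : Ω → ℝ) (ω : Ω) : ℝ :=
  Real.log 6 + 2 * (∫ r in (0 : ℝ)..2, |a (r +ᵥ ω)|) + Real.log (1 + orbitEnergy q b ω)
    + Real.log (1 + orbitEnergy q b ((1 : ℝ) +ᵥ ω))

omit [MeasurableSpace Ω] [MeasurableVAdd₂ ℝ Ω] in
lemma exp_growthExponent (q : ℝ≥0∞) (a b : Ω → ℝ) (ω : Ω) :
    Real.exp (growthExponent q a b ω) = 6 * Real.exp (2 * ∫ r in (0 : ℝ)..2, |a (r +ᵥ ω)|)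
      * (1 + orbitEnergy q b ω) * (1 + orbitEnergy q b ((1 : ℝ) +ᵥ ω)) := by
  have h1 := orbitEnergy_nonneg q b ω
  have h2 := orbitEnergy_nonneg q b ((1 : ℝ) +ᵥ ω)
  rw [growthExponent, Real.exp_add, Real.exp_add, Real.exp_add, Real.exp_log (by norm_num),
    Real.exp_log (by linarith), Real.exp_log (by linarith)]

omit [MeasurableSpace Ω] [MeasurableVAdd₂ ℝ Ω] in
lemma growthExponent_nonneg (q : ℝ≥0∞) (a b : Ω → ℝ) (ω : Ω) : 0 ≤ growthExponent q a b ω := by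
  have h1 := Real.log_nonneg (show 1 ≤ 1 + orbitEnergy q b ω by
    linarith [orbitEnergy_nonneg q b ω])
  have h2 := Real.log_nonneg (show 1 ≤ 1 + orbitEnergy q b ((1 : ℝ) +ᵥ ω) by
    linarith [orbitEnergy_nonneg q b ((1 : ℝ) +ᵥ ω)])
  have h3 : 0 ≤ Real.log 6 := Real.log_nonneg (by norm_num)
  have h4 : 0 ≤ ∫ r in (0 : ℝ)..2, |a (r +ᵥ ω)| :=
    intervalIntegral.integral_nonneg zero_le_two fun _ _ => abs_nonneg _
  rw [growthExponent]
  linarith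

lemma measurable_growthExponent (q : ℝ≥0∞) (ha : Measurable a) (hb : Measurable b) :
    Measurable (growthExponent q a b) := by
  have h1 : Measurable fun ω => Real.log (1 + orbitEnergy q b ω) :=
    Real.measurable_log.comp ((measurable_orbitEnergy q hb).const_add 1)
  exact ((((measurable_orbit_intervalIntegral ha.norm 0 2).const_mul 2).const_add _).add h1).add
    (h1.comp (measurable_const_vadd (1 : ℝ)))

lemma integrable_growthExponent {P : Measure Ω} [IsFiniteMeasure P] [VAddInvariantMeasure ℝ Ω P]
    (hq0 : q ≠ 0) (hq' : q ≠ ∞) (ha : Measurable a) (hai : Integrable a P) (hb : Measurable b)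
    (h : ∀ ω, IsDelayCoeff q (fun t : ℝ => a (t +ᵥ ω)) (fun t : ℝ => b (t +ᵥ ω)))
    (hi : ∫⁻ ω, lnPlus (∫⁻ r in Icc (0 : ℝ) 1, ‖b (r +ᵥ ω)‖ₑ ^ q.toReal) ∂P < ∞) :
    Integrable (growthExponent q a b) P := by
  have h1 := integrable_log_one_add_orbitEnergy hq0 hq' hb h hi
  have h2 := (measurePreserving_vadd (1 : ℝ) P).integrable_comp_of_integrable h1
  have h3 := integrable_orbit_integral P ha.norm hai.norm (zero_le_two (α := ℝ))
  exact (((integrable_const _).add (h3.const_mul 2)).add h1).add h2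

/-! ### Bounds for the solution operators over a random orbit -/

lemma lintegral_orbit_le (hq0 : q ≠ 0) (hq' : q ≠ ∞) (hb : Measurable b)
    (h : ∀ ω, IsDelayCoeff q (fun t : ℝ => a (t +ᵥ ω)) (fun t : ℝ => b (t +ᵥ ω))) (ω : Ω) :
    ∫⁻ r in Icc (0 : ℝ) 2, ‖b (r +ᵥ ω)‖ₑ ^ q.toReal
      ≤ ENNReal.ofReal (orbitEnergy q b ω + orbitEnergy q b ((1 : ℝ) +ᵥ ω)) := by
  rw [ENNReal.ofReal_add (orbitEnergy_nonneg _ _ _) (orbitEnergy_nonneg _ _ _),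
    (h ω).ofReal_orbitEnergy hq0 hq', (h _).ofReal_orbitEnergy hq0 hq',
    setLIntegral_orbit_vadd hb, zero_add, one_add_one_eq_two]
  refine (lintegral_mono_set ?_).trans (lintegral_union_le _ _ _)
  rw [Icc_union_Icc_eq_Icc zero_le_one one_le_two]

lemma eLpNorm_orbit_le (hq0 : q ≠ 0) (hq' : q ≠ ∞) (hq1 : 1 ≤ q) (hb : Measurable b)
    (h : ∀ ω, IsDelayCoeff q (fun t : ℝ => a (t +ᵥ ω)) (fun t : ℝ => b (t +ᵥ ω))) (ω : Ω)
    {s t : ℝ} (hs : 0 ≤ s) (hst : s + t ≤ 2) :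
    eLpNorm (fun r : ℝ => b (r +ᵥ (s +ᵥ ω))) q (volume.restrict (Icc 0 t))
      ≤ ENNReal.ofReal (1 + (orbitEnergy q b ω + orbitEnergy q b ((1 : ℝ) +ᵥ ω))) := by
  have h1 : ∫⁻ r in Icc (0 : ℝ) t, ‖b (r +ᵥ (s +ᵥ ω))‖ₑ ^ q.toReal
      ≤ ENNReal.ofReal (orbitEnergy q b ω + orbitEnergy q b ((1 : ℝ) +ᵥ ω)) := by
    rw [setLIntegral_orbit_vadd hb]
    exact (lintegral_mono_set (Icc_subset_Icc (by linarith) (by linarith))).trans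
      (lintegral_orbit_le hq0 hq' hb h ω)
  have hqr : 1 ≤ q.toReal := by
    rwa [← ENNReal.toReal_one, ENNReal.toReal_le_toReal ENNReal.one_ne_top hq']
  rw [eLpNorm_eq_lintegral_rpow_enorm_toReal hq0 hq', ENNReal.ofReal_add zero_le_one
    (add_nonneg (orbitEnergy_nonneg _ _ _) (orbitEnergy_nonneg _ _ _)), ENNReal.ofReal_one]
  refine (ENNReal.rpow_le_rpow h1 (by positivity)).trans ?_
  rcases le_total (ENNReal.ofReal (orbitEnergy q b ω + orbitEnergy q b ((1 : ℝ) +ᵥ ω))) 1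
    with h2 | h2
  · exact (ENNReal.rpow_le_one h2 (by positivity)).trans le_self_add
  · refine (ENNReal.rpow_le_rpow_of_exponent_le h2 ?_).trans ((ENNReal.rpow_one _).trans_le
      le_add_self)
    rw [div_le_one (by linarith)]
    exact hqr

omit [MeasurableSpace Ω] [MeasurableVAdd₂ ℝ Ω] in
lemma integral_orbit_vadd (a : Ω → ℝ) (x y s : ℝ) (ω : Ω) :
    ∫ r in x..y, a (r +ᵥ (s +ᵥ ω)) = ∫ r in (x + s)..(y + s), a (r +ᵥ ω) := by
  rw [orbit_vadd]
  exact intervalIntegral.integral_comp_add_right (fun r => a (r +ᵥ ω)) s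

variable [Fact (1 ≤ p)] [p.HolderConjugate q]

/-- The operators over subintervals `[s, s + t]` of `[0, 2]` of length at most `1`. -/
lemma norm_delayOp_orbit_le (hq0 : q ≠ 0) (hq' : q ≠ ∞) (hq1 : 1 ≤ q) (hb : Measurable b)
    (h : ∀ ω, IsDelayCoeff q (fun t : ℝ => a (t +ᵥ ω)) (fun t : ℝ => b (t +ᵥ ω))) (ω : Ω)
    {s t : ℝ} (hs : 0 ≤ s) (ht : 0 ≤ t) (ht1 : t ≤ 1) (hst : s + t ≤ 2) (u : DelaySpace p) :
    ‖delayOp (fun r : ℝ => a (r +ᵥ (s +ᵥ ω))) (fun r : ℝ => b (r +ᵥ (s +ᵥ ω))) t u‖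
      ≤ Real.exp (growthExponent q a b ω) * ‖u‖ := by
  have hE1 := orbitEnergy_nonneg q b ω
  have hE2 := orbitEnergy_nonneg q b ((1 : ℝ) +ᵥ ω)
  have hK0 : 0 ≤ ∫ r in (0 : ℝ)..2, |a (r +ᵥ ω)| :=
    intervalIntegral.integral_nonneg zero_le_two fun _ _ => abs_nonneg _
  have hK : ∫ r in (0 : ℝ)..t, |a (r +ᵥ (s +ᵥ ω))| ≤ ∫ r in (0 : ℝ)..2, |a (r +ᵥ ω)| := by
    rw [integral_orbit_vadd (fun ω => |a ω|)]
    exact intervalIntegral.integral_mono_interval (by linarith) (by linarith) (by linarith)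
      (Eventually.of_forall fun _ => abs_nonneg _) ((h ω).intervalIntegrable 0 2).abs
  refine (norm_delayOp_le (h (s +ᵥ ω)) ht ht1 hK (by linarith)
    (eLpNorm_orbit_le hq0 hq' hq1 hb h ω hs hst) u).trans ?_
  gcongr
  rw [exp_growthExponent]
  set k := Real.exp (2 * ∫ r in (0 : ℝ)..2, |a (r +ᵥ ω)|)
  have hk : 1 ≤ k := Real.one_le_exp (by linarith)
  have h1 : 0 ≤ orbitEnergy q b ω * orbitEnergy q b ((1 : ℝ) +ᵥ ω) := mul_nonneg hE1 hE2
  nlinarith [mul_nonneg (zero_le_one.trans hk) hE1, mul_nonneg (zero_le_one.trans hk) hE2,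
    mul_nonneg (zero_le_one.trans hk) h1]

/-- The operators over arbitrary subintervals of `[0, 2]`: two steps of length at most `1`. -/
lemma norm_delayCLM_orbit_le (hq0 : q ≠ 0) (hq' : q ≠ ∞) (hq1 : 1 ≤ q) (hb : Measurable b)
    (h : ∀ ω, IsDelayCoeff q (fun t : ℝ => a (t +ᵥ ω)) (fun t : ℝ => b (t +ᵥ ω))) (ω : Ω)
    {s t : ℝ≥0} (hst : s + t ≤ 2) :
    ‖delayCLM (p := p) (h ((s : ℝ) +ᵥ ω)) t‖ ≤ Real.exp (2 * growthExponent q a b ω) := by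
  refine ContinuousLinearMap.opNorm_le_bound _ (Real.exp_pos _).le fun u => ?_
  have hst' : (s : ℝ) + t ≤ 2 := by exact_mod_cast hst
  have hs := s.coe_nonneg
  have ht := t.coe_nonneg
  have hg := growthExponent_nonneg q a b ω
  change ‖delayOp (fun r : ℝ => a (r +ᵥ ((s : ℝ) +ᵥ ω)))
    (fun r : ℝ => b (r +ᵥ ((s : ℝ) +ᵥ ω))) t u‖ ≤ _
  rcases le_total (t : ℝ) 1 with ht1 | ht1
  · refine (norm_delayOp_orbit_le hq0 hq' hq1 hb h ω hs ht ht1 hst' u).trans ?_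
    gcongr
    linarith
  · have h1 := delayOp_comp (h ((s : ℝ) +ᵥ ω)) zero_le_one (sub_nonneg.2 ht1) u
    rw [sub_add_cancel] at h1
    have h2 : ∀ c : Ω → ℝ, (fun r : ℝ => c ((r + 1) +ᵥ ((s : ℝ) +ᵥ ω)))
        = fun r : ℝ => c (r +ᵥ (((s : ℝ) + 1) +ᵥ ω)) := by
      intro c
      funext r
      rw [vadd_vadd, vadd_vadd, add_assoc, add_comm 1]
    rw [h2, h2] at h1
    rw [← h1, two_mul, Real.exp_add, mul_assoc]
    refine (norm_delayOp_orbit_le hq0 hq' hq1 hb h ω (by linarith) (by linarith) (by linarith)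
      (by linarith) _).trans ?_
    gcongr
    exact norm_delayOp_orbit_le hq0 hq' hq1 hb h ω hs zero_le_one le_rfl (by linarith) u

end Orbits

/-! ### The focusing constant -/

section Kappa

variable {Ω : Type*} [AddAction ℝ Ω] {p q : ℝ≥0∞} {a b : Ω → ℝ}

lemma kappa_eq (a b : Ω → ℝ) (ω : Ω) :
    kappa a b ω = Real.exp (∫ r in (1 : ℝ)..2, |a (r +ᵥ ω)|) *
      (1 + focusWeight (fun t : ℝ => a (t +ᵥ ω)) fun t : ℝ => b (t +ᵥ ω)) := by
  rw [kappa, cFun, integral_orbit_vadd (fun ω => |a ω|), zero_add, one_add_one_eq_two]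
  rfl

lemma one_le_kappa (hb0 : ∀ ω, 0 ≤ b ω) (ω : Ω) : 1 ≤ kappa a b ω := by
  rw [kappa_eq]
  have h1 : 0 ≤ focusWeight (fun t : ℝ => a (t +ᵥ ω)) fun t : ℝ => b (t +ᵥ ω) :=
    focusWeight_nonneg fun t => hb0 _
  have h2 : 0 ≤ ∫ r in (1 : ℝ)..2, |a (r +ᵥ ω)| :=
    intervalIntegral.integral_nonneg one_le_two fun _ _ => abs_nonneg _
  exact one_le_mul_of_one_le_of_one_le (Real.one_le_exp h2) (by linarith)

variable [MeasurableSpace Ω] [MeasurableVAdd₂ ℝ Ω]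

lemma measurable_kappa (ha : Measurable a) (hb : Measurable b) : Measurable (kappa a b) := by
  have h1 : Measurable (Function.uncurry fun (x : Ω × ℝ) (r : ℝ) => a (r +ᵥ x.1)) :=
    (measurable_orbit ha).comp (measurable_snd.prodMk (measurable_fst.comp measurable_fst))
  have h2 : Measurable fun x : Ω × ℝ => ∫ r in (x.2 - 1)..x.2, a (r +ᵥ x.1) :=
    measurable_intervalIntegral h1 (measurable_snd.sub_const 1) measurable_snd
  have h3 : Measurable (Function.uncurry fun (ω : Ω) (s : ℝ) =>
      Real.exp (-∫ r in (s - 1)..s, a (r +ᵥ ω)) * b (s +ᵥ ω)) :=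
    h2.neg.exp.mul ((measurable_orbit hb).comp measurable_swap)
  have h4 : Measurable (cFun a) := (measurable_orbit_intervalIntegral ha.norm 0 1).exp
  exact (h4.comp (measurable_const_vadd (1 : ℝ))).mul
    ((measurable_intervalIntegral h3 measurable_const measurable_const).const_add 1)

/-- By `x ≤ 1 + x ^ q`. -/
lemma integral_orbit_le_one_add_orbitEnergy (hq0 : q ≠ 0) (hq' : q ≠ ∞) (hq1 : 1 ≤ q)
    (hb : Measurable b) (hb0 : ∀ ω, 0 ≤ b ω)
    (h : ∀ ω, IsDelayCoeff q (fun t : ℝ => a (t +ᵥ ω)) (fun t : ℝ => b (t +ᵥ ω))) (ω : Ω) :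
    ∫ s in (1 : ℝ)..2, b (s +ᵥ ω) ≤ 1 + orbitEnergy q b ((1 : ℝ) +ᵥ ω) := by
  have hE := orbitEnergy_nonneg q b ((1 : ℝ) +ᵥ ω)
  have hqr : 1 ≤ q.toReal := by
    rwa [← ENNReal.toReal_one, ENNReal.toReal_le_toReal ENNReal.one_ne_top hq']
  rw [intervalIntegral.integral_of_le one_le_two, ← integral_Icc_eq_integral_Ioc,
    integral_eq_lintegral_of_nonneg_ae (Eventually.of_forall fun s => hb0 _)
      (measurable_orbit_left hb ω).aestronglyMeasurable]
  refine ENNReal.toReal_le_of_le_ofReal (by linarith) ?_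
  rw [ENNReal.ofReal_add zero_le_one hE, (h _).ofReal_orbitEnergy hq0 hq',
    setLIntegral_orbit_vadd hb, zero_add, one_add_one_eq_two, ENNReal.ofReal_one]
  calc ∫⁻ s in Icc (1 : ℝ) 2, ENNReal.ofReal (b (s +ᵥ ω))
      ≤ ∫⁻ s in Icc (1 : ℝ) 2, (1 + ‖b (s +ᵥ ω)‖ₑ ^ q.toReal) := by
        refine lintegral_mono fun s => ?_
        rw [← Real.enorm_of_nonneg (hb0 _)]
        rcases le_total ‖b (s +ᵥ ω)‖ₑ 1 with h1 | h1
        · exact le_add_right h1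
        · exact le_add_left ((ENNReal.rpow_one _).symm.trans_le
            (ENNReal.rpow_le_rpow_of_exponent_le h1 hqr))
    _ = _ := by
        rw [lintegral_add_left measurable_const, setLIntegral_one, Real.volume_Icc]
        norm_num

lemma log_kappa_le (hq0 : q ≠ 0) (hq' : q ≠ ∞) (hq1 : 1 ≤ q) (hb : Measurable b)
    (hb0 : ∀ ω, 0 ≤ b ω)
    (h : ∀ ω, IsDelayCoeff q (fun t : ℝ => a (t +ᵥ ω)) (fun t : ℝ => b (t +ᵥ ω))) (ω : Ω) :
    Real.log (kappa a b ω) ≤ growthExponent q a b ω := by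
  have : Fact (1 ≤ q) := ⟨hq1⟩
  have hE1 := orbitEnergy_nonneg q b ω
  have hE2 := orbitEnergy_nonneg q b ((1 : ℝ) +ᵥ ω)
  set K := ∫ r in (0 : ℝ)..2, |a (r +ᵥ ω)| with hK
  have hi := ((h ω).intervalIntegrable 0 2).abs
  have hK0 : 0 ≤ K := intervalIntegral.integral_nonneg zero_le_two fun _ _ => abs_nonneg _
  have hsub : ∀ {x y : ℝ}, 0 ≤ x → x ≤ y → y ≤ 2 → ∫ r in x..y, |a (r +ᵥ ω)| ≤ K :=
    fun h1 h2 h3 => intervalIntegral.integral_mono_interval h1 h2 h3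
      (Eventually.of_forall fun _ => abs_nonneg _) hi
  have hW : focusWeight (fun t : ℝ => a (t +ᵥ ω)) (fun t : ℝ => b (t +ᵥ ω))
      ≤ Real.exp K * (1 + orbitEnergy q b ((1 : ℝ) +ᵥ ω)) := by
    have hbi : IntervalIntegrable (fun s : ℝ => b (s +ᵥ ω)) volume 1 2 := by
      rw [intervalIntegrable_iff_integrableOn_Icc_of_le one_le_two]
      exact ((h ω).memLp 1 2).integrable hq1
    calc focusWeight (fun t : ℝ => a (t +ᵥ ω)) (fun t : ℝ => b (t +ᵥ ω))
        ≤ ∫ s in (1 : ℝ)..2, Real.exp K * b (s +ᵥ ω) := by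
          refine intervalIntegral.integral_mono_on one_le_two (h ω).intervalIntegrable_weight
            (hbi.const_mul _) fun s hs => ?_
          refine mul_le_mul_of_nonneg_right (Real.exp_le_exp.2 ?_) (hb0 _)
          refine (neg_le_abs _).trans ((intervalIntegral.abs_integral_le_integral_abs
            (by linarith)).trans (hsub (by linarith [hs.1]) (by linarith) hs.2))
      _ = Real.exp K * ∫ s in (1 : ℝ)..2, b (s +ᵥ ω) := intervalIntegral.integral_const_mul _ _
      _ ≤ _ := by
          gcongr
          exact integral_orbit_le_one_add_orbitEnergy hq0 hq' hq1 hb hb0 h ω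
  have hκ : kappa a b ω ≤ Real.exp (growthExponent q a b ω) := by
    have hW0 : 0 ≤ focusWeight (fun t : ℝ => a (t +ᵥ ω)) (fun t : ℝ => b (t +ᵥ ω)) :=
      focusWeight_nonneg fun t => hb0 _
    have hk : 1 ≤ Real.exp K := Real.one_le_exp hK0
    rw [kappa_eq, exp_growthExponent]
    calc Real.exp (∫ r in (1 : ℝ)..2, |a (r +ᵥ ω)|) *
          (1 + focusWeight (fun t : ℝ => a (t +ᵥ ω)) fun t : ℝ => b (t +ᵥ ω))
        ≤ Real.exp K * (Real.exp K * (2 * (1 + orbitEnergy q b ((1 : ℝ) +ᵥ ω)))) := by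
          have h1 := hsub zero_le_one one_le_two le_rfl
          refine mul_le_mul (Real.exp_le_exp.2 h1) ?_ (by linarith) (Real.exp_pos _).le
          nlinarith
      _ = 2 * Real.exp (2 * K) * 1 * (1 + orbitEnergy q b ((1 : ℝ) +ᵥ ω)) := by
          rw [two_mul K, Real.exp_add]; ring
      _ ≤ _ := by
          gcongr
          · norm_num
          · linarith
  rw [← Real.log_exp (growthExponent q a b ω)]
  exact Real.log_le_log (zero_lt_one.trans_le (one_le_kappa hb0 ω)) hκ

/-! ### The lower bound for the exponent -/

section LowerBound

variable [Fact (1 ≤ p)] [p.HolderConjugate q]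

/-- Any principal exponent dominates the growth rate of the equation without delay. Only the vector
`w ω` for a single `ω` matters: its orbit does not vanish, so that the solution is positive at time
`1` and grows from there on at least like `exp (∫ a)`. -/
theorem integral_le_of_isPrincipalLyapunovExponent {P : Measure Ω} [IsProbabilityMeasure P]
    [ErgodicVAdd ℝ Ω P] (hp' : p ≠ ∞) (hq1 : 1 ≤ q) (ha : Measurable a) (hai : Integrable a P)
    (hb : Measurable b) (hb0 : ∀ ω, 0 ≤ b ω)
    (h : ∀ ω, IsDelayCoeff q (fun t : ℝ => a (t +ᵥ ω)) (fun t : ℝ => b (t +ᵥ ω))) {lam : EReal}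
    (hlam : IsPrincipalLyapunovExponent P (posCone p) (delaySemiflow hp' ha hb h) lam) :
    ((∫ ω, a ω ∂P : ℝ) : EReal) ≤ lam := by
  have : Fact (1 ≤ q) := ⟨hq1⟩
  obtain ⟨-, S, w, hSm, hSinv, hSP, -, hS⟩ := hlam
  set F : ℝ≥0 → Ω → ℝ := fun t ω => prim (fun r : ℝ => a (r +ᵥ ω)) t with hF
  have hFcoc : IsAdditiveCocycle F := by
    intro s t ω
    simp only [hF, orbit_vadd]
    rw [NNReal.coe_add, add_comm, (h ω).prim_add]
  have hlim := hFcoc.tendsto_div (P := P) (measurable_orbit_intervalIntegral ha 0 1)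
    (integrable_orbit_integral P ha.norm hai.norm zero_le_one)
    (measurable_orbit_intervalIntegral ha.norm 0 1) (fun t ht ω => by
      have ht' : (t : ℝ) ≤ 1 := by exact_mod_cast ht
      refine (intervalIntegral.abs_integral_le_integral_abs t.coe_nonneg).trans ?_
      exact intervalIntegral.integral_mono_interval le_rfl t.coe_nonneg ht'
        (Eventually.of_forall fun _ => abs_nonneg _) ((h ω).intervalIntegrable 0 1).abs)
  have hI : ∫ ω, F 1 ω ∂P = ∫ ω, a ω ∂P := integral_orbit_integral P ha hai
  rw [hI] at hlim
  have hSae : ∀ᵐ ω ∂P, ω ∈ S := by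
    rw [← prob_compl_eq_zero_iff hSm] at hSP
    exact hSP
  obtain ⟨ω, hωS, hωlim⟩ := (hSae.and hlim).exists
  obtain ⟨hwK, -, hspan, hwlim, -⟩ := hS ω hωS
  set z := delaySol (fun r : ℝ => a (r +ᵥ ω)) (fun r : ℝ => b (r +ᵥ ω)) (w ω) with hz
  have hm : IsMild (fun r : ℝ => a (r +ᵥ ω)) (fun r : ℝ => b (r +ᵥ ω)) (w ω) z := isMild_delaySol
  have hβ : ∀ t : ℝ, 0 ≤ b (t +ᵥ ω) := fun t => hb0 _
  -- a solution vanishing at time `1` would be annihilated at time `2`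
  have hz1 : 0 < z 1 := by
    refine (hm.nonneg hβ hwK 1 zero_le_one).lt_of_ne fun h0 => ?_
    have h2 : (delaySemiflow (p := p) hp' ha hb h).U ω 2 (w ω) = 0 :=
      delayOp_two_eq_zero (h ω) hβ hwK h0.symm
    have h3 := hspan 2 two_pos
    rw [Submodule.map_span, image_singleton] at h3
    have h4 : ((delaySemiflow (p := p) hp' ha hb h).U ω 2).toLinearMap (w ω) = 0 := h2
    rw [h4, Submodule.span_zero_singleton, eq_comm, Submodule.span_singleton_eq_bot] at h3
    have h5 : ((2 : ℝ≥0) : ℝ) +ᵥ ω ∈ S := by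
      have : ω ∈ (fun ω => ((2 : ℝ≥0) : ℝ) +ᵥ ω) ⁻¹' S := by rwa [hSinv]
      exact this
    exact (hS _ h5).2.1 h3
  set c := Real.log (z 1) - F 1 ω with hc
  have h1 : Tendsto (fun t : ℝ≥0 => c / t + F t ω / t) atTop (𝓝 (∫ ω, a ω ∂P)) := by
    have h2 : Tendsto (fun t : ℝ≥0 => c / (t : ℝ)) atTop (𝓝 0) :=
      tendsto_const_nhds.div_atTop (NNReal.tendsto_coe_atTop.2 tendsto_id)
    simpa using h2.add hωlim
  refine le_of_tendsto_of_tendsto ((continuous_coe_real_ereal.tendsto _).comp h1) hwlim ?_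
  filter_upwards [eventually_ge_atTop 1] with t ht
  have ht' : (1 : ℝ) ≤ t := by exact_mod_cast ht
  have h2 : Real.exp (c + F t ω) ≤ ‖(delaySemiflow (p := p) hp' ha hb h).U ω t (w ω)‖ := by
    have h3 := hm.exp_mul_le (h ω) hβ hwK zero_le_one ht'
    have h4 : (delayOp (fun r : ℝ => a (r +ᵥ ω)) (fun r : ℝ => b (r +ᵥ ω)) t (w ω)).fst = z t := rfl
    change _ ≤ ‖delayOp (fun r : ℝ => a (r +ᵥ ω)) (fun r : ℝ => b (r +ᵥ ω)) t (w ω)‖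
    rw [DelaySpace.norm_eq, h4]
    have h5 : Real.exp (c + F t ω) = Real.exp (prim (fun r : ℝ => a (r +ᵥ ω)) t -
        prim (fun r : ℝ => a (r +ᵥ ω)) 1) * z 1 := by
      rw [← Real.exp_log hz1, ← Real.exp_add]
      congr 1
      simp only [hc, hF, NNReal.coe_one]
      ring
    rw [h5]
    exact h3.trans ((le_abs_self _).trans (le_add_of_nonneg_right (norm_nonneg _)))
  simp only [Function.comp, ← add_div]
  rw [EReal.coe_div]
  refine EReal.div_le_div_right_of_nonneg (by exact_mod_cast t.2) ?_
  rw [← Real.log_exp (c + F t ω), ← ENNReal.log_ofReal_of_pos (Real.exp_pos _), ← ofReal_norm]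
  exact ENNReal.log_monotone (ENNReal.ofReal_le_ofReal h2)

end LowerBound

end Kappa

/-! ### Properties of the generated semiflow -/

section Semiflow

variable {Ω : Type*} [MeasurableSpace Ω] [AddAction ℝ Ω] [MeasurableVAdd₂ ℝ Ω]
  {p q : ℝ≥0∞} [Fact (1 ≤ p)] [p.HolderConjugate q] {a b : Ω → ℝ}

lemma tendsto_delaySemiflow_zero (hp' : p ≠ ∞) (ha : Measurable a) (hb : Measurable b)
    (h : ∀ ω, IsDelayCoeff q (fun t : ℝ => a (t +ᵥ ω)) (fun t : ℝ => b (t +ᵥ ω))) (ω : Ω)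
    (u : DelaySpace p) :
    Tendsto (fun t => (delaySemiflow hp' ha hb h).U ω t u) (𝓝 0) (𝓝 u) := by
  refine (tendsto_delayOp_zero hp' (h ω) u).comp ?_
  refine tendsto_nhdsWithin_of_tendsto_nhds_of_eventually_within _ ?_
    (Eventually.of_forall fun t => t.2)
  exact NNReal.continuous_coe.tendsto 0

lemma positivityA2_delaySemiflow (hp' : p ≠ ∞) (ha : Measurable a) (hb : Measurable b)
    (hb0 : ∀ ω, 0 ≤ b ω)
    (h : ∀ ω, IsDelayCoeff q (fun t : ℝ => a (t +ᵥ ω)) (fun t : ℝ => b (t +ᵥ ω))) :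
    PositivityA2 (posCone p) (delaySemiflow hp' ha hb h) := by
  intro ω t u v huv
  rw [ConeLE, ← map_sub]
  exact delayOp_mem_posCone (h ω) (fun t => hb0 _) t.2 huv

lemma exp_prim_half_le_norm_delaySemiflow (hp' : p ≠ ∞) (ha : Measurable a) (hb : Measurable b)
    (hb0 : ∀ ω, 0 ≤ b ω)
    (h : ∀ ω, IsDelayCoeff q (fun t : ℝ => a (t +ᵥ ω)) (fun t : ℝ => b (t +ᵥ ω))) (ω : Ω)
    (t : ℝ≥0) : Real.exp (prim (fun r : ℝ => a (r +ᵥ ω)) t) / 2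
      ≤ ‖(delaySemiflow (p := p) hp' ha hb h).U ω t (halfVec p)‖ :=
  le_norm_delayOp_halfVec (h ω) (fun _ => hb0 _) t.2

lemma delaySemiflow_halfVec_ne_zero (hp' : p ≠ ∞) (ha : Measurable a) (hb : Measurable b)
    (hb0 : ∀ ω, 0 ≤ b ω)
    (h : ∀ ω, IsDelayCoeff q (fun t : ℝ => a (t +ᵥ ω)) (fun t : ℝ => b (t +ᵥ ω))) (ω : Ω)
    (t : ℝ≥0) : (delaySemiflow (p := p) hp' ha hb h).U ω t (halfVec p) ≠ 0 := by
  rw [← norm_pos_iff]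
  exact (half_pos (Real.exp_pos _)).trans_le
    (exp_prim_half_le_norm_delaySemiflow hp' ha hb hb0 h ω t)

lemma delaySemiflow_focusing (hp' : p ≠ ∞) (hq1 : 1 ≤ q) (ha : Measurable a) (hb : Measurable b)
    (hb0 : ∀ ω, 0 ≤ b ω)
    (h : ∀ ω, IsDelayCoeff q (fun t : ℝ => a (t +ᵥ ω)) (fun t : ℝ => b (t +ᵥ ω))) (ω : Ω)
    {u : DelaySpace p} (hu : u ∈ posCone p) :
    (delaySemiflow hp' ha hb h).U ω 2 u = 0 ∨ ((delaySemiflow hp' ha hb h).U ω 2 u ≠ 0 ∧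
      ∃ β : ℝ, 0 < β ∧ ConeLE (posCone p) (β • halfVec p) ((delaySemiflow hp' ha hb h).U ω 2 u) ∧
        ConeLE (posCone p) ((delaySemiflow hp' ha hb h).U ω 2 u)
          ((kappa a b ω * β) • halfVec p)) := by
  have : Fact (1 ≤ q) := ⟨hq1⟩
  rw [kappa_eq]
  exact delayOp_two_focusing (h ω) (fun t => hb0 _) hu

variable {P : Measure Ω} [IsProbabilityMeasure P]

lemma integrable_log_kappa [VAddInvariantMeasure ℝ Ω P] (hq' : q ≠ ∞) (hq1 : 1 ≤ q)
    (ha : Measurable a) (hai : Integrable a P) (hb : Measurable b) (hb0 : ∀ ω, 0 ≤ b ω)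
    (h : ∀ ω, IsDelayCoeff q (fun t : ℝ => a (t +ᵥ ω)) (fun t : ℝ => b (t +ᵥ ω)))
    (hi : ∫⁻ ω, lnPlus (∫⁻ r in Icc (0 : ℝ) 1, ‖b (r +ᵥ ω)‖ₑ ^ q.toReal) ∂P < ∞) :
    Integrable (fun ω => Real.log (kappa a b ω)) P := by
  have hq0 : q ≠ 0 := (zero_lt_one.trans_le hq1).ne'
  refine (integrable_growthExponent hq0 hq' ha hai hb h hi).mono'
    (Real.measurable_log.comp (measurable_kappa ha hb)).aestronglyMeasurable
    (Eventually.of_forall fun ω => ?_)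
  rw [Real.norm_of_nonneg (Real.log_nonneg (one_le_kappa hb0 ω))]
  exact log_kappa_le hq0 hq' hq1 hb hb0 h ω

omit [IsProbabilityMeasure P] in
lemma focusingA3_delaySemiflow (hp' : p ≠ ∞) (hq1 : 1 ≤ q) (ha : Measurable a)
    (hb : Measurable b) (hb0 : ∀ ω, 0 ≤ b ω)
    (h : ∀ ω, IsDelayCoeff q (fun t : ℝ => a (t +ᵥ ω)) (fun t : ℝ => b (t +ᵥ ω)))
    (hκi : Integrable (fun ω => Real.log (kappa a b ω)) P) :
    FocusingA3 P (posCone p) (delaySemiflow hp' ha hb h) 2 (halfVec p) (kappa a b) := by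
  have hκm := measurable_kappa ha hb
  refine ⟨positivityA2_delaySemiflow hp' ha hb hb0 h, halfVec_mem_posCone p, norm_halfVec,
    fun ω => delaySemiflow_halfVec_ne_zero hp' ha hb hb0 h ω 2, hκm, one_le_kappa hb0, ?_,
    fun ω u hu _ => delaySemiflow_focusing hp' hq1 ha hb hb0 h ω hu⟩
  have hm : Measurable fun ω => Real.posLog (Real.log (kappa a b ω)) :=
    measurable_const.max (Real.measurable_log.comp (Real.measurable_log.comp hκm))
  refine hκi.mono' hm.aestronglyMeasurable (Eventually.of_forall fun ω => ?_)
  have h0 : 0 ≤ Real.log (kappa a b ω) := Real.log_nonneg (one_le_kappa hb0 ω)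
  rw [Real.norm_of_nonneg Real.posLog_nonneg, Real.posLog_def]
  exact max_le h0 (Real.log_le_self h0)

lemma exists_isPrincipalLyapunovExponent_delaySemiflow [ErgodicVAdd ℝ Ω P] (hp' : p ≠ ∞)
    (hq' : q ≠ ∞) (hq1 : 1 ≤ q) (ha : Measurable a) (hai : Integrable a P) (hb : Measurable b)
    (hb0 : ∀ ω, 0 ≤ b ω)
    (h : ∀ ω, IsDelayCoeff q (fun t : ℝ => a (t +ᵥ ω)) (fun t : ℝ => b (t +ᵥ ω)))
    (hi : ∫⁻ ω, lnPlus (∫⁻ r in Icc (0 : ℝ) 1, ‖b (r +ᵥ ω)‖ₑ ^ q.toReal) ∂P < ∞) :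
    ∃ lam : EReal, IsPrincipalLyapunovExponent P (posCone p)
      (delaySemiflow (p := p) hp' ha hb h) lam := by
  have : Fact (p ≠ ∞) := ⟨hp'⟩
  have hq0 : q ≠ 0 := (zero_lt_one.trans_le hq1).ne'
  have hfoc : IsFocusing (posCone p) (delaySemiflow (p := p) hp' ha hb h) 2 (halfVec p)
      (kappa a b) :=
    { cone := isMonotoneCone_posCone
      positive := fun ω t u hu => delayOp_mem_posCone (h ω) (fun t => hb0 _) t.2 hu
      e_mem := halfVec_mem_posCone p
      norm_e := norm_halfVec
      U_e_ne_zero := delaySemiflow_halfVec_ne_zero hp' ha hb hb0 h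
      one_le := one_le_kappa hb0
      focus := fun ω u hu => (delaySemiflow_focusing hp' hq1 ha hb hb0 h ω hu).imp_right And.right }
  refine hfoc.exists_isPrincipalLyapunovExponent (measurable_kappa ha hb)
    (integrable_log_kappa hq' hq1 ha hai hb hb0 h hi)
    (H := fun ω => 2 * growthExponent q a b ω)
    (L := fun ω => (∫ r in (0 : ℝ)..1, |a (r +ᵥ ω)|) + Real.log 2)
    ((measurable_growthExponent q ha hb).const_mul 2)
    ((integrable_growthExponent hq0 hq' ha hai hb h hi).const_mul 2)
    ((measurable_orbit_intervalIntegral ha.norm 0 1).add_const _)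
    ((integrable_orbit_integral P ha.norm hai.norm zero_le_one).add (integrable_const _))
    (fun ω t ht => ?_) (fun ω t ht => ?_)
  · have h1 : ‖(delaySemiflow (p := p) hp' ha hb h).U (((0 : ℝ≥0) : ℝ) +ᵥ ω) t‖
        ≤ Real.exp (2 * growthExponent q a b ω) :=
      norm_delayCLM_orbit_le (p := p) hq0 hq' hq1 hb h ω
        (by rw [zero_add]; exact ht.trans one_le_two)
    simpa only [NNReal.coe_zero, zero_vadd] using h1
  · refine le_trans ?_ (exp_prim_half_le_norm_delaySemiflow hp' ha hb hb0 h ω t)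
    have ht' : (t : ℝ) ≤ 1 := by exact_mod_cast ht
    have h1 : |prim (fun r : ℝ => a (r +ᵥ ω)) t| ≤ ∫ r in (0 : ℝ)..1, |a (r +ᵥ ω)| :=
      (intervalIntegral.abs_integral_le_integral_abs t.coe_nonneg).trans
        (intervalIntegral.integral_mono_interval le_rfl t.coe_nonneg ht'
          (Eventually.of_forall fun _ => abs_nonneg _) ((h ω).intervalIntegrable 0 1).abs)
    rw [neg_add, Real.exp_add, Real.exp_neg (Real.log 2), Real.exp_log two_pos, div_eq_mul_inv]
    gcongr
    linarith [neg_abs_le (prim (fun r : ℝ => a (r +ᵥ ω)) t)]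

end Semiflow

end RandomDelay

end

theorem mainTheorem6 {Ω : Type*} [MeasurableSpace Ω] [AddAction ℝ Ω] [MeasurableVAdd₂ ℝ Ω]
    (P : Measure Ω) [IsProbabilityMeasure P] [ErgodicVAdd ℝ Ω P]
    (p q : ℝ≥0∞) [Fact (1 ≤ p)] [p.HolderConjugate q] (hp : 1 < p) (hp' : p < ∞)
    (a b : Ω → ℝ) (hS1 : RandomDelay.AssumptionS1 P q a b) (hS2 : RandomDelay.AssumptionS2 b) :
    RandomDelay.normA a =ᵐ[P] a ∧ RandomDelay.normB q b =ᵐ[P] b ∧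
    ∃ Φ : RandomDelay.SkewProductSemiflow Ω (RandomDelay.DelaySpace p),
      RandomDelay.IsGeneratedBy Φ (RandomDelay.normA a) (RandomDelay.normB q b) ∧
      RandomDelay.IntegrabilityA1 P Φ 2 ∧
      RandomDelay.PositivityA2 (RandomDelay.posCone p) Φ ∧
      RandomDelay.FocusingA3 P (RandomDelay.posCone p) Φ 2 (RandomDelay.halfVec p)
        (RandomDelay.kappa (RandomDelay.normA a) (RandomDelay.normB q b)) ∧
      Integrable (fun ω => Real.log
        (RandomDelay.kappa (RandomDelay.normA a) (RandomDelay.normB q b) ω)) P ∧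
      (∃ lam : EReal, RandomDelay.IsPrincipalLyapunovExponent P (RandomDelay.posCone p) Φ lam) ∧
      ∀ lam : EReal, RandomDelay.IsPrincipalLyapunovExponent P (RandomDelay.posCone p) Φ lam →
        ((∫ ω, a ω ∂P : ℝ) : EReal) ≤ lam := by
  obtain ⟨ha, hb, hai, hi⟩ := hS1
  have hq1 : 1 ≤ q := ENNReal.HolderConjugate.one_le q p
  have hq0 : q ≠ 0 := ENNReal.HolderConjugate.ne_zero q p
  have hq' : q ≠ ∞ := (ENNReal.HolderConjugate.lt_top_iff_one_lt q p).2 hp |>.ne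
  have hAe := RandomDelay.normA_ae_eq P ha hai
  have hA := RandomDelay.measurable_normA ha
  have hB := RandomDelay.measurable_normB hq0 hq' hb
  have hAi : Integrable (RandomDelay.normA a) P := hai.congr hAe.symm
  have hB0 := RandomDelay.normB_nonneg q hS2
  have h := RandomDelay.isDelayCoeff_norm q a b
  have hBi : ∫⁻ ω, RandomDelay.lnPlus
      (∫⁻ r in Icc (0 : ℝ) 1, ‖RandomDelay.normB q b (r +ᵥ ω)‖ₑ ^ q.toReal) ∂P < ∞ := by
    refine (lintegral_mono fun ω => RandomDelay.lnPlus_mono (lintegral_mono fun r => ?_)).trans_lt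
      hi
    gcongr
    rw [RandomDelay.normB]
    split_ifs
    · exact le_rfl
    · simp
  have hκi := RandomDelay.integrable_log_kappa hq' hq1 hA hAi hB hB0 h hBi
  have : Fact (p ≠ ∞) := ⟨hp'.ne⟩
  refine ⟨hAe, RandomDelay.normB_ae_eq P hq0 hq' hb hi,
    RandomDelay.delaySemiflow hp'.ne hA hB h,
    RandomDelay.isGeneratedBy_delaySemiflow hp'.ne hA hB h,
    RandomDelay.integrabilityA1_of_norm_le
      (RandomDelay.tendsto_delaySemiflow_zero hp'.ne hA hB h)
      ((RandomDelay.integrable_growthExponent hq0 hq' hA hAi hB h hBi).const_mul 2)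
      (fun ω s t hst => RandomDelay.norm_delayCLM_orbit_le hq0 hq' hq1 hB h ω hst),
    RandomDelay.positivityA2_delaySemiflow hp'.ne hA hB hB0 h,
    RandomDelay.focusingA3_delaySemiflow hp'.ne hq1 hA hB hB0 h hκi, hκi,
    RandomDelay.exists_isPrincipalLyapunovExponent_delaySemiflow hp'.ne hq' hq1 hA hAi hB hB0 h hBi,
    fun lam hlam => ?_⟩
  rw [← integral_congr_ae hAe]
  exact RandomDelay.integral_le_of_isPrincipalLyapunovExponent hp'.ne hq1 hA hAi hB hB0 h hlam
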